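/- Let $\Sigma$ be a finite reduced crystallographic root system with Weyl group $W_0$, a fixed base $(\alpha_i)_{i\in S_0}$, positive roots $\Sigma^+$, length function $\ell$ (with respect to the simple reflections) and Bruhat order $\leq$ on $W_0$; write $2\rho=\sum_{\alpha\in\Sigma^+}\alpha$. For coweights write $\gamma'\leq\gamma$ if $\gamma-\gamma'\in\sum_{i}\mathbb Z_{\geq 0}\alpha_i^\vee$; for roots write $\alpha\leq\beta$ if $\beta-\alpha\in\sum_i\mathbb Z_{\geq0}\alpha_i$. The quantum Bruhat graph is the directed graph with vertex set $W_0$ and an edge $x\to xs_\alpha$ ($x\in W_0$, $\alpha\in\Sigma^+$) whenever $\ell(xs_\alpha)=\ell(x)+1$ (a Bruhat edge, of weight $0$) or $\ell(xs_\alpha)=\ell(x)+1-\langle\alpha^\vee,2\rho\rangle$ (a quantum edge, of weight $\alpha^\vee$). The weight of a path is the sum of the weights of its edges, and $\mathrm{wt}(x,y)$ is the weight of a shortest path from $x$ to $y$. For $u,v\in W_0$ the Demazure product $u*v$ is the maximum, in the Bruhat order, of $\{u'v' : u'\leq u,\ v'\leq v\}$. For $\gamma\in\sum_i\mathbb Z_{\geq0}\alpha_i^\vee$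 define $z_\gamma\in W_0$ recursively by $z_0=1$ and, for $\gamma\neq0$, $z_\gamma=z_{\gamma-\beta^\vee}*s_\beta$, where $\beta$ is any element that is maximal, in the order on roots, among the $\beta\in\Sigma^+$ with $\beta^\vee\leq\gamma$. Then the Demazure product and the weights $\mathrm{wt}(x,1)$, $x \in W_0$, are well defined, $z_\gamma$ exists and does not depend on the choices of the maximal roots $\beta$, and $z_\gamma$ is the (unique) maximum in the Bruhat order of the set $\{x\in W_0 : \mathrm{wt}(x,1)\leq\gamma\}$. -/

import Mathlib

open scoped BigOperators

noncomputable section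

namespace QuantumBruhat

variable {ι M N : Type*} [AddCommGroup M] [Module ℝ M] [AddCommGroup N] [Module ℝ N]
variable {P : RootPairing ι ℝ M N}

/-- The length of `w` in the Weyl group: the least number of factors in an expression of `w` as a
product of simple reflections. -/
def length (b : P.Base) (w : P.weylGroup) : ℕ :=
  sInf {n : ℕ | ∃ l : List ι, (∀ i ∈ l, i ∈ b.support) ∧ l.length = n ∧
    (l.map (RootPairing.weylGroup.ofIdx P)).prod = w}

/-- One step up in the Bruhat order: right multiplication by a reflection that increases the
length. -/
def BruhatStep (b : P.Base) (x y : P.weylGroup) : Prop :=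
  ∃ i : ι, y = x * RootPairing.weylGroup.ofIdx P i ∧ length b x < length b y

theorem length_le_of_reflTransGen {b : P.Base} {x y : P.weylGroup}
    (h : Relation.ReflTransGen (BruhatStep b) x y) : length b x ≤ length b y := by
  induction h with
  | refl => exact le_rfl
  | tail _ hs ih =>
    obtain ⟨_, _, hlt⟩ := hs
    exact ih.trans hlt.le

/-- The Bruhat order on the Weyl group (with respect to the simple reflections of `b`). -/
@[reducible]
def bruhatOrder (b : P.Base) : PartialOrder P.weylGroup where
  le := Relation.ReflTransGen (BruhatStep b)
  le_refl _ := Relation.ReflTransGen.refl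
  le_trans _ _ _ := Relation.ReflTransGen.trans
  le_antisymm x y hxy hyx := by
    rcases Relation.ReflTransGen.cases_tail hxy with h | ⟨c, hxc, hcy⟩
    · exact h.symm
    · obtain ⟨_, _, hlt⟩ := hcy
      have h1 := length_le_of_reflTransGen hxc
      have h2 := length_le_of_reflTransGen hyx
      exact absurd hlt (by omega)

/-- `z` is the maximum (greatest element) of `S` in the Bruhat order. -/
def IsBruhatMax (b : P.Base) (S : Set P.weylGroup) (z : P.weylGroup) : Prop :=
  letI := bruhatOrder b
  IsGreatest S z

/-- `w` is the Demazure product of `u` and `v`: the maximum of `{u' v' | u' ≤ u, v' ≤ v}`. -/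
def IsDemazureProduct (b : P.Base) (u v w : P.weylGroup) : Prop :=
  IsBruhatMax b {y | ∃ u' v' : P.weylGroup,
    (bruhatOrder b).le u' u ∧ (bruhatOrder b).le v' v ∧ y = u' * v'} w

/-- The Demazure product `u * v`. -/
def demazure (b : P.Base) (u v : P.weylGroup) : P.weylGroup :=
  Classical.epsilon (IsDemazureProduct b u v)

open Classical in
/-- The sum `2ρ` of the positive roots. -/
def twoRho [Fintype ι] (b : P.Base) : M :=
  ∑ j : ι with b.IsPos j, P.root j

/-- Bruhat edges `x → x s_α` of the quantum Bruhat graph, `α` the positive root of index `i`. -/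
def IsBruhatEdge (b : P.Base) (x : P.weylGroup) (i : ι) : Prop :=
  b.IsPos i ∧ length b (x * RootPairing.weylGroup.ofIdx P i) = length b x + 1

/-- Quantum edges `x → x s_α` of the quantum Bruhat graph, `α` the positive root of index `i`:
`ℓ(x s_α) = ℓ(x) + 1 - ⟨α^∨, 2ρ⟩`. -/
def IsQuantumEdge [Fintype ι] (b : P.Base) (x : P.weylGroup) (i : ι) : Prop :=
  b.IsPos i ∧ (length b (x * RootPairing.weylGroup.ofIdx P i) : ℝ) =
    (length b x : ℝ) + 1 - P.toLinearMap (twoRho b) (P.coroot i)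

/-- `IsPath b x y n ω`: there is a path in the quantum Bruhat graph from `x` to `y` with `n` edges
and of weight `ω`. A Bruhat edge has weight `0` and a quantum edge `x → x s_α` has weight the
coroot of `α`. -/
inductive IsPath [Fintype ι] (b : P.Base) :
    P.weylGroup → P.weylGroup → ℕ → N → Prop
  | nil (x : P.weylGroup) : IsPath b x x 0 0
  | bruhat (x y : P.weylGroup) (i : ι) (n : ℕ) (ω : N) (hi : IsBruhatEdge b x i)
      (hp : IsPath b (x * RootPairing.weylGroup.ofIdx P i) y n ω) : IsPath b x y (n + 1) ω
  | quantum (x y : P.weylGroup) (i : ι) (n : ℕ) (ω : N) (hi : IsQuantumEdge b x i)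
      (hp : IsPath b (x * RootPairing.weylGroup.ofIdx P i) y n ω) :
      IsPath b x y (n + 1) (P.coroot i + ω)

/-- `ω` is the weight of some shortest path from `x` to `y` in the quantum Bruhat graph. -/
def IsShortestPathWeight [Fintype ι] (b : P.Base) (x y : P.weylGroup) (ω : N) : Prop :=
  ∃ n : ℕ, IsPath b x y n ω ∧ ∀ (n' : ℕ) (ω' : N), IsPath b x y n' ω' → n ≤ n'

/-- The weight `wt(x, y)`: the weight of a shortest path from `x` to `y`. -/
def wt [Fintype ι] (b : P.Base) (x y : P.weylGroup) : N :=
  Classical.epsilon (IsShortestPathWeight b x y)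

/-- The monoid of nonnegative integer combinations of the simple coroots. -/
def corootCone (b : P.Base) : AddSubmonoid N :=
  AddSubmonoid.closure (P.coroot '' (b.support : Set ι))

/-- `γ' ≤ γ`: the difference `γ - γ'` is a nonnegative integer combination of simple coroots. -/
def CorootLE (b : P.Base) (γ' γ : N) : Prop :=
  γ - γ' ∈ corootCone b

/-- The usual order on roots: the difference of the root of index `j` and the root of index `i` is
a nonnegative integer combination of simple roots. -/
def RootLE (b : P.Base) (i j : ι) : Prop :=
  P.root j - P.root i ∈ AddSubmonoid.closure (P.root '' (b.support : Set ι))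

/-- The root `β` of index `i` is maximal, in the order on roots, among the positive roots with
`β^∨ ≤ γ`. -/
def IsMaximalRoot (b : P.Base) (γ : N) (i : ι) : Prop :=
  (b.IsPos i ∧ CorootLE b (P.coroot i) γ) ∧
    ∀ j : ι, b.IsPos j → CorootLE b (P.coroot j) γ → RootLE b i j → j = i

/-- `IsGreedy b γ z`: the element `z` is obtained from `γ` by the recursion
`z_0 = 1`, `z_γ = z_{γ - β^∨} * s_β`, for some choice at each step of a maximal root `β` among the
positive roots with `β^∨ ≤ γ`. -/
inductive IsGreedy (b : P.Base) : N → P.weylGroup → Prop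
  | zero : IsGreedy b 0 1
  | step (γ : N) (i : ι) (z : P.weylGroup) (hi : IsMaximalRoot b γ i)
      (hz : IsGreedy b (γ - P.coroot i) z) :
      IsGreedy b γ (demazure b z (RootPairing.weylGroup.ofIdx P i))

end QuantumBruhat

end

set_option linter.unusedSectionVars false
set_option linter.unusedFintypeInType false

/-! Say that a weight $\gamma$ covers $x$ (`Covered`) if $x$ lies below a Demazure product of
reflections in positive roots whose coroots add up to $\gamma$. The theorem follows from three facts
about this relation.

For fixed $\gamma$, the covered elements are exactly those below $z_\gamma$
(`IsGreedy.covered_iff`); in particular $z_\gamma$ is independent of the choices. The point is that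
the reflection in a maximal root $\delta$ with $\delta^\vee\le\gamma$ can be split off on the right
(`Covered.exists_star_ofIdx`). This rests on a rank-one analysis (`RankOneBound`,
`Covered.exists_inner`): if a simple root $\alpha_j$ pairs positively with $\gamma$, every $x$
covered by $\gamma$ lies below some $s_j*v*s_j$ with $v$ covered by $\gamma-\alpha_j^\vee$.

For fixed $x$, the weights covering $x$ have a least element (`exists_isLeastWeight`). Covering is
rewritten as $(x,0)\le(1,\gamma)$ in the semi-infinite order on pairs (Weyl group element,
coweight). The affine reflection in a highest root $\theta$ has a lifting property for this order
(`SemiInfStep.lo_hi`). Applying it trades $(x,\gamma)$ for a pair with smaller weight, unless $x$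
fixes $\theta$; then $x$ lies in a smaller standard parabolic subgroup and induction applies.

Finally, a path from $x$ to $1$ of weight $\omega$ shows that $\omega$ covers $x$, and it has
exactly $2\,\mathrm{ht}(\omega)-\ell(x)$ edges (`IsPath.covered`). Conversely, the greedy product
yields, whenever $\gamma$ covers $x$, a path of weight at most $\gamma$ (`Covered.exists_isPath`),
because maximal roots satisfy $\ell(s_\delta)=\langle\delta^\vee,2\rho\rangle-1$. So
$\mathrm{wt}(x,1)$ is the least covering weight, and $\mathrm{wt}(x,1)\le\gamma$ means that $\gamma$
covers $x$, that is, $x\le z_\gamma$. -/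

noncomputable section

namespace QuantumBruhat

open RootPairing

variable {ι M N : Type*} [AddCommGroup M] [Module ℝ M] [AddCommGroup N] [Module ℝ N]
variable {P : RootPairing ι ℝ M N}

local notation "σ" => RootPairing.weylGroup.ofIdx P

/-! ### Reflections and the action of the Weyl group on root indices -/

section Action

theorem ofIdx_mul_self (i : ι) : σ i * σ i = 1 := by
  apply Subtype.ext
  change Equiv.reflection P i * Equiv.reflection P i = 1
  rw [mul_eq_one_iff_inv_eq, Equiv.reflection_inv P i]

theorem ofIdx_inv (i : ι) : (σ i)⁻¹ = σ i :=
  inv_eq_of_mul_eq_one_left (ofIdx_mul_self i)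

theorem ofIdx_mul_cancel (i : ι) (w : P.weylGroup) : σ i * (σ i * w) = w := by
  rw [← mul_assoc, ofIdx_mul_self, one_mul]

theorem mul_ofIdx_cancel (i : ι) (w : P.weylGroup) : w * σ i * σ i = w := by
  rw [mul_assoc, ofIdx_mul_self, mul_one]

theorem ofIdx_smul_smul (i k : ι) : σ i • σ i • k = k := by
  rw [← mul_smul, ofIdx_mul_self, one_smul]

theorem eq_ofIdx_smul_of_ofIdx_smul_eq {i k m : ι} (h : σ i • k = m) : k = σ i • m := by
  rw [← h, ofIdx_smul_smul]

theorem ofIdx_smul_idx (i k : ι) : σ i • k = P.reflectionPerm i k := rfl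

theorem weylGroup_induction {p : P.weylGroup → Prop} (mem : ∀ i, p (σ i)) (one : p 1)
    (mul : ∀ x y, p x → p y → p (x * y)) (w : P.weylGroup) : p w := by
  obtain ⟨w, hw⟩ := w
  induction hw using weylGroup.induction with
  | mem i => exact mem i
  | one => exact one
  | mul x y hx hy h1 h2 => exact mul ⟨x, hx⟩ ⟨y, hy⟩ h1 h2

theorem conj_ofIdx (w : P.weylGroup) (i : ι) : w * σ i * w⁻¹ = σ (w • i) := by
  induction w using weylGroup_induction generalizing i with
  | mem j =>
    rw [ofIdx_inv]
    apply Subtype.ext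
    apply Equiv.weightHom_injective
    apply LinearEquiv.ext
    intro x
    show P.reflection j (P.reflection i (P.reflection j x)) = P.reflection (P.reflectionPerm j i) x
    rw [reflection_reflectionPerm]
    rfl
  | one => simp
  | mul x y hx hy =>
    rw [mul_smul, ← hx, ← hy]
    group

theorem mul_ofIdx (w : P.weylGroup) (i : ι) : w * σ i = σ (w • i) * w := by
  rw [← conj_ofIdx]; group

variable [P.IsCrystallographic]

theorem pairing_cast (i j : ι) : P.pairing i j = (P.pairingIn ℤ i j : ℝ) :=
  (P.algebraMap_pairingIn ℤ i j).symm

theorem root_ofIdx_smul (i k : ι) :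
    P.root (σ i • k) = P.root k - (P.pairingIn ℤ k i : ℝ) • P.root i := by
  rw [ofIdx_smul_idx, root_reflectionPerm, reflection_apply_root, pairing_cast]

theorem coroot_ofIdx_smul (i k : ι) :
    P.coroot (σ i • k) = P.coroot k - (P.pairingIn ℤ i k : ℝ) • P.coroot i := by
  rw [ofIdx_smul_idx, coroot_reflectionPerm, coreflection_apply_coroot, pairing_cast]

theorem pairingIn_smul (w : P.weylGroup) (i j : ι) :
    P.pairingIn ℤ (w • i) (w • j) = P.pairingIn ℤ i j := by
  induction w using weylGroup_induction generalizing i j with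
  | mem k =>
    rw [ofIdx_smul_idx, ofIdx_smul_idx, pairingIn_reflectionPerm, reflectionPerm_self]
  | one => simp
  | mul x y hx hy => rw [mul_smul, mul_smul, hx, hy]

theorem pairingIn_smul_left (w : P.weylGroup) (i j : ι) :
    P.pairingIn ℤ (w • i) j = P.pairingIn ℤ i (w⁻¹ • j) := by
  rw [← pairingIn_smul w i, smul_inv_smul]

/-- The index of the negative of root `k` is written `σ k • k` throughout. -/
theorem root_neg_idx (k : ι) : P.root (σ k • k) = - P.root k := by
  rw [ofIdx_smul_idx, root_reflectionPerm, reflection_apply_self]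

theorem coroot_neg_idx (k : ι) : P.coroot (σ k • k) = - P.coroot k := by
  rw [ofIdx_smul_idx, coroot_reflectionPerm, coreflection_apply_self]

theorem smul_neg_idx (w : P.weylGroup) (k : ι) : w • σ k • k = σ (w • k) • w • k := by
  rw [← mul_smul, mul_ofIdx, mul_smul]

theorem ofIdx_neg_idx (k : ι) : σ (σ k • k) = σ k := by
  rw [← conj_ofIdx]; group

theorem pairingIn_neg_left (i j : ι) : P.pairingIn ℤ (σ i • i) j = - P.pairingIn ℤ i j := by
  rw [ofIdx_smul_idx, pairingIn_reflectionPerm_self_left]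

theorem pairingIn_neg_right (i j : ι) : P.pairingIn ℤ i (σ j • j) = - P.pairingIn ℤ i j := by
  rw [ofIdx_smul_idx, pairingIn_reflectionPerm_self_right]

end Action

/-! ### Coefficients in simple roots and positivity -/

section Coefficients

/-- The roots need not span the space, so coordinate functionals on their span are extended. -/
theorem exists_dual_family {V : Type*} [AddCommGroup V] [Module ℝ V] {v : ι → V} {s : Finset ι}
    (hs : LinearIndepOn ℝ v (s : Set ι)) :
    ∃ f : ι → V →ₗ[ℝ] ℝ, (∀ i ∈ s, f i (v i) = 1) ∧ ∀ i ∈ s, ∀ j ∈ s, j ≠ i → f i (v j) = 0 := by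
  classical
  have hs' : LinearIndependent ℝ (fun i : s ↦ v i) := hs
  have h : ∀ i : s, ∃ g : V →ₗ[ℝ] ℝ, ∀ j : s, g (v j) = if j = i then 1 else 0 := by
    intro i
    let B := Module.Basis.span hs'
    obtain ⟨g, hg⟩ := LinearMap.exists_extend (B.coord i)
    refine ⟨g, fun j ↦ ?_⟩
    have h1 : (B j : V) = v j := by simp [B, Module.Basis.span_apply]
    rw [← h1]
    have h2 := LinearMap.congr_fun hg (B j)
    simp only [LinearMap.comp_apply, Submodule.subtype_apply] at h2
    rw [h2, Module.Basis.coord_apply, Module.Basis.repr_self, Finsupp.single_apply]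
  choose g hg using h
  refine ⟨fun i ↦ if hi : i ∈ s then g ⟨i, hi⟩ else 0, fun i hi ↦ ?_, fun i hi j hj hij ↦ ?_⟩
  · simpa [hi] using hg ⟨i, hi⟩ ⟨i, hi⟩
  · simpa [hi, hij] using hg ⟨i, hi⟩ ⟨j, hj⟩

/-- The coefficient of the simple root of index `i`. -/
def rootCoeff (b : P.Base) : ι → M →ₗ[ℝ] ℝ := (exists_dual_family b.linearIndepOn_root).choose

variable {b : P.Base} [Fintype ι] [P.IsCrystallographic] [P.IsReduced]

theorem rootCoeff_self {i : ι} (hi : i ∈ b.support) : rootCoeff b i (P.root i) = 1 :=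
  (exists_dual_family b.linearIndepOn_root).choose_spec.1 i hi

theorem rootCoeff_ne {i j : ι} (hi : i ∈ b.support) (hj : j ∈ b.support) (hij : j ≠ i) :
    rootCoeff b i (P.root j) = 0 :=
  (exists_dual_family b.linearIndepOn_root).choose_spec.2 i hi j hj hij

theorem rootCoeff_nonneg_of_mem {x : M} (hx : x ∈ AddSubmonoid.closure (P.root '' b.support))
    {j : ι} (hj : j ∈ b.support) : 0 ≤ rootCoeff b j x := by
  induction hx using AddSubmonoid.closure_induction with
  | mem x hx =>
    obtain ⟨i, hi, rfl⟩ := hx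
    by_cases h : i = j
    · subst h; rw [rootCoeff_self hi]; exact zero_le_one
    · rw [rootCoeff_ne hj hi h]
  | zero => simp
  | add x y _ _ h1 h2 => rw [map_add]; exact add_nonneg h1 h2

theorem root_eq_sum_rootCoeff_of_mem {x : M}
    (hx : x ∈ AddSubmonoid.closure (P.root '' b.support)) :
    x = ∑ j ∈ b.support, rootCoeff b j x • P.root j := by
  induction hx using AddSubmonoid.closure_induction with
  | mem x hx =>
    obtain ⟨i, hi, rfl⟩ := hx
    rw [Finset.sum_eq_single_of_mem i hi, rootCoeff_self hi, one_smul]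
    intro j hj hji
    rw [rootCoeff_ne hj hi hji.symm, zero_smul]
  | zero => simp
  | add x y _ _ h1 h2 =>
    simp only [map_add, add_smul, Finset.sum_add_distrib]
    rw [← h1, ← h2]

theorem not_isPos_iff {k : ι} : ¬ b.IsPos k ↔ b.IsPos (σ k • k) :=
  (Base.IsPos.neg_iff_not b k).symm

theorem isPos_neg_idx {k : ι} : b.IsPos (σ k • k) ↔ ¬ b.IsPos k :=
  Base.IsPos.neg_iff_not b k

theorem isPos_smul_neg_idx {w : P.weylGroup} {k : ι} :
    b.IsPos (w • σ k • k) ↔ ¬ b.IsPos (w • k) := by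
  rw [smul_neg_idx, isPos_neg_idx]

/-- `b.IsPos` is positivity of the height; a root with nonpositive coefficients has nonpositive
height. -/
theorem root_mem_of_isPos {k : ι} (hk : b.IsPos k) :
    P.root k ∈ AddSubmonoid.closure (P.root '' b.support) := by
  rcases b.root_mem_or_neg_mem k with h | h
  · exact h
  · exfalso
    obtain ⟨f, hf, hf' | hf'⟩ := b.exists_root_eq_sum_nat_or_neg k
    · have h1 := fun j ↦ rootCoeff_nonneg_of_mem (b := b) h (j := j)
      have h2 : P.root k ∈ AddSubmonoid.closure (P.root '' b.support) := by
        rw [hf']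
        exact sum_mem fun j hj ↦ nsmul_mem (AddSubmonoid.subset_closure (Set.mem_image_of_mem _ hj)) _
      have h3 : P.root k = 0 := by
        rw [root_eq_sum_rootCoeff_of_mem h2]
        refine Finset.sum_eq_zero fun j hj ↦ ?_
        have h4 := rootCoeff_nonneg_of_mem h2 hj
        have h5 := h1 j hj
        rw [map_neg] at h5
        rw [le_antisymm (by linarith) h4, zero_smul]
      exact P.ne_zero k h3
    · have h1 : P.root k = ∑ j ∈ b.support, (-(f j : ℤ)) • P.root j := by
        rw [hf', ← Finset.sum_neg_distrib]
        simp
      have h2 := Base.height_eq_sum h1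
      have h3 : 0 < b.height k := hk
      rw [h2] at h3
      have : ∑ j ∈ b.support, (-(f j : ℤ)) ≤ 0 := Finset.sum_nonpos fun j _ ↦ by simp
      omega

theorem rootCoeff_nonneg {k j : ι} (hk : b.IsPos k) (hj : j ∈ b.support) :
    0 ≤ rootCoeff b j (P.root k) :=
  rootCoeff_nonneg_of_mem (root_mem_of_isPos hk) hj

theorem isPos_of_rootCoeff_pos {k j : ι} (hj : j ∈ b.support)
    (h : 0 < rootCoeff b j (P.root k)) : b.IsPos k := by
  by_contra hk
  have := rootCoeff_nonneg (not_isPos_iff.mp hk) hj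
  rw [root_neg_idx, map_neg] at this
  linarith

theorem not_isPos_of_rootCoeff_neg {k j : ι} (hj : j ∈ b.support)
    (h : rootCoeff b j (P.root k) < 0) : ¬ b.IsPos k :=
  fun hk ↦ absurd (rootCoeff_nonneg hk hj) (not_le.mpr h)

theorem isPos_of_mem_closure {k : ι}
    (h : P.root k ∈ AddSubmonoid.closure (P.root '' b.support)) : b.IsPos k := by
  by_contra hk
  have h2 := root_mem_of_isPos (not_isPos_iff.mp hk)
  rw [root_neg_idx] at h2
  apply P.ne_zero k
  rw [root_eq_sum_rootCoeff_of_mem h]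
  refine Finset.sum_eq_zero fun j hj ↦ ?_
  have h4 := rootCoeff_nonneg_of_mem h hj
  have h5 := rootCoeff_nonneg_of_mem h2 hj
  rw [map_neg] at h5
  rw [le_antisymm (by linarith) h4, zero_smul]

/-- Reducedness enters here: a positive root supported on `j` alone is proportional, hence equal, to
the simple root. -/
theorem exists_rootCoeff_pos {k j : ι} (hk : b.IsPos k) (hj : j ∈ b.support) (hkj : k ≠ j) :
    ∃ i ∈ b.support, i ≠ j ∧ 0 < rootCoeff b i (P.root k) := by
  by_contra! hcon
  have h1 := root_eq_sum_rootCoeff_of_mem (root_mem_of_isPos hk)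
  rw [Finset.sum_eq_single_of_mem j hj] at h1
  · have h2 : LinearIndependent ℝ ![P.root k, P.root j] := by
      refine IsReduced.linearIndependent P hkj fun h ↦ ?_
      have := rootCoeff_nonneg hk hj
      rw [h, map_neg, rootCoeff_self hj] at this
      linarith
    rw [LinearIndependent.pair_iff] at h2
    have := h2 1 (-rootCoeff b j (P.root k)) (by rw [one_smul, neg_smul, ← h1, add_neg_cancel])
    simp at this
  · intro i hi hij
    rw [le_antisymm (hcon i hi hij) (rootCoeff_nonneg hk hi), zero_smul]

theorem isPos_ofIdx_smul {j k : ι} (hj : j ∈ b.support) (hk : b.IsPos k) (hkj : k ≠ j) :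
    b.IsPos (σ j • k) :=
  Base.IsPos.reflectionPerm hk hj hkj

theorem eq_of_not_isPos_ofIdx_smul {j k : ι} (hj : j ∈ b.support) (hk : b.IsPos k)
    (h : ¬ b.IsPos (σ j • k)) : k = j := by
  by_contra hkj
  exact h (isPos_ofIdx_smul hj hk hkj)

theorem not_isPos_ofIdx_smul {j k : ι} (hj : j ∈ b.support) (hk : ¬ b.IsPos k)
    (hkj : k ≠ σ j • j) : ¬ b.IsPos (σ j • k) := by
  have h := isPos_ofIdx_smul hj (not_isPos_iff.mp hk) fun h ↦ hkj (by
    rw [← h, ofIdx_neg_idx, ofIdx_smul_smul])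
  rwa [isPos_smul_neg_idx] at h

/-- Induction on height: a positive root pairs positively with some simple root, and reflecting in
the latter lowers the height without leaving the positive roots, unless the two coincide. -/
theorem isPos_induction {p : ι → Prop} (simple : ∀ j ∈ b.support, p j)
    (step : ∀ k j, b.IsPos k → j ∈ b.support → k ≠ j → 0 < P.pairingIn ℤ j k →
      b.IsPos (σ j • k) → p (σ j • k) → p k) {k : ι} (hk : b.IsPos k) : p k := by
  generalize hn : (b.height k).toNat = n
  induction n using Nat.strong_induction_on generalizing k with
  | _ n ih =>
    obtain ⟨j, hj, hjk⟩ := hk.exists_mem_support_pos_pairingIn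
    by_cases hkj : k = j
    · exact simple k (hkj ▸ hj)
    have hpos := isPos_ofIdx_smul hj hk hkj
    refine step k j hk hj hkj hjk hpos (ih _ ?_ hpos rfl)
    have h1 : P.root (σ j • k) = P.root k + (-P.pairingIn ℤ k j) • P.root j := by
      rw [root_ofIdx_smul, neg_smul, sub_eq_add_neg, Int.cast_smul_eq_zsmul]
    have h2 := b.height_add_zsmul h1
    rw [Base.height_one_of_mem_support hj] at h2
    have h3 : 0 < P.pairingIn ℤ k j := (P.zero_lt_pairingIn_iff' ℤ).mp hjk
    have h4 : 0 < b.height k := hk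
    simp only [smul_eq_mul, mul_one] at h2
    omega

theorem coroot_mem_corootCone {k : ι} (hk : b.IsPos k) : P.coroot k ∈ corootCone b := by
  refine isPos_induction (b := b) (p := fun k ↦ P.coroot k ∈ corootCone b)
    (fun j hj ↦ AddSubmonoid.subset_closure ⟨j, hj, rfl⟩) (fun k j _ hj _ hjk _ ih ↦ ?_) hk
  rw [coroot_ofIdx_smul] at ih
  have h1 : P.coroot k = (P.coroot k - (P.pairingIn ℤ j k : ℝ) • P.coroot j) +
      (P.pairingIn ℤ j k).toNat • P.coroot j := by
    rw [← Nat.cast_smul_eq_nsmul ℝ, ← Int.cast_natCast, Int.toNat_of_nonneg hjk.le]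
    abel
  rw [h1]
  exact add_mem ih (nsmul_mem (AddSubmonoid.subset_closure (Set.mem_image_of_mem _ hj)) _)

end Coefficients

/-! ### Length as the number of inversions -/

section Length

variable {b : P.Base} [Fintype ι] [P.IsCrystallographic] [P.IsReduced]

open Classical in
/-- The indices of the positive roots that `w` makes negative. -/
def inversions (b : P.Base) (w : P.weylGroup) : Finset ι :=
  {i : ι | b.IsPos i ∧ ¬ b.IsPos (w • i)}

theorem mem_inversions {w : P.weylGroup} {i : ι} :
    i ∈ inversions b w ↔ b.IsPos i ∧ ¬ b.IsPos (w • i) := by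
  simp [inversions]

/-- $s_j$ permutes the positive roots other than $\alpha_j$, so only $\alpha_j$ itself is a new
inversion. -/
theorem card_inversions_mul_of_isPos {w : P.weylGroup} {j : ι} (hj : j ∈ b.support)
    (h : b.IsPos (w • j)) : (inversions b (w * σ j)).card = (inversions b w).card + 1 := by
  classical
  have hjp := Base.isPos_of_mem_support hj
  have h1 : inversions b (w * σ j) = insert j ((inversions b w).image (fun i ↦ σ j • i)) := by
    ext i
    simp only [Finset.mem_insert, Finset.mem_image, mem_inversions, mul_smul]
    constructor
    · rintro ⟨h1, h2⟩
      by_cases hij : i = j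
      · exact Or.inl hij
      · exact Or.inr ⟨σ j • i, ⟨isPos_ofIdx_smul hj h1 hij, h2⟩, ofIdx_smul_smul j i⟩
    · rintro (rfl | ⟨k, ⟨h1, h2⟩, rfl⟩)
      · exact ⟨hjp, by rw [isPos_smul_neg_idx]; exact not_not.mpr h⟩
      · have hkj : k ≠ j := by rintro rfl; exact h2 h
        exact ⟨isPos_ofIdx_smul hj h1 hkj, by rwa [ofIdx_smul_smul]⟩
  rw [h1, Finset.card_insert_of_notMem, Finset.card_image_of_injective _ (MulAction.injective _)]
  simp only [Finset.mem_image, mem_inversions, not_exists, not_and]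
  rintro k ⟨h1, _⟩ h3
  have h4 : k = σ j • j := eq_ofIdx_smul_of_ofIdx_smul_eq h3
  rw [h4, isPos_neg_idx] at h1
  exact h1 hjp

theorem card_inversions_mul_of_not_isPos {w : P.weylGroup} {j : ι} (hj : j ∈ b.support)
    (h : ¬ b.IsPos (w • j)) : (inversions b (w * σ j)).card + 1 = (inversions b w).card := by
  rw [← card_inversions_mul_of_isPos hj, mul_ofIdx_cancel]
  rw [mul_smul, isPos_smul_neg_idx]
  exact h

theorem exists_simple_word_ofIdx (k : ι) : ∃ l : List ι, (∀ i ∈ l, i ∈ b.support) ∧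
    (l.map σ).prod = σ k := by
  wlog hk : b.IsPos k generalizing k
  · obtain ⟨l, hl, hl'⟩ := this _ (not_isPos_iff.mp hk)
    exact ⟨l, hl, by rw [hl', ofIdx_neg_idx]⟩
  refine isPos_induction (b := b) (p := fun k ↦ ∃ l : List ι, (∀ i ∈ l, i ∈ b.support) ∧
    (l.map σ).prod = σ k) (fun j hj ↦ ⟨[j], by simpa, by simp⟩) ?_ hk
  rintro k j _ hj _ _ _ ⟨l, hl, hl'⟩
  refine ⟨j :: (l ++ [j]), by simpa [hj, or_imp, forall_and] using hl, ?_⟩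
  simp only [List.map_cons, List.map_append, List.map_nil, List.prod_cons, List.prod_append,
    List.prod_nil, mul_one]
  rw [hl', ← conj_ofIdx, ofIdx_inv, mul_ofIdx_cancel, ofIdx_mul_cancel]

theorem exists_simple_word (w : P.weylGroup) : ∃ l : List ι, (∀ i ∈ l, i ∈ b.support) ∧
    (l.map σ).prod = w := by
  induction w using weylGroup_induction with
  | mem i => exact exists_simple_word_ofIdx i
  | one => exact ⟨[], by simp, by simp⟩
  | mul x y hx hy =>
    obtain ⟨l, hl, rfl⟩ := hx
    obtain ⟨l', hl', rfl⟩ := hy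
    exact ⟨l ++ l', by simpa [or_imp, forall_and] using ⟨hl, hl'⟩, by simp⟩

/-- Applying the letters to $\alpha_j$ from the right, the sign changes at some letter $i$; the root
just before is then $\alpha_i$, and that letter can be deleted. -/
theorem exists_exchange {j : ι} (hj : j ∈ b.support) (l : List ι) (hl : ∀ i ∈ l, i ∈ b.support)
    (h : ¬ b.IsPos ((l.map σ).prod • j)) : ∃ l' : List ι, (∀ i ∈ l', i ∈ b.support) ∧
      l'.length + 1 = l.length ∧ (l'.map σ).prod = (l.map σ).prod * σ j := by
  induction l with
  | nil => exact absurd (Base.isPos_of_mem_support hj) (by simpa using h)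
  | cons i l ih =>
    have hi : i ∈ b.support := hl i (by simp)
    have hl' : ∀ i ∈ l, i ∈ b.support := fun k hk ↦ hl k (by simp [hk])
    rw [List.map_cons, List.prod_cons] at h ⊢
    by_cases hp : b.IsPos ((l.map σ).prod • j)
    · rw [mul_smul] at h
      have h1 := eq_of_not_isPos_ofIdx_smul hi hp h
      refine ⟨l, hl', by simp, ?_⟩
      rw [mul_assoc, mul_ofIdx, h1, ofIdx_mul_cancel]
    · obtain ⟨l', h1, h2, h3⟩ := ih hl' hp
      refine ⟨i :: l', by simpa [hi] using h1, by simp [h2], ?_⟩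
      rw [List.map_cons, List.prod_cons, h3, mul_assoc]

theorem card_inversions_le (l : List ι) (hl : ∀ i ∈ l, i ∈ b.support) :
    (inversions b (l.map σ).prod).card ≤ l.length := by
  induction l using List.reverseRecOn with
  | nil =>
    simp only [List.map_nil, List.prod_nil, List.length_nil, Nat.le_zero, Finset.card_eq_zero]
    ext i
    simp [mem_inversions]
  | append_singleton l j ih =>
    have hj : j ∈ b.support := hl j (by simp)
    have ih := ih fun k hk ↦ hl k (by simp [hk])
    simp only [List.map_append, List.map_cons, List.map_nil, List.prod_append, List.prod_cons,
      List.prod_nil, mul_one, List.length_append, List.length_singleton]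
    by_cases h : b.IsPos ((l.map σ).prod • j)
    · rw [card_inversions_mul_of_isPos hj h]; omega
    · have := card_inversions_mul_of_not_isPos hj h; omega

theorem exists_reduced_word_card (w : P.weylGroup) : ∃ l : List ι, (∀ i ∈ l, i ∈ b.support) ∧
    l.length = (inversions b w).card ∧ (l.map σ).prod = w := by
  obtain ⟨l, hl, rfl⟩ := exists_simple_word (b := b) w
  induction l using List.reverseRecOn with
  | nil =>
    exact ⟨[], by simp, ((card_inversions_le (b := b) [] (by simp)).antisymm (Nat.zero_le _)).symm,
      rfl⟩
  | append_singleton l j ih =>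
    have hj : j ∈ b.support := hl j (by simp)
    obtain ⟨l', h1, h2, h3⟩ := ih fun k hk ↦ hl k (by simp [hk])
    simp only [List.map_append, List.map_cons, List.map_nil, List.prod_append, List.prod_cons,
      List.prod_nil, mul_one]
    by_cases h : b.IsPos ((l.map σ).prod • j)
    · refine ⟨l' ++ [j], by simpa [hj, or_imp, forall_and] using h1, ?_, by simp [h3]⟩
      rw [card_inversions_mul_of_isPos hj h, ← h2]; simp
    · rw [← h3] at h
      obtain ⟨l'', h4, h5, h6⟩ := exists_exchange hj l' h1 h
      refine ⟨l'', h4, ?_, by rw [h6, h3]⟩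
      rw [h3] at h
      have := card_inversions_mul_of_not_isPos hj h; omega

theorem length_eq_card (w : P.weylGroup) : length b w = (inversions b w).card := by
  apply le_antisymm
  · exact Nat.sInf_le (exists_reduced_word_card w)
  · refine le_csInf ⟨_, exists_reduced_word_card w⟩ ?_
    rintro n ⟨l, hl, rfl, rfl⟩
    exact card_inversions_le l hl

theorem exists_reduced_word (w : P.weylGroup) : ∃ l : List ι, (∀ i ∈ l, i ∈ b.support) ∧
    l.length = length b w ∧ (l.map σ).prod = w := by
  rw [length_eq_card]; exact exists_reduced_word_card w

theorem length_le (l : List ι) (hl : ∀ i ∈ l, i ∈ b.support) :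
    length b (l.map σ).prod ≤ l.length := by
  rw [length_eq_card]; exact card_inversions_le l hl

theorem length_inv (w : P.weylGroup) : length b w⁻¹ = length b w := by
  have key : ∀ w : P.weylGroup, length b w⁻¹ ≤ length b w := by
    intro w
    obtain ⟨l, hl, h2, h3⟩ := exists_reduced_word (b := b) w
    have h4 : (l.reverse.map σ).prod = w⁻¹ := by
      rw [← h3, List.prod_inv_reverse, List.map_map, List.map_reverse]
      congr 3
      funext i
      exact (ofIdx_inv i).symm
    rw [← h4, ← h2, ← List.length_reverse]
    exact length_le _ (by simpa using hl)
  exact (key w).antisymm (by simpa using key w⁻¹)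

theorem length_one : length b (1 : P.weylGroup) = 0 := by
  simpa using length_le (P := P) (b := b) [] (by simp)

theorem eq_one_of_length_eq_zero {w : P.weylGroup} (h : length b w = 0) : w = 1 := by
  obtain ⟨l, -, h2, h3⟩ := exists_reduced_word (b := b) w
  rw [h, List.length_eq_zero_iff] at h2
  rw [← h3, h2]; rfl

theorem length_mul_simple_of_isPos {w : P.weylGroup} {j : ι} (hj : j ∈ b.support)
    (h : b.IsPos (w • j)) : length b (w * σ j) = length b w + 1 := by
  rw [length_eq_card, length_eq_card, card_inversions_mul_of_isPos hj h]

theorem length_mul_simple_of_not_isPos {w : P.weylGroup} {j : ι} (hj : j ∈ b.support)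
    (h : ¬ b.IsPos (w • j)) : length b (w * σ j) + 1 = length b w := by
  rw [length_eq_card, length_eq_card, card_inversions_mul_of_not_isPos hj h]

theorem length_simple_mul_of_isPos {w : P.weylGroup} {j : ι} (hj : j ∈ b.support)
    (h : b.IsPos (w⁻¹ • j)) : length b (σ j * w) = length b w + 1 := by
  rw [← length_inv, mul_inv_rev, ofIdx_inv, length_mul_simple_of_isPos hj h, length_inv]

theorem length_simple_mul_of_not_isPos {w : P.weylGroup} {j : ι} (hj : j ∈ b.support)
    (h : ¬ b.IsPos (w⁻¹ • j)) : length b (σ j * w) + 1 = length b w := by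
  rw [← length_inv, mul_inv_rev, ofIdx_inv, length_mul_simple_of_not_isPos hj h, length_inv]

theorem exists_not_isPos_smul {w : P.weylGroup} (h : w ≠ 1) :
    ∃ j ∈ b.support, ¬ b.IsPos (w • j) := by
  obtain ⟨l, hl, h2, h3⟩ := exists_reduced_word (b := b) w
  induction l using List.reverseRecOn with
  | nil => exact absurd h3.symm (by simpa using h)
  | append_singleton l j _ =>
    refine ⟨j, hl j (by simp), fun hp ↦ ?_⟩
    have h4 := length_mul_simple_of_isPos (hl j (by simp)) hp
    have h5 : w * σ j = (l.map σ).prod := by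
      rw [← h3]; simp [mul_assoc, ofIdx_mul_self]
    have h6 := length_le (b := b) l fun k hk ↦ hl k (by simp [hk])
    rw [h5] at h4
    rw [List.length_append, List.length_singleton] at h2
    omega

theorem exists_not_isPos_inv_smul {w : P.weylGroup} (h : w ≠ 1) :
    ∃ j ∈ b.support, ¬ b.IsPos (w⁻¹ • j) :=
  exists_not_isPos_smul (inv_ne_one.mpr h)

/-- Sending an inversion $k$ of $w$ to $s_ik$ if this is positive, and to $k$ otherwise, injects the
inversions of $w$ into those of $ws_i$ different from $i$. -/
theorem length_lt_mul_ofIdx {w : P.weylGroup} {i : ι} (hi : b.IsPos i) (h : b.IsPos (w • i)) :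
    length b w < length b (w * σ i) := by
  classical
  rw [length_eq_card, length_eq_card]
  let f : ι → ι := fun k ↦ if b.IsPos (σ i • k) then σ i • k else k
  have hf : ∀ k, b.IsPos k → ¬ b.IsPos (w • k) → f k ∈ (inversions b (w * σ i)).erase i := by
    intro k hk hwk
    simp only [f, Finset.mem_erase, mem_inversions, mul_smul]
    split_ifs with hs
    · refine ⟨fun h1 ↦ ?_, hs, by rwa [ofIdx_smul_smul]⟩
      have h2 : k = σ i • i := eq_ofIdx_smul_of_ofIdx_smul_eq h1
      rw [h2, isPos_neg_idx] at hk
      exact hk hi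
    · refine ⟨fun h1 ↦ hwk (h1 ▸ h), hk, fun h1 ↦ ?_⟩
      have hpair : 0 < P.pairingIn ℤ k i := by
        by_contra! hle
        apply hs
        obtain ⟨n, hn⟩ := Int.exists_eq_neg_ofNat hle
        apply isPos_of_mem_closure
        rw [root_ofIdx_smul, hn]
        have : P.root k - ((-(n : ℤ) : ℤ) : ℝ) • P.root i = P.root k + n • P.root i := by
          rw [← Nat.cast_smul_eq_nsmul ℝ]; push_cast; rw [neg_smul, sub_neg_eq_add]
        rw [this]
        exact add_mem (root_mem_of_isPos hk) (nsmul_mem (root_mem_of_isPos hi) _)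
      have h2 := root_mem_of_isPos h1
      have h3 := root_mem_of_isPos (not_isPos_iff.mp hwk)
      have h4 : P.root (w • σ i • k) =
          P.root (w • k) - (P.pairingIn ℤ k i : ℝ) • P.root (w • i) := by
        rw [← mul_smul, mul_ofIdx, mul_smul, root_ofIdx_smul, pairingIn_smul]
      refine (isPos_smul_neg_idx (b := b) (w := w) (k := σ i • k)).mp ?_ h1
      apply isPos_of_mem_closure
      rw [smul_neg_idx, root_neg_idx, h4, neg_sub]
      rw [root_neg_idx] at h3
      rw [sub_eq_add_neg]
      refine add_mem ?_ h3
      obtain ⟨n, hn⟩ := Int.eq_ofNat_of_zero_le hpair.le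
      rw [hn, Int.cast_natCast, Nat.cast_smul_eq_nsmul]
      exact nsmul_mem (root_mem_of_isPos h) _
  have hinj : Set.InjOn f (inversions b w : Set ι) := by
    intro k hk k' hk' hkk
    simp only [Finset.mem_coe, mem_inversions] at hk hk'
    simp only [f] at hkk
    split_ifs at hkk with h1 h2 h2
    · exact MulAction.injective _ hkk
    · exact absurd (by rw [← hkk, ofIdx_smul_smul]; exact hk.1) h2
    · exact absurd (by rw [hkk, ofIdx_smul_smul]; exact hk'.1) h1
    · exact hkk
  have hmem : i ∈ inversions b (w * σ i) := by
    rw [mem_inversions, mul_smul, isPos_smul_neg_idx]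
    exact ⟨hi, not_not.mpr h⟩
  calc (inversions b w).card ≤ ((inversions b (w * σ i)).erase i).card :=
        Finset.card_le_card_of_injOn f
          (fun k hk ↦ hf k (mem_inversions.mp hk).1 (mem_inversions.mp hk).2) hinj
    _ < (inversions b (w * σ i)).card := Finset.card_erase_lt_of_mem hmem

theorem length_mul_ofIdx_lt {w : P.weylGroup} {i : ι} (hi : b.IsPos i) (h : ¬ b.IsPos (w • i)) :
    length b (w * σ i) < length b w := by
  have := length_lt_mul_ofIdx (w := w * σ i) hi (by rw [mul_smul, isPos_smul_neg_idx]; exact h)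
  rwa [mul_ofIdx_cancel] at this

end Length

/-- The relation underlying the Bruhat order. -/
def BruhatLE (b : P.Base) (x y : P.weylGroup) : Prop := (bruhatOrder b).le x y

local notation:50 x:51 " ≼[" b "] " y:51 => BruhatLE b x y

/-! ### The Bruhat order: lifting property and covers -/

section Bruhat

variable {b : P.Base}

theorem BruhatLE.refl (x : P.weylGroup) : x ≼[b] x := (bruhatOrder b).le_refl x

theorem BruhatLE.trans {x y z : P.weylGroup} (h : x ≼[b] y) (h' : y ≼[b] z) : x ≼[b] z :=
  (bruhatOrder b).le_trans x y z h h'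

theorem BruhatLE.antisymm {x y : P.weylGroup} (h : x ≼[b] y) (h' : y ≼[b] x) : x = y :=
  (bruhatOrder b).le_antisymm x y h h'

theorem BruhatLE.length_le {x y : P.weylGroup} (h : x ≼[b] y) : length b x ≤ length b y :=
  length_le_of_reflTransGen h

variable [Fintype ι] [P.IsCrystallographic] [P.IsReduced]

theorem bruhatStep_iff {x y : P.weylGroup} :
    BruhatStep b x y ↔ ∃ i, b.IsPos i ∧ b.IsPos (x • i) ∧ y = x * σ i := by
  constructor
  · rintro ⟨i, rfl, h⟩
    wlog hi : b.IsPos i generalizing i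
    · obtain ⟨k, h1, h2, h3⟩ := this (σ i • i) (by rwa [ofIdx_neg_idx]) (not_isPos_iff.mp hi)
      exact ⟨k, h1, h2, by rw [← h3, ofIdx_neg_idx]⟩
    refine ⟨i, hi, ?_, rfl⟩
    by_contra hx
    exact absurd (length_mul_ofIdx_lt hi hx) h.not_gt
  · rintro ⟨i, hi, hx, rfl⟩
    exact ⟨i, rfl, length_lt_mul_ofIdx hi hx⟩

theorem bruhatLE_mul_ofIdx {x : P.weylGroup} {i : ι} (hi : b.IsPos i) (h : b.IsPos (x • i)) :
    x ≼[b] x * σ i :=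
  Relation.ReflTransGen.single (bruhatStep_iff.mpr ⟨i, hi, h, rfl⟩)

theorem BruhatLE.induction {r : P.weylGroup → P.weylGroup → Prop} (refl : ∀ x, r x x)
    (trans : ∀ x y z, r x y → r y z → r x z)
    (step : ∀ x i, b.IsPos i → b.IsPos (x • i) → r x (x * σ i)) {x y : P.weylGroup}
    (h : x ≼[b] y) : r x y := by
  change Relation.ReflTransGen (BruhatStep b) x y at h
  induction h with
  | refl => exact refl x
  | tail _ hs ih =>
    obtain ⟨i, h1, h2, rfl⟩ := bruhatStep_iff.mp hs
    exact trans _ _ _ ih (step _ i h1 h2)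

theorem BruhatLE.inv {x y : P.weylGroup} (h : x ≼[b] y) : x⁻¹ ≼[b] y⁻¹ := by
  refine BruhatLE.induction (r := fun x y ↦ x⁻¹ ≼[b] y⁻¹) (fun _ ↦ .refl _)
    (fun _ _ _ ↦ .trans) (fun x i h1 h2 ↦ ?_) h
  rw [mul_ofIdx, mul_inv_rev, ofIdx_inv]
  exact bruhatLE_mul_ofIdx h2 (by rwa [inv_smul_smul])

theorem BruhatLE.inv_iff {x y : P.weylGroup} : x⁻¹ ≼[b] y⁻¹ ↔ x ≼[b] y :=
  ⟨fun h ↦ by simpa using h.inv, .inv⟩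

theorem one_bruhatLE (x : P.weylGroup) : 1 ≼[b] x := by
  generalize hn : length b x = n
  induction n using Nat.strong_induction_on generalizing x with
  | _ n ih =>
    by_cases hx : x = 1
    · rw [hx]; exact .refl 1
    · obtain ⟨j, hj, hjx⟩ := exists_not_isPos_smul (b := b) hx
      have h1 := length_mul_simple_of_not_isPos hj hjx
      refine (ih _ (by omega) (x * σ j) rfl).trans ?_
      have h2 := bruhatLE_mul_ofIdx (b := b) (x := x * σ j) (Base.isPos_of_mem_support hj)
        (by rw [mul_smul, isPos_smul_neg_idx]; exact hjx)
      rwa [mul_ofIdx_cancel] at h2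

open Classical in
/-- The longer one of `w` and `s_j w`. -/
def upLeft (b : P.Base) (j : ι) (w : P.weylGroup) : P.weylGroup :=
  if b.IsPos (w⁻¹ • j) then σ j * w else w

open Classical in
/-- The shorter one of `w` and `s_j w`. -/
def downLeft (b : P.Base) (j : ι) (w : P.weylGroup) : P.weylGroup :=
  if b.IsPos (w⁻¹ • j) then w else σ j * w

open Classical in
/-- The longer one of `w` and `w s_j`. -/
def upRight (b : P.Base) (j : ι) (w : P.weylGroup) : P.weylGroup :=
  if b.IsPos (w • j) then w * σ j else w

theorem upLeft_of_isPos {j : ι} {w : P.weylGroup} (h : b.IsPos (w⁻¹ • j)) :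
    upLeft b j w = σ j * w := if_pos h

theorem upLeft_of_not_isPos {j : ι} {w : P.weylGroup} (h : ¬ b.IsPos (w⁻¹ • j)) :
    upLeft b j w = w := if_neg h

theorem downLeft_of_isPos {j : ι} {w : P.weylGroup} (h : b.IsPos (w⁻¹ • j)) :
    downLeft b j w = w := if_pos h

theorem downLeft_of_not_isPos {j : ι} {w : P.weylGroup} (h : ¬ b.IsPos (w⁻¹ • j)) :
    downLeft b j w = σ j * w := if_neg h

theorem upRight_of_isPos {j : ι} {w : P.weylGroup} (h : b.IsPos (w • j)) :
    upRight b j w = w * σ j := if_pos h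

theorem upRight_of_not_isPos {j : ι} {w : P.weylGroup} (h : ¬ b.IsPos (w • j)) :
    upRight b j w = w := if_neg h

theorem isPos_inv_mul_smul {j : ι} {w : P.weylGroup} :
    b.IsPos ((σ j * w)⁻¹ • j) ↔ ¬ b.IsPos (w⁻¹ • j) := by
  rw [mul_inv_rev, ofIdx_inv, mul_smul, isPos_smul_neg_idx]

theorem isPos_mul_smul {j : ι} {w : P.weylGroup} :
    b.IsPos ((w * σ j) • j) ↔ ¬ b.IsPos (w • j) := by
  rw [mul_smul, isPos_smul_neg_idx]

theorem upRight_eq_inv_upLeft_inv (j : ι) (w : P.weylGroup) :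
    upRight b j w = (upLeft b j w⁻¹)⁻¹ := by
  by_cases h : b.IsPos (w • j)
  · rw [upRight_of_isPos h, upLeft_of_isPos (by rwa [inv_inv]), mul_inv_rev, inv_inv, ofIdx_inv]
  · rw [upRight_of_not_isPos h, upLeft_of_not_isPos (by rwa [inv_inv]), inv_inv]

theorem bruhatLE_simple_mul {j : ι} (hj : j ∈ b.support) {w : P.weylGroup}
    (h : b.IsPos (w⁻¹ • j)) : w ≼[b] σ j * w := by
  have h1 := bruhatLE_mul_ofIdx (x := w) h
    (by rw [smul_inv_smul]; exact Base.isPos_of_mem_support hj)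
  rwa [mul_ofIdx, smul_inv_smul] at h1

theorem simple_mul_bruhatLE {j : ι} (hj : j ∈ b.support) {w : P.weylGroup}
    (h : ¬ b.IsPos (w⁻¹ • j)) : σ j * w ≼[b] w := by
  have h1 := bruhatLE_simple_mul hj (w := σ j * w) (isPos_inv_mul_smul.mpr h)
  rwa [ofIdx_mul_cancel] at h1

theorem bruhatLE_upLeft {j : ι} (hj : j ∈ b.support) (w : P.weylGroup) : w ≼[b] upLeft b j w := by
  by_cases h : b.IsPos (w⁻¹ • j)
  · rw [upLeft_of_isPos h]; exact bruhatLE_simple_mul hj h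
  · rw [upLeft_of_not_isPos h]; exact .refl _

theorem mul_bruhatLE_upLeft {j : ι} (hj : j ∈ b.support) (w : P.weylGroup) :
    σ j * w ≼[b] upLeft b j w := by
  by_cases h : b.IsPos (w⁻¹ • j)
  · rw [upLeft_of_isPos h]; exact .refl _
  · rw [upLeft_of_not_isPos h]; exact simple_mul_bruhatLE hj h

theorem downLeft_bruhatLE {j : ι} (hj : j ∈ b.support) (w : P.weylGroup) :
    downLeft b j w ≼[b] w := by
  by_cases h : b.IsPos (w⁻¹ • j)
  · rw [downLeft_of_isPos h]; exact .refl _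
  · rw [downLeft_of_not_isPos h]; exact simple_mul_bruhatLE hj h

theorem downLeft_bruhatLE_mul {j : ι} (hj : j ∈ b.support) (w : P.weylGroup) :
    downLeft b j w ≼[b] σ j * w := by
  by_cases h : b.IsPos (w⁻¹ • j)
  · rw [downLeft_of_isPos h]; exact bruhatLE_simple_mul hj h
  · rw [downLeft_of_not_isPos h]; exact .refl _

theorem upLeft_mul (j : ι) (w : P.weylGroup) : upLeft b j (σ j * w) = upLeft b j w := by
  by_cases h : b.IsPos (w⁻¹ • j)
  · rw [upLeft_of_isPos h, upLeft_of_not_isPos (by rw [isPos_inv_mul_smul]; exact not_not.mpr h)]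
  · rw [upLeft_of_not_isPos h, upLeft_of_isPos (isPos_inv_mul_smul.mpr h), ofIdx_mul_cancel]

theorem downLeft_mul (j : ι) (w : P.weylGroup) : downLeft b j (σ j * w) = downLeft b j w := by
  by_cases h : b.IsPos (w⁻¹ • j)
  · rw [downLeft_of_isPos h,
      downLeft_of_not_isPos (by rw [isPos_inv_mul_smul]; exact not_not.mpr h), ofIdx_mul_cancel]
  · rw [downLeft_of_not_isPos h, downLeft_of_isPos (isPos_inv_mul_smul.mpr h)]

theorem upLeft_downLeft (j : ι) (w : P.weylGroup) :
    upLeft b j (downLeft b j w) = upLeft b j w := by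
  by_cases h : b.IsPos (w⁻¹ • j)
  · rw [downLeft_of_isPos h]
  · rw [downLeft_of_not_isPos h, upLeft_mul]

theorem downLeft_upLeft (j : ι) (w : P.weylGroup) :
    downLeft b j (upLeft b j w) = downLeft b j w := by
  by_cases h : b.IsPos (w⁻¹ • j)
  · rw [upLeft_of_isPos h, downLeft_mul]
  · rw [upLeft_of_not_isPos h]

/-- Left multiplication by a simple reflection maps a Bruhat step to a Bruhat step, unless it
interchanges the two ends. -/
theorem simple_mul_step {j : ι} (hj : j ∈ b.support) {x : P.weylGroup} {i : ι} (hi : b.IsPos i)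
    (h : b.IsPos (x • i)) (hij : x • i ≠ j) : σ j * x ≼[b] σ j * (x * σ i) := by
  rw [← mul_assoc]
  exact bruhatLE_mul_ofIdx hi (by rw [mul_smul]; exact isPos_ofIdx_smul hj h hij)

/-- Multiplying a step by $s_j$ gives a step again, except when $s_j$ swaps its two ends; then both
ends have the same `upLeft`. -/
theorem BruhatLE.upLeft {j : ι} (hj : j ∈ b.support) {x y : P.weylGroup} (h : x ≼[b] y) :
    upLeft b j x ≼[b] upLeft b j y := by
  refine BruhatLE.induction (r := fun x y ↦ QuantumBruhat.upLeft b j x ≼[b]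
    QuantumBruhat.upLeft b j y) (fun _ ↦ .refl _) (fun _ _ _ ↦ .trans) (fun x i h1 h2 ↦ ?_) h
  by_cases hij : x • i = j
  · rw [mul_ofIdx, hij, upLeft_mul]; exact .refl _
  · by_cases hx : b.IsPos (x⁻¹ • j)
    · rw [upLeft_of_isPos hx]
      exact (simple_mul_step hj h1 h2 hij).trans (mul_bruhatLE_upLeft hj _)
    · rw [upLeft_of_not_isPos hx]
      exact (bruhatLE_mul_ofIdx h1 h2).trans (bruhatLE_upLeft hj _)

theorem BruhatLE.downLeft {j : ι} (hj : j ∈ b.support) {x y : P.weylGroup} (h : x ≼[b] y) :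
    downLeft b j x ≼[b] downLeft b j y := by
  refine BruhatLE.induction (r := fun x y ↦ QuantumBruhat.downLeft b j x ≼[b]
    QuantumBruhat.downLeft b j y) (fun _ ↦ .refl _) (fun _ _ _ ↦ .trans) (fun x i h1 h2 ↦ ?_) h
  by_cases hij : x • i = j
  · rw [mul_ofIdx, hij, downLeft_mul]; exact .refl _
  · by_cases hy : b.IsPos ((x * σ i)⁻¹ • j)
    · rw [downLeft_of_isPos hy]
      exact (downLeft_bruhatLE hj _).trans (bruhatLE_mul_ofIdx h1 h2)
    · rw [downLeft_of_not_isPos hy]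
      exact (downLeft_bruhatLE_mul hj _).trans (simple_mul_step hj h1 h2 hij)

/-- The lifting property as a Galois connection; iterated, it gives Demazure multiplication a lower
adjoint (`exists_star_adjoint`). -/
theorem bruhatLE_upLeft_iff {j : ι} (hj : j ∈ b.support) {x z : P.weylGroup} :
    x ≼[b] upLeft b j z ↔ downLeft b j x ≼[b] z := by
  constructor
  · intro h
    have h1 := h.downLeft hj
    rw [downLeft_upLeft] at h1
    exact h1.trans (downLeft_bruhatLE hj z)
  · intro h
    have h1 := h.upLeft hj
    rw [upLeft_downLeft] at h1
    exact (bruhatLE_upLeft hj x).trans h1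

theorem bruhatLE_upRight {j : ι} (hj : j ∈ b.support) (w : P.weylGroup) :
    w ≼[b] upRight b j w := by
  rw [upRight_eq_inv_upLeft_inv, ← BruhatLE.inv_iff, inv_inv]
  exact bruhatLE_upLeft hj _

theorem BruhatLE.upRight {j : ι} (hj : j ∈ b.support) {x y : P.weylGroup} (h : x ≼[b] y) :
    upRight b j x ≼[b] upRight b j y := by
  rw [upRight_eq_inv_upLeft_inv, upRight_eq_inv_upLeft_inv]
  exact (h.inv.upLeft hj).inv

theorem mul_bruhatLE_of_bruhatLE_upRight {j : ι} (hj : j ∈ b.support) {x z : P.weylGroup}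
    (h : x ≼[b] upRight b j z) : x ≼[b] z ∨ ¬ b.IsPos (x • j) ∧ x * σ j ≼[b] z := by
  rw [upRight_eq_inv_upLeft_inv, ← BruhatLE.inv_iff, inv_inv, bruhatLE_upLeft_iff hj] at h
  by_cases hx : b.IsPos (x • j)
  · rw [downLeft_of_isPos (by rwa [inv_inv])] at h
    exact Or.inl (BruhatLE.inv_iff.mp h)
  · rw [downLeft_of_not_isPos (by rwa [inv_inv])] at h
    refine Or.inr ⟨hx, BruhatLE.inv_iff.mp ?_⟩
    rwa [mul_inv_rev, ofIdx_inv]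

/-- The germ of associativity of the Demazure product. The delicate case is $w\alpha_j=\alpha_i$,
where $ws_j=s_iw$ and either order of operations stops there. -/
theorem upLeft_upRight_comm {i j : ι} (hi : i ∈ b.support) (hj : j ∈ b.support)
    (w : P.weylGroup) : upLeft b i (upRight b j w) = upRight b j (upLeft b i w) := by
  have hjp := Base.isPos_of_mem_support hj
  have hip := Base.isPos_of_mem_support hi
  by_cases h1 : b.IsPos (w⁻¹ • i) <;> by_cases h2 : b.IsPos (w • j)
  · rw [upLeft_of_isPos h1, upRight_of_isPos h2]
    by_cases hij : w • j = i
    · have h3 : w * σ j = σ i * w := by rw [mul_ofIdx, hij]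
      rw [upRight_of_not_isPos (w := σ i * w), upLeft_of_not_isPos (w := w * σ j), h3]
      · rw [h3, isPos_inv_mul_smul]; exact not_not.mpr h1
      · rw [← h3, isPos_mul_smul]; exact not_not.mpr h2
    · rw [upRight_of_isPos, upLeft_of_isPos, mul_assoc]
      · rw [mul_inv_rev, ofIdx_inv, mul_smul]
        exact isPos_ofIdx_smul hj h1 fun h ↦ hij (by rw [← h, smul_inv_smul])
      · rw [mul_smul]; exact isPos_ofIdx_smul hi h2 hij
  · rw [upLeft_of_isPos h1, upRight_of_not_isPos h2, upLeft_of_isPos h1, upRight_of_not_isPos]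
    rw [mul_smul]
    refine not_isPos_ofIdx_smul hi h2 fun h ↦ ?_
    have h3 : w⁻¹ • i = σ j • j := by
      rw [← inv_smul_smul w j, h, smul_neg_idx, ofIdx_neg_idx, ofIdx_smul_smul]
    rw [h3, isPos_neg_idx] at h1
    exact h1 hjp
  · rw [upLeft_of_not_isPos h1, upRight_of_isPos h2, upLeft_of_not_isPos]
    rw [mul_inv_rev, ofIdx_inv, mul_smul]
    refine not_isPos_ofIdx_smul hj h1 fun h ↦ ?_
    have h3 : w • j = σ i • i := by
      rw [← smul_inv_smul w i, h, smul_neg_idx, ofIdx_neg_idx, ofIdx_smul_smul]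
    rw [h3, isPos_neg_idx] at h2
    exact h2 hip
  · rw [upLeft_of_not_isPos h1, upRight_of_not_isPos h2, upLeft_of_not_isPos h1]

/-- A chain of Bruhat covers. -/
def CoverChain (b : P.Base) : P.weylGroup → P.weylGroup → Prop :=
  Relation.ReflTransGen fun x y ↦ ∃ i, b.IsPos i ∧ y = x * σ i ∧ length b y = length b x + 1

theorem coverChain_simple_mul {j : ι} (hj : j ∈ b.support) {w : P.weylGroup}
    (h : b.IsPos (w⁻¹ • j)) : CoverChain b w (σ j * w) := by
  refine Relation.ReflTransGen.single ⟨w⁻¹ • j, h, ?_, length_simple_mul_of_isPos hj h⟩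
  rw [mul_ofIdx, smul_inv_smul]

theorem CoverChain.simple_mul {j : ι} (hj : j ∈ b.support) {x y : P.weylGroup}
    (h : CoverChain b x y) (hx : b.IsPos (x⁻¹ • j)) (hy : b.IsPos (y⁻¹ • j)) :
    CoverChain b (σ j * x) (σ j * y) := by
  induction h using Relation.ReflTransGen.head_induction_on with
  | refl => exact .refl
  | head hs hrest ih =>
    rename_i a c
    obtain ⟨i, hi, rfl, hlen⟩ := hs
    have hai : b.IsPos (a • i) := by
      by_contra hneg
      have := length_mul_ofIdx_lt hi hneg
      omega
    by_cases hc : b.IsPos ((a * σ i)⁻¹ • j)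
    · refine Relation.ReflTransGen.head ⟨i, hi, (mul_assoc _ _ _).symm, ?_⟩ (ih hc)
      rw [length_simple_mul_of_isPos hj hx, length_simple_mul_of_isPos hj hc, hlen]
    · by_cases hij : a • i = j
      · rw [← hij, ← mul_ofIdx, hij]
        exact hrest.trans (coverChain_simple_mul hj hy)
      -- Impossible: $s_j$ would turn the cover into a relation from length $\ell(a)+1$ up to length
      -- $\ell(a)$.
      · have h1 := (simple_mul_step hj hi hai hij).length_le
        have h2 := length_simple_mul_of_not_isPos hj hc
        have h3 := length_simple_mul_of_isPos hj hx
        omega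

/-- Steps of the order may raise the length by more than one, but Bruhat edges of the quantum graph
may not, so relations are refined into covers. The induction removes a left descent of $y$. -/
theorem BruhatLE.coverChain {x y : P.weylGroup} (h : x ≼[b] y) : CoverChain b x y := by
  generalize hn : length b y = n
  induction n using Nat.strong_induction_on generalizing x y with
  | _ n ih =>
    by_cases hy : y = 1
    · have h1 := h.length_le
      rw [hy, length_one, Nat.le_zero] at h1
      rw [hy, eq_one_of_length_eq_zero h1]
      exact .refl
    · obtain ⟨j, hj, hjy⟩ := exists_not_isPos_inv_smul (b := b) hy
      have h1 := length_simple_mul_of_not_isPos hj hjy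
      have h2 := h.downLeft hj
      rw [downLeft_of_not_isPos hjy] at h2
      have hjy' := isPos_inv_mul_smul.mpr hjy
      by_cases hx : b.IsPos (x⁻¹ • j)
      · rw [downLeft_of_isPos hx] at h2
        have h3 := (ih _ (by omega) h2 rfl).trans (coverChain_simple_mul hj hjy')
        rwa [ofIdx_mul_cancel] at h3
      · rw [downLeft_of_not_isPos hx] at h2
        have h3 := (ih _ (by omega) h2 rfl).simple_mul hj (isPos_inv_mul_smul.mpr hx) hjy'
        rwa [ofIdx_mul_cancel, ofIdx_mul_cancel] at h3

end Bruhat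

/-! ### The Demazure product -/

section Star

variable {b : P.Base} [Fintype ι] [P.IsCrystallographic] [P.IsReduced]

/-- The Demazure product of `u` and `v`. -/
def star (b : P.Base) (u v : P.weylGroup) : P.weylGroup :=
  (exists_reduced_word (b := b) u).choose.foldr (upLeft b) v

theorem length_mul_le (u v : P.weylGroup) : length b (u * v) ≤ length b u + length b v := by
  obtain ⟨l, h1, h2, h3⟩ := exists_reduced_word (b := b) u
  obtain ⟨l', h1', h2', h3'⟩ := exists_reduced_word (b := b) v
  have h4 := length_le (b := b) (l ++ l') (by simpa [or_imp, forall_and] using ⟨h1, h1'⟩)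
  rwa [List.map_append, List.prod_append, h3, h3', List.length_append, h2, h2'] at h4

theorem foldr_upLeft_one (l : List ι) (hl : ∀ i ∈ l, i ∈ b.support)
    (hr : l.length = length b (l.map σ).prod) : l.foldr (upLeft b) 1 = (l.map σ).prod := by
  induction l with
  | nil => rfl
  | cons i l ih =>
    have hi : i ∈ b.support := hl i (by simp)
    have hl' : ∀ i ∈ l, i ∈ b.support := fun k hk ↦ hl k (by simp [hk])
    rw [List.map_cons, List.prod_cons, List.length_cons] at hr
    have h1 := length_le l hl'
    have hp : b.IsPos ((l.map σ).prod⁻¹ • i) := by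
      by_contra hn
      have := length_simple_mul_of_not_isPos hi hn
      omega
    rw [length_simple_mul_of_isPos hi hp] at hr
    rw [List.foldr_cons, ih hl' (by omega), upLeft_of_isPos hp, List.map_cons, List.prod_cons]

theorem foldl_upRight_one (l : List ι) (hl : ∀ i ∈ l, i ∈ b.support)
    (hr : l.length = length b (l.map σ).prod) :
    l.foldl (fun w j ↦ upRight b j w) 1 = (l.map σ).prod := by
  induction l using List.reverseRecOn with
  | nil => rfl
  | append_singleton l i ih =>
    have hi : i ∈ b.support := hl i (by simp)
    have hl' : ∀ i ∈ l, i ∈ b.support := fun k hk ↦ hl k (by simp [hk])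
    simp only [List.map_append, List.map_cons, List.map_nil, List.prod_append, List.prod_cons,
      List.prod_nil, mul_one, List.length_append, List.length_singleton, List.foldl_append,
      List.foldl_cons, List.foldl_nil] at hr ⊢
    have h1 := length_le l hl'
    have hp : b.IsPos ((l.map σ).prod • i) := by
      by_contra hn
      have := length_mul_simple_of_not_isPos hi hn
      omega
    rw [length_mul_simple_of_isPos hi hp] at hr
    rw [ih hl' (by omega), upRight_of_isPos hp]

theorem foldr_upLeft_foldl_upRight (l l' : List ι) (hl : ∀ i ∈ l, i ∈ b.support)
    (hl' : ∀ i ∈ l', i ∈ b.support) (w : P.weylGroup) :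
    l.foldr (upLeft b) (l'.foldl (fun w j ↦ upRight b j w) w) =
      l'.foldl (fun w j ↦ upRight b j w) (l.foldr (upLeft b) w) := by
  have h1 : ∀ i ∈ b.support, ∀ w : P.weylGroup,
      upLeft b i (l'.foldl (fun w j ↦ upRight b j w) w) =
        l'.foldl (fun w j ↦ upRight b j w) (upLeft b i w) := by
    intro i hi
    induction l' with
    | nil => intro w; rfl
    | cons j l' ih =>
      intro w
      rw [List.foldl_cons, List.foldl_cons, ih fun k hk ↦ hl' k (by simp [hk]),
        upLeft_upRight_comm hi (hl' j (by simp))]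
  induction l with
  | nil => rfl
  | cons i l ih =>
    rw [List.foldr_cons, List.foldr_cons, ih fun k hk ↦ hl k (by simp [hk]),
      h1 i (hl i (by simp))]

/-- Both words are applied to $1$ and commuted past each other. Hence the reduced word chosen in
`star` does not matter, and the product can be read off a reduced word of either factor. -/
theorem star_eq_foldl (u : P.weylGroup) (l : List ι) (hl : ∀ i ∈ l, i ∈ b.support)
    (hr : l.length = length b (l.map σ).prod) :
    star b u (l.map σ).prod = l.foldl (fun w j ↦ upRight b j w) u := by
  obtain ⟨h1, h2, h3⟩ := (exists_reduced_word (b := b) u).choose_spec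
  rw [star, ← foldl_upRight_one l hl hr, foldr_upLeft_foldl_upRight _ _ h1 hl,
    foldr_upLeft_one _ h1 (by rw [h3, h2]), h3]

theorem star_eq_foldr (v : P.weylGroup) (l : List ι) (hl : ∀ i ∈ l, i ∈ b.support)
    (hr : l.length = length b (l.map σ).prod) :
    star b (l.map σ).prod v = l.foldr (upLeft b) v := by
  obtain ⟨l', h1, h2, rfl⟩ := exists_reduced_word (b := b) v
  rw [star_eq_foldl _ l' h1 h2, ← foldl_upRight_one l' h1 h2, foldr_upLeft_foldl_upRight _ _ hl h1,
    foldr_upLeft_one l hl hr]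

theorem one_star (v : P.weylGroup) : star b 1 v = v :=
  star_eq_foldr (b := b) v [] (by simp) (by simp [length_one])

theorem star_one (u : P.weylGroup) : star b u 1 = u :=
  star_eq_foldl (b := b) u [] (by simp) (by simp [length_one])

theorem length_simple {j : ι} (hj : j ∈ b.support) : length b (σ j) = 1 := by
  have h := length_mul_simple_of_isPos (b := b) (w := 1) hj
    (by rw [one_smul]; exact Base.isPos_of_mem_support hj)
  rwa [one_mul, length_one] at h

theorem simple_star {j : ι} (hj : j ∈ b.support) (v : P.weylGroup) :
    star b (σ j) v = upLeft b j v := by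
  simpa using star_eq_foldr (b := b) v [j] (by simpa using hj) (by simp [length_simple hj])

theorem star_simple {j : ι} (hj : j ∈ b.support) (u : P.weylGroup) :
    star b u (σ j) = upRight b j u := by
  simpa using star_eq_foldl (b := b) u [j] (by simpa using hj) (by simp [length_simple hj])

theorem star_assoc (u v w : P.weylGroup) : star b (star b u v) w = star b u (star b v w) := by
  obtain ⟨l, h1, h2, rfl⟩ := exists_reduced_word (b := b) w
  obtain ⟨l', h1', h2', rfl⟩ := exists_reduced_word (b := b) u
  rw [star_eq_foldl _ l h1 h2, star_eq_foldr _ l' h1' h2', star_eq_foldr _ l' h1' h2',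
    star_eq_foldl _ l h1 h2, foldr_upLeft_foldl_upRight _ _ h1' h1]

theorem star_mono {u u' v v' : P.weylGroup} (hu : u ≼[b] u') (hv : v ≼[b] v') :
    star b u v ≼[b] star b u' v' := by
  have h1 : star b u v ≼[b] star b u v' := by
    obtain ⟨l, h1, h2, rfl⟩ := exists_reduced_word (b := b) u
    rw [star_eq_foldr _ l h1 h2, star_eq_foldr _ l h1 h2]
    clear h2 hu
    induction l with
    | nil => exact hv
    | cons i l ih => exact (ih fun k hk ↦ h1 k (by simp [hk])).upLeft (h1 i (by simp))
  refine h1.trans ?_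
  clear h1 hv
  obtain ⟨l, h1, h2, rfl⟩ := exists_reduced_word (b := b) v'
  rw [star_eq_foldl _ l h1 h2, star_eq_foldl _ l h1 h2]
  clear h2
  induction l using List.reverseRecOn with
  | nil => exact hu
  | append_singleton l i ih =>
    simp only [List.foldl_append, List.foldl_cons, List.foldl_nil]
    exact (ih fun k hk ↦ h1 k (by simp [hk])).upRight (h1 i (by simp))

theorem bruhatLE_star_left (u v : P.weylGroup) : u ≼[b] star b u v := by
  simpa [star_one] using star_mono (b := b) (.refl u) (one_bruhatLE v)

theorem mul_bruhatLE_star (u v : P.weylGroup) : u * v ≼[b] star b u v := by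
  obtain ⟨l, h1, h2, rfl⟩ := exists_reduced_word (b := b) u
  rw [star_eq_foldr _ l h1 h2]
  clear h2
  induction l with
  | nil => simpa using BruhatLE.refl v
  | cons i l ih =>
    rw [List.map_cons, List.prod_cons, mul_assoc, List.foldr_cons]
    exact (mul_bruhatLE_upLeft (h1 i (by simp)) _).trans
      ((ih fun k hk ↦ h1 k (by simp [hk])).upLeft (h1 i (by simp)))

/-- The Demazure product is a length-additive product of an element below `u` and of `v`. -/
theorem exists_star_eq_mul (u v : P.weylGroup) : ∃ u', u' ≼[b] u ∧ star b u v = u' * v ∧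
    length b (u' * v) = length b u' + length b v := by
  obtain ⟨l, h1, h2, rfl⟩ := exists_reduced_word (b := b) u
  rw [star_eq_foldr _ l h1 h2, ← foldr_upLeft_one l h1 h2]
  clear h2
  induction l with
  | nil => exact ⟨1, .refl 1, by simp, by simp [length_one]⟩
  | cons i l ih =>
    obtain ⟨u', h3, h4, h5⟩ := ih fun k hk ↦ h1 k (by simp [hk])
    have hi : i ∈ b.support := h1 i (by simp)
    rw [List.foldr_cons, List.foldr_cons, h4]
    by_cases hp : b.IsPos ((u' * v)⁻¹ • i)
    · have h6 := length_simple_mul_of_isPos hi hp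
      have h7 := length_mul_le (b := b) (σ i * u') v
      rw [mul_assoc] at h7
      have h8 : b.IsPos (u'⁻¹ • i) := by
        by_contra hn
        have := length_simple_mul_of_not_isPos hi hn
        omega
      refine ⟨σ i * u', ?_, by rw [upLeft_of_isPos hp, mul_assoc], ?_⟩
      · rw [← upLeft_of_isPos h8]; exact h3.upLeft hi
      · rw [mul_assoc, h6, length_simple_mul_of_isPos hi h8, h5]; omega
    · exact ⟨u', h3.trans (bruhatLE_upLeft hi _), by rw [upLeft_of_not_isPos hp], h5⟩

theorem isDemazureProduct_star (u v : P.weylGroup) : IsDemazureProduct b u v (star b u v) := by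
  constructor
  · obtain ⟨u', h1, h2, _⟩ := exists_star_eq_mul (b := b) u v
    exact ⟨u', v, h1, BruhatLE.refl v, h2⟩
  · rintro _ ⟨u', v', h1, h2, rfl⟩
    exact (mul_bruhatLE_star u' v').trans (star_mono h1 h2)

theorem IsBruhatMax.unique {S : Set P.weylGroup} {x y : P.weylGroup} (hx : IsBruhatMax b S x)
    (hy : IsBruhatMax b S y) : x = y :=
  BruhatLE.antisymm (b := b) (hy.2 hx.1) (hx.2 hy.1)

theorem existsUnique_isDemazureProduct (u v : P.weylGroup) :
    ∃! w : P.weylGroup, IsDemazureProduct b u v w :=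
  ⟨star b u v, isDemazureProduct_star u v, fun _ h ↦ h.unique (isDemazureProduct_star u v)⟩

theorem demazure_eq_star (u v : P.weylGroup) : demazure b u v = star b u v :=
  IsBruhatMax.unique (Classical.epsilon_spec (p := IsDemazureProduct b u v)
    ⟨_, isDemazureProduct_star u v⟩) (isDemazureProduct_star u v)

end Star

/-! ### Standard parabolic subgroups, detected by coefficients outside `J` -/

section Parabolic

variable {b : P.Base} [Fintype ι] [P.IsCrystallographic] [P.IsReduced]

/-- Membership in the standard parabolic subgroup attached to the simple roots in `J`. -/
def IsParabolic (b : P.Base) (J : Finset ι) (x : P.weylGroup) : Prop :=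
  ∀ η : ι, ∀ i ∈ b.support, i ∉ J →
    rootCoeff b i (P.root (x • η)) = rootCoeff b i (P.root η)

theorem IsParabolic.one (J : Finset ι) : IsParabolic b J 1 := fun η _ _ _ ↦ by rw [one_smul]

theorem IsParabolic.mul {J : Finset ι} {x y : P.weylGroup} (hx : IsParabolic b J x)
    (hy : IsParabolic b J y) : IsParabolic b J (x * y) := fun η i hi hJ ↦ by
  rw [mul_smul, hx _ i hi hJ, hy _ i hi hJ]

theorem IsParabolic.inv {J : Finset ι} {x : P.weylGroup} (hx : IsParabolic b J x) :
    IsParabolic b J x⁻¹ := fun η i hi hJ ↦ by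
  rw [← hx _ i hi hJ, smul_inv_smul]

theorem isParabolic_support (x : P.weylGroup) : IsParabolic b b.support x :=
  fun _ _ hi hJ ↦ absurd hi hJ

theorem isParabolic_ofIdx {J : Finset ι} {k : ι}
    (h : ∀ i ∈ b.support, i ∉ J → rootCoeff b i (P.root k) = 0) : IsParabolic b J (σ k) :=
  fun η i hi hJ ↦ by rw [root_ofIdx_smul, map_sub, map_smul, h i hi hJ, smul_zero, sub_zero]

theorem isParabolic_simple {J : Finset ι} {j : ι} (hj : j ∈ b.support) (hJ : j ∈ J) :
    IsParabolic b J (σ j) :=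
  isParabolic_ofIdx fun _ hi hiJ ↦ rootCoeff_ne hi hj (fun h ↦ hiJ (h ▸ hJ))

theorem IsParabolic.isPos_smul {J : Finset ι} {x : P.weylGroup} (hx : IsParabolic b J x)
    {j : ι} (hj : j ∈ b.support) (hJ : j ∉ J) : b.IsPos (x • j) :=
  isPos_of_rootCoeff_pos hj (by rw [hx _ j hj hJ, rootCoeff_self hj]; norm_num)

theorem IsParabolic.downLeft {J : Finset ι} {x : P.weylGroup} (hx : IsParabolic b J x)
    {j : ι} (hj : j ∈ b.support) : IsParabolic b J (downLeft b j x) := by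
  by_cases h : b.IsPos (x⁻¹ • j)
  · rwa [downLeft_of_isPos h]
  · rw [downLeft_of_not_isPos h]
    by_cases hJ : j ∈ J
    · exact (isParabolic_simple hj hJ).mul hx
    · exact absurd (hx.inv.isPos_smul hj hJ) h

/-- Left Demazure multiplication by `u` has a lower adjoint, preserving standard parabolic
subgroups. -/
theorem exists_star_adjoint (u x : P.weylGroup) :
    ∃ x', (∀ z, x ≼[b] star b u z ↔ x' ≼[b] z) ∧
      ∀ J, IsParabolic b J x → IsParabolic b J x' := by
  obtain ⟨l, h1, h2, rfl⟩ := exists_reduced_word (b := b) u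
  simp only [star_eq_foldr _ l h1 h2]
  clear h2
  induction l generalizing x with
  | nil => exact ⟨x, by simp, fun _ ↦ id⟩
  | cons i l ih =>
    have hi : i ∈ b.support := h1 i (by simp)
    obtain ⟨x', h3, h4⟩ := ih (downLeft b i x) fun k hk ↦ h1 k (by simp [hk])
    exact ⟨x', fun z ↦ by rw [List.foldr_cons, bruhatLE_upLeft_iff hi, h3],
      fun J hJ ↦ h4 J (hJ.downLeft hi)⟩

end Parabolic

local notation:70 x:70 " ⋆[" b "] " y:71 => star b x y

/-! ### The coroot monoid, heights and the pairing with $2\rho$ -/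

section Cone

/-- The monoid generated by the coroots with index in `J`. -/
def coneOn (P : RootPairing ι ℝ M N) (J : Finset ι) : AddSubmonoid N :=
  AddSubmonoid.closure (P.coroot '' (J : Set ι))

/-- The group generated by the simple coroots. -/
def corootLattice (b : P.Base) : AddSubgroup N :=
  AddSubgroup.closure (P.coroot '' (b.support : Set ι))

/-- The coordinates with respect to the simple coroots. -/
def corootCoeff (b : P.Base) (i : ι) : N →ₗ[ℝ] ℝ := rootCoeff b.flip i

/-- The pairing of the root of index `j` with an element of `N`. -/
def rootEval (P : RootPairing ι ℝ M N) (j : ι) : N →ₗ[ℝ] ℝ := P.toLinearMap (P.root j)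

/-- The sum of the coordinates with respect to the simple coroots. -/
def corootHeight (b : P.Base) : N →ₗ[ℝ] ℝ := ∑ i ∈ b.support, corootCoeff b i

theorem corootHeight_apply (b : P.Base) (γ : N) :
    corootHeight b γ = ∑ i ∈ b.support, corootCoeff b i γ := by
  simp [corootHeight]

variable {b : P.Base} [Fintype ι] [P.IsCrystallographic] [P.IsReduced]

theorem rootEval_coroot (i j : ι) : rootEval P i (P.coroot j) = P.pairingIn ℤ i j := by
  rw [rootEval, root_coroot_eq_pairing, pairing_cast]

theorem corootCoeff_self {i : ι} (hi : i ∈ b.support) : corootCoeff b i (P.coroot i) = 1 :=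
  rootCoeff_self (b := b.flip) hi

theorem corootCoeff_ne {i j : ι} (hi : i ∈ b.support) (hj : j ∈ b.support) (hij : j ≠ i) :
    corootCoeff b i (P.coroot j) = 0 :=
  rootCoeff_ne (b := b.flip) hi hj hij

theorem corootHeight_simple {i : ι} (hi : i ∈ b.support) : corootHeight b (P.coroot i) = 1 := by
  rw [corootHeight_apply, Finset.sum_eq_single_of_mem i hi
    (fun j hj hji ↦ corootCoeff_ne hj hi hji.symm), corootCoeff_self hi]

theorem coneOn_mono {J J' : Finset ι} (h : J ⊆ J') : coneOn P J ≤ coneOn P J' :=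
  AddSubmonoid.closure_mono (Set.image_mono (by exact_mod_cast h))

theorem coroot_mem_coneOn {J : Finset ι} {j : ι} (hj : j ∈ J) : P.coroot j ∈ coneOn P J :=
  AddSubmonoid.subset_closure ⟨j, hj, rfl⟩

theorem coroot_mem_corootLattice (k : ι) : P.coroot k ∈ corootLattice b := by
  have key : ∀ γ ∈ corootCone b, γ ∈ corootLattice b := fun γ hγ ↦ by
    induction hγ using AddSubmonoid.closure_induction with
    | mem x hx => exact AddSubgroup.subset_closure hx
    | zero => exact zero_mem _
    | add x y _ _ hx hy => exact add_mem hx hy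
  by_cases hk : b.IsPos k
  · exact key _ (coroot_mem_corootCone hk)
  · have := key _ (coroot_mem_corootCone (not_isPos_iff.mp hk))
    rwa [coroot_neg_idx, neg_mem_iff] at this

theorem eq_sum_corootCoeff {γ : N} (h : γ ∈ corootLattice b) :
    γ = ∑ j ∈ b.support, corootCoeff b j γ • P.coroot j := by
  induction h using AddSubgroup.closure_induction with
  | mem x hx =>
    obtain ⟨i, hi, rfl⟩ := hx
    rw [Finset.sum_eq_single_of_mem i hi (fun j hj hji ↦ by
      rw [corootCoeff_ne hj hi hji.symm, zero_smul]), corootCoeff_self hi, one_smul]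
  | zero => simp
  | add x y _ _ hx hy =>
    simp only [map_add, add_smul, Finset.sum_add_distrib, ← hx, ← hy]
  | neg x _ hx => simp only [map_neg, neg_smul, Finset.sum_neg_distrib, ← hx]

theorem exists_int_corootCoeff {γ : N} (h : γ ∈ corootLattice b) {i : ι} (hi : i ∈ b.support) :
    ∃ n : ℤ, corootCoeff b i γ = n := by
  induction h using AddSubgroup.closure_induction with
  | mem x hx =>
    obtain ⟨j, hj, rfl⟩ := hx
    by_cases hij : j = i
    · subst hij; exact ⟨1, by rw [corootCoeff_self hi]; simp⟩
    · exact ⟨0, by rw [corootCoeff_ne hi hj hij]; simp⟩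
  | zero => exact ⟨0, by simp⟩
  | add x y _ _ hx hy =>
    obtain ⟨m, hm⟩ := hx
    obtain ⟨n, hn⟩ := hy
    exact ⟨m + n, by rw [map_add, hm, hn]; push_cast; ring⟩
  | neg x _ hx =>
    obtain ⟨m, hm⟩ := hx
    exact ⟨-m, by rw [map_neg, hm]; push_cast; ring⟩

theorem exists_int_rootEval {γ : N} (h : γ ∈ corootLattice b) (i : ι) :
    ∃ n : ℤ, rootEval P i γ = n := by
  induction h using AddSubgroup.closure_induction with
  | mem x hx =>
    obtain ⟨j, hj, rfl⟩ := hx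
    exact ⟨_, rootEval_coroot i j⟩
  | zero => exact ⟨0, by simp⟩
  | add x y _ _ hx hy =>
    obtain ⟨m, hm⟩ := hx
    obtain ⟨n, hn⟩ := hy
    exact ⟨m + n, by rw [map_add, hm, hn]; push_cast; ring⟩
  | neg x _ hx =>
    obtain ⟨m, hm⟩ := hx
    exact ⟨-m, by rw [map_neg, hm]; push_cast; ring⟩

theorem mem_coneOn_iff {J : Finset ι} (hJ : J ⊆ b.support) {γ : N} :
    γ ∈ coneOn P J ↔ γ ∈ corootLattice b ∧
      ∀ i ∈ b.support, 0 ≤ corootCoeff b i γ ∧ (i ∉ J → corootCoeff b i γ = 0) := by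
  constructor
  · intro h
    refine ⟨?_, fun i hi ↦ ?_⟩
    · induction h using AddSubmonoid.closure_induction with
      | mem x hx => obtain ⟨j, hj, rfl⟩ := hx; exact coroot_mem_corootLattice j
      | zero => exact zero_mem _
      | add x y _ _ hx hy => exact add_mem hx hy
    · induction h using AddSubmonoid.closure_induction with
      | mem x hx =>
        obtain ⟨j, hj, rfl⟩ := hx
        by_cases hij : j = i
        · subst hij
          rw [corootCoeff_self hi]
          exact ⟨zero_le_one, fun h ↦ absurd hj h⟩
        · rw [corootCoeff_ne hi (hJ hj) hij]
          exact ⟨le_rfl, fun _ ↦ rfl⟩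
      | zero => simp
      | add x y _ _ hx hy =>
        rw [map_add]
        exact ⟨add_nonneg hx.1 hy.1, fun h ↦ by rw [hx.2 h, hy.2 h, add_zero]⟩
  · rintro ⟨h, h'⟩
    rw [eq_sum_corootCoeff h]
    refine sum_mem fun i hi ↦ ?_
    by_cases hiJ : i ∈ J
    · obtain ⟨n, hn⟩ := exists_int_corootCoeff h hi
      have h1 := (h' i hi).1
      rw [hn] at h1 ⊢
      lift n to ℕ using by exact_mod_cast h1
      rw [Int.cast_natCast, Nat.cast_smul_eq_nsmul]
      exact nsmul_mem (coroot_mem_coneOn hiJ) n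
    · rw [(h' i hi).2 hiJ, zero_smul]
      exact zero_mem _

theorem mem_corootCone_iff {γ : N} : γ ∈ corootCone b ↔ γ ∈ corootLattice b ∧
      ∀ i ∈ b.support, 0 ≤ corootCoeff b i γ := by
  refine (mem_coneOn_iff (b := b) subset_rfl).trans (and_congr_right fun _ ↦ forall₂_congr ?_)
  exact fun i hi ↦ ⟨fun h ↦ h.1, fun h ↦ ⟨h, fun h' ↦ absurd hi h'⟩⟩

theorem mem_corootLattice_of_mem_corootCone {γ : N} (h : γ ∈ corootCone b) :
    γ ∈ corootLattice b := (mem_corootCone_iff.mp h).1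

theorem corootCoeff_nonneg {γ : N} (h : γ ∈ corootCone b) {i : ι} (hi : i ∈ b.support) :
    0 ≤ corootCoeff b i γ := (mem_corootCone_iff.mp h).2 i hi

theorem sub_coroot_mem {J : Finset ι} (hJ : J ⊆ b.support) {γ : N} (h : γ ∈ coneOn P J) {j : ι}
    (hj : j ∈ b.support) (hpos : 0 < corootCoeff b j γ) : γ - P.coroot j ∈ coneOn P J := by
  obtain ⟨h1, h2⟩ := (mem_coneOn_iff hJ).mp h
  refine (mem_coneOn_iff hJ).mpr ⟨sub_mem h1 (coroot_mem_corootLattice j), fun i hi ↦ ?_⟩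
  rw [map_sub]
  by_cases hij : j = i
  · subst hij
    obtain ⟨n, hn⟩ := exists_int_corootCoeff h1 hi
    rw [corootCoeff_self hi]
    rw [hn] at hpos ⊢
    have h3 : (1 : ℝ) ≤ n := by exact_mod_cast hpos
    refine ⟨by linarith, fun hJ ↦ ?_⟩
    have := (h2 j hi).2 hJ
    rw [hn] at this
    linarith
  · rw [corootCoeff_ne hi hj hij, sub_zero]
    exact h2 i hi

theorem corootHeight_nonneg {γ : N} (h : γ ∈ corootCone b) : 0 ≤ corootHeight b γ := by
  rw [corootHeight_apply]
  exact Finset.sum_nonneg fun i hi ↦ corootCoeff_nonneg h hi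

theorem eq_zero_of_corootCoeff {γ : N} (h : γ ∈ corootLattice b)
    (h' : ∀ i ∈ b.support, corootCoeff b i γ = 0) : γ = 0 := by
  rw [eq_sum_corootCoeff h]
  exact Finset.sum_eq_zero fun i hi ↦ by rw [h' i hi, zero_smul]

theorem exists_corootCoeff_pos {γ : N} (h : γ ∈ corootCone b) (h' : γ ≠ 0) :
    ∃ i ∈ b.support, 0 < corootCoeff b i γ := by
  by_contra! hcon
  exact h' (eq_zero_of_corootCoeff (mem_corootLattice_of_mem_corootCone h)
    fun i hi ↦ le_antisymm (hcon i hi) (corootCoeff_nonneg h hi))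

theorem one_le_corootHeight {γ : N} (h : γ ∈ corootCone b) (h' : γ ≠ 0) :
    1 ≤ corootHeight b γ := by
  obtain ⟨i, hi, hpos⟩ := exists_corootCoeff_pos h h'
  have h1 := corootHeight_nonneg (sub_coroot_mem (b := b) subset_rfl h hi hpos)
  rw [map_sub, corootHeight_simple hi] at h1
  linarith

theorem corootCone_antisymm {γ : N} (h : γ ∈ corootCone b) (h' : -γ ∈ corootCone b) : γ = 0 := by
  by_contra hne
  have h1 := one_le_corootHeight h hne
  have h2 := corootHeight_nonneg h'
  rw [map_neg] at h2
  linarith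

theorem one_le_corootHeight_coroot {k : ι} (hk : b.IsPos k) :
    1 ≤ corootHeight b (P.coroot k) :=
  one_le_corootHeight (coroot_mem_corootCone hk) (P.ne_zero' k)

theorem corootCone_induction {p : N → Prop} (ind : ∀ γ ∈ corootCone b, (∀ γ' ∈ corootCone b,
    corootHeight b γ' ≤ corootHeight b γ - 1 → p γ') → p γ) {γ : N} (hγ : γ ∈ corootCone b) :
    p γ := by
  obtain ⟨n, hn⟩ := exists_nat_ge (corootHeight b γ)
  induction n generalizing γ with
  | zero =>
    refine ind γ hγ fun γ' h h' ↦ ?_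
    have := corootHeight_nonneg h
    push_cast at hn
    linarith
  | succ n ih => exact ind γ hγ fun γ' h h' ↦ ih h (by push_cast at hn; linarith)

-- The involution $i\mapsto s_ki$ on positive roots that stay positive reverses the sign of the
-- pairing with $\alpha_k^\vee$, so these terms cancel and the inversions of $s_k$ remain.
open Classical in
theorem twoRho_apply_coroot (k : ι) : P.toLinearMap (twoRho b) (P.coroot k) =
    ∑ i ∈ inversions b (σ k), (P.pairingIn ℤ i k : ℝ) := by
  have h1 : P.toLinearMap (twoRho b) (P.coroot k) =
      ∑ i : ι with b.IsPos i, (P.pairingIn ℤ i k : ℝ) := by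
    rw [twoRho, map_sum, LinearMap.sum_apply]
    exact Finset.sum_congr rfl fun i _ ↦ rootEval_coroot i k
  have h2 : ∑ i ∈ (Finset.univ.filter fun i ↦ b.IsPos i) with b.IsPos (σ k • i),
      (P.pairingIn ℤ i k : ℝ) = 0 := by
    have hneg : ∀ a : ι, (P.pairingIn ℤ (σ k • a) k : ℝ) = - P.pairingIn ℤ a k := fun a ↦ by
      rw [pairingIn_smul_left, ofIdx_inv, pairingIn_neg_right, Int.cast_neg]
    refine Finset.sum_involution (fun a _ ↦ σ k • a) (fun a _ ↦ by rw [hneg]; ring)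
      (fun a _ ha h ↦ ha ?_) (fun a ha ↦ ?_) (fun a _ ↦ ofIdx_smul_smul k a)
    · have := hneg a
      rw [h] at this
      linarith
    · simp only [Finset.mem_filter, Finset.mem_univ, true_and, ofIdx_smul_smul] at ha ⊢
      exact ⟨ha.2, ha.1⟩
  rw [h1, ← Finset.sum_filter_add_sum_filter_not _ (fun i ↦ b.IsPos (σ k • i)), h2, zero_add]
  refine Finset.sum_congr ?_ fun _ _ ↦ rfl
  ext i
  simp [mem_inversions]

theorem inversions_simple {j : ι} (hj : j ∈ b.support) : inversions b (σ j) = {j} := by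
  ext i
  rw [mem_inversions, Finset.mem_singleton]
  constructor
  · exact fun h ↦ eq_of_not_isPos_ofIdx_smul hj h.1 h.2
  · rintro rfl
    have := Base.isPos_of_mem_support hj
    exact ⟨this, by rw [isPos_neg_idx]; exact not_not.mpr this⟩

theorem twoRho_apply_simple {j : ι} (hj : j ∈ b.support) :
    P.toLinearMap (twoRho b) (P.coroot j) = 2 := by
  rw [twoRho_apply_coroot, inversions_simple hj, Finset.sum_singleton, pairingIn_same]
  norm_num

theorem twoRho_apply {γ : N} (h : γ ∈ corootLattice b) :
    P.toLinearMap (twoRho b) γ = 2 * corootHeight b γ := by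
  induction h using AddSubgroup.closure_induction with
  | mem x hx =>
    obtain ⟨i, hi, rfl⟩ := hx
    rw [twoRho_apply_simple hi, corootHeight_simple hi, mul_one]
  | zero => simp
  | add x y _ _ hx hy => rw [map_add, map_add, hx, hy]; ring
  | neg x _ hx => rw [map_neg, map_neg, hx]; ring

/-- A nonzero element of the coroot monoid pairs positively with a simple root in its support. -/
theorem exists_rootEval_pos {γ : N} (h : γ ∈ corootCone b) (h' : γ ≠ 0) :
    ∃ j ∈ b.support, 0 < corootCoeff b j γ ∧ 1 ≤ rootEval P j γ := by
  have hl := mem_corootLattice_of_mem_corootCone h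
  -- Otherwise $2\rho$ would pair nonpositively with $\gamma$, but the pairing is twice the positive
  -- height.
  have h1 : ∃ k, b.IsPos k ∧ 0 < rootEval P k γ := by
    by_contra! hcon
    have h2 := twoRho_apply hl
    have h3 := one_le_corootHeight h h'
    have h4 : P.toLinearMap (twoRho b) γ ≤ 0 := by
      classical
      rw [twoRho, map_sum, LinearMap.sum_apply]
      exact Finset.sum_nonpos fun k hk ↦ hcon k (by simpa using hk)
    linarith
  obtain ⟨k, hk, hkγ⟩ := h1
  have h2 : ∃ j ∈ b.support, 0 < rootEval P j γ := by
    by_contra! hcon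
    rw [rootEval, root_eq_sum_rootCoeff_of_mem (root_mem_of_isPos hk), map_sum,
      LinearMap.sum_apply] at hkγ
    refine hkγ.not_ge (Finset.sum_nonpos fun j hj ↦ ?_)
    rw [map_smul, LinearMap.smul_apply, smul_eq_mul]
    exact mul_nonpos_of_nonneg_of_nonpos (rootCoeff_nonneg hk hj) (hcon j hj)
  obtain ⟨j, hj, hjγ⟩ := h2
  refine ⟨j, hj, ?_, ?_⟩
  -- Without $\alpha_j^\vee$ in its support, $\gamma$ would pair with $\alpha_j$ through
  -- off-diagonal Cartan integers only, all nonpositive.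
  · refine lt_of_le_of_ne (corootCoeff_nonneg h hj) fun h0 ↦ hjγ.not_ge ?_
    rw [eq_sum_corootCoeff hl, map_sum]
    refine Finset.sum_nonpos fun i hi ↦ ?_
    rw [map_smul, smul_eq_mul, rootEval_coroot]
    by_cases hij : j = i
    · rw [← hij, ← h0, zero_mul]
    · refine mul_nonpos_of_nonneg_of_nonpos (corootCoeff_nonneg h hi) ?_
      exact_mod_cast b.pairingIn_le_zero_of_ne hij hj hi
  · obtain ⟨n, hn⟩ := exists_int_rootEval hl j
    rw [hn] at hjγ ⊢
    exact_mod_cast hjγ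

end Cone

/-! ### Weighted Demazure products of reflections and the rank-one analysis -/

section Word

variable {b : P.Base} [Fintype ι] [P.IsCrystallographic] [P.IsReduced]

theorem simple_star_self {j : ι} (hj : j ∈ b.support) : σ j ⋆[b] σ j = σ j := by
  rw [star_simple hj, upRight_of_not_isPos]
  rw [isPos_neg_idx]
  exact not_not.mpr (Base.isPos_of_mem_support hj)

theorem not_isPos_ofIdx_smul_of_pairingIn_pos {j k : ι} (hj : j ∈ b.support) (hk : b.IsPos k)
    (hkj : k ≠ j) (h : 0 < P.pairingIn ℤ j k) : ¬ b.IsPos (σ k • j) := by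
  obtain ⟨i, hi, hij, hpos⟩ := exists_rootCoeff_pos hk hj hkj
  refine not_isPos_of_rootCoeff_neg hi ?_
  rw [root_ofIdx_smul, map_sub, map_smul, rootCoeff_ne hi hj hij.symm, smul_eq_mul, zero_sub,
    neg_lt_zero]
  exact mul_pos (by exact_mod_cast h) hpos

theorem isPos_ofIdx_smul_of_pairingIn_nonpos {j k : ι} (hj : j ∈ b.support) (hk : b.IsPos k)
    (h : P.pairingIn ℤ j k ≤ 0) : b.IsPos (σ k • j) := by
  refine isPos_of_rootCoeff_pos hj ?_
  rw [root_ofIdx_smul, map_sub, map_smul, rootCoeff_self hj, smul_eq_mul]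
  have h1 := rootCoeff_nonneg hk hj
  have h2 : (P.pairingIn ℤ j k : ℝ) ≤ 0 := by exact_mod_cast h
  nlinarith

theorem ofIdx_star_simple_of_pos {j k : ι} (hj : j ∈ b.support) (hk : b.IsPos k)
    (h : 0 < P.pairingIn ℤ j k) : σ k ⋆[b] σ j = σ k := by
  by_cases hkj : k = j
  · rw [hkj, simple_star_self hj]
  · rw [star_simple hj, upRight_of_not_isPos (not_isPos_ofIdx_smul_of_pairingIn_pos hj hk hkj h)]

theorem ofIdx_smul_of_pairingIn_eq_zero {j k : ι} (h : P.pairingIn ℤ j k = 0) : σ k • j = j := by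
  apply P.root.injective
  rw [root_ofIdx_smul, h, Int.cast_zero, zero_smul, sub_zero]

theorem ofIdx_star_simple_comm {j k : ι} (hj : j ∈ b.support) (h : P.pairingIn ℤ j k = 0) :
    σ k ⋆[b] σ j = σ j ⋆[b] σ k := by
  have h1 := ofIdx_smul_of_pairingIn_eq_zero h
  have hp := Base.isPos_of_mem_support hj
  rw [star_simple hj, simple_star hj, upRight_of_isPos (by rwa [h1]),
    upLeft_of_isPos (by rwa [ofIdx_inv, h1]), mul_ofIdx, h1]

/-- Both multiplications by $s_j$ raise the length, so the Demazure product is the ordinary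
conjugate. The second could fail to do so only if $s_k$ fixed $\alpha_j$, which the nonzero pairing
forbids. -/
theorem simple_star_ofIdx_star_simple {j k : ι} (hj : j ∈ b.support) (hk : b.IsPos k)
    (h : P.pairingIn ℤ j k < 0) : σ j ⋆[b] (σ k ⋆[b] σ j) = σ (σ j • k) := by
  have h1 := isPos_ofIdx_smul_of_pairingIn_nonpos hj hk h.le
  have h2 : σ k • j ≠ j := fun h2 ↦ by
    have h3 := pairingIn_smul_left (σ k) j k
    rw [h2, ofIdx_inv, pairingIn_neg_right] at h3
    omega
  rw [star_simple hj, simple_star hj, upRight_of_isPos h1, upLeft_of_isPos, ← conj_ofIdx,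
    ofIdx_inv, mul_assoc]
  rw [mul_inv_rev, ofIdx_inv, ofIdx_inv, mul_smul]
  exact isPos_ofIdx_smul hj h1 h2

/-- `Word b γ w`: the element `w` is a Demazure product of reflections in positive roots whose
coroots add up to `γ`. -/
inductive Word (b : P.Base) : N → P.weylGroup → Prop
  | one : Word b 0 1
  | mul (γ : N) (x : P.weylGroup) (i : ι) (hi : b.IsPos i) (h : Word b γ x) :
      Word b (γ + P.coroot i) (x ⋆[b] σ i)

/-- `Covered b γ x`: the element `x` lies below a Demazure product of reflections in positive
roots whose coroots add up to `γ`. -/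
def Covered (b : P.Base) (γ : N) (x : P.weylGroup) : Prop := ∃ w, Word b γ w ∧ x ≼[b] w

theorem Word.covered {γ : N} {w : P.weylGroup} (h : Word b γ w) : Covered b γ w :=
  ⟨w, h, .refl w⟩

theorem Covered.of_le {γ : N} {x y : P.weylGroup} (h : Covered b γ y) (hx : x ≼[b] y) :
    Covered b γ x := by
  obtain ⟨w, h1, h2⟩ := h
  exact ⟨w, h1, hx.trans h2⟩

theorem Word.star {γ γ' : N} {x y : P.weylGroup} (hx : Word b γ x) (hy : Word b γ' y) :
    Word b (γ + γ') (x ⋆[b] y) := by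
  induction hy with
  | one => rwa [add_zero, star_one]
  | mul γ' y i hi _ ih =>
    rw [← add_assoc, ← star_assoc]
    exact ih.mul _ _ _ hi

theorem word_ofIdx {k : ι} (hk : b.IsPos k) : Word b (P.coroot k) (σ k) := by
  simpa [one_star] using Word.one.mul _ _ k hk

theorem covered_ofIdx {k : ι} (hk : b.IsPos k) : Covered b (P.coroot k) (σ k) :=
  (word_ofIdx hk).covered

theorem covered_simple {j : ι} (hj : j ∈ b.support) : Covered b (P.coroot j) (σ j) :=
  covered_ofIdx (Base.isPos_of_mem_support hj)

theorem Covered.star {γ γ' : N} {x y : P.weylGroup} (hx : Covered b γ x) (hy : Covered b γ' y) :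
    Covered b (γ + γ') (x ⋆[b] y) := by
  obtain ⟨w, h1, h2⟩ := hx
  obtain ⟨w', h1', h2'⟩ := hy
  exact ⟨_, h1.star h1', star_mono h2 h2'⟩

theorem covered_one {γ : N} (h : γ ∈ corootCone b) : Covered b γ 1 := by
  induction h using AddSubmonoid.closure_induction with
  | mem x hx =>
    obtain ⟨i, hi, rfl⟩ := hx
    exact (covered_simple hi).of_le (one_bruhatLE _)
  | zero => exact Word.one.covered
  | add x y _ _ hx hy => simpa [one_star] using hx.star hy

theorem Covered.add {γ γ' : N} {x : P.weylGroup} (h : Covered b γ x) (h' : γ' ∈ corootCone b) :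
    Covered b (γ + γ') x := by
  simpa [star_one] using h.star (covered_one h')

theorem Covered.mono {γ γ' : N} {x : P.weylGroup} (h : Covered b γ x)
    (h' : γ' - γ ∈ corootCone b) : Covered b γ' x := by
  simpa using h.add h'

theorem Word.mem_corootCone {γ : N} {w : P.weylGroup} (h : Word b γ w) : γ ∈ corootCone b := by
  induction h with
  | one => exact zero_mem _
  | mul γ x i hi _ ih => exact add_mem ih (coroot_mem_corootCone hi)

theorem Covered.mem_corootCone {γ : N} {x : P.weylGroup} (h : Covered b γ x) :
    γ ∈ corootCone b := by
  obtain ⟨w, h1, _⟩ := h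
  exact h1.mem_corootCone

theorem Word.eq_one {w : P.weylGroup} (h : Word b 0 w) : w = 1 := by
  generalize hγ : (0 : N) = γ at h
  cases h with
  | one => rfl
  | mul γ x i hi h =>
    have h1 := corootHeight_nonneg h.mem_corootCone
    have h2 := one_le_corootHeight_coroot hi
    have h3 := congrArg (corootHeight b) hγ
    rw [map_zero, map_add] at h3
    linarith

theorem covered_zero_iff {x : P.weylGroup} : Covered b 0 x ↔ x = 1 := by
  constructor
  · rintro ⟨w, h1, h2⟩
    rw [h1.eq_one] at h2
    exact h2.antisymm (one_bruhatLE x)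
  · rintro rfl
    exact Word.one.covered

theorem bruhatLE_one_iff {x : P.weylGroup} : x ≼[b] 1 ↔ x = 1 :=
  ⟨fun h ↦ h.antisymm (one_bruhatLE x), fun h ↦ h ▸ .refl x⟩

/-- Upper bounds `x` for Demazure products of reflections, of weight `g + c α^∨`, where
`⟨α, g⟩ = -q` and `α` is the simple root of index `j`. -/
structure RankOneBound (b : P.Base) (j : ι) (g : N) (q : ℕ) (x : P.weylGroup) : Prop where
  eval : rootEval P j g = -q
  star_right : x ⋆[b] σ j = x
  star_left : σ j ⋆[b] x = x
  full : ∀ c : ℕ, q + 1 ≤ 2 * c → Covered b (g + c • P.coroot j) x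
  right : ∀ c : ℕ, q ≤ 2 * c → ∃ v, Covered b (g + c • P.coroot j) v ∧ x ≼[b] v ⋆[b] σ j
  left : ∀ c : ℕ, q ≤ 2 * c → ∃ v, Covered b (g + c • P.coroot j) v ∧ x ≼[b] σ j ⋆[b] v
  inner : ∀ c : ℕ, q ≤ 2 * c + 1 →
    ∃ v, Covered b (g + c • P.coroot j) v ∧ x ≼[b] σ j ⋆[b] (v ⋆[b] σ j)

theorem Covered.simple {γ : N} {x : P.weylGroup} (h : Covered b γ x) {j : ι}
    (hj : j ∈ b.support) : Covered b (γ + P.coroot j) (x ⋆[b] σ j) := h.star (covered_simple hj)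

/-- Start of the induction: $s_j$ absorbs $s_j$ on both sides and costs a single $\alpha_j^\vee$,
available as soon as $2c\ge1$. -/
theorem rankOneBound_simple {j : ι} (hj : j ∈ b.support) : RankOneBound b j 0 0 (σ j) := by
  have h1 : ∀ c : ℕ, Covered b (0 + c • P.coroot j) 1 := fun c ↦ by
    rw [zero_add]
    exact covered_one (nsmul_mem (coroot_mem_coneOn hj) c)
  refine ⟨by simp, simple_star_self hj, simple_star_self hj, fun c hc ↦ ?_,
    fun c _ ↦ ⟨1, h1 c, ?_⟩, fun c _ ↦ ⟨1, h1 c, ?_⟩, fun c _ ↦ ⟨1, h1 c, ?_⟩⟩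
  · obtain ⟨d, rfl⟩ : ∃ d, c = d + 1 := ⟨c - 1, by omega⟩
    have h2 := (h1 d).simple hj
    rwa [one_star, add_assoc, ← succ_nsmul] at h2
  · rw [one_star]; exact .refl _
  · rw [star_one]; exact .refl _
  · rw [one_star, simple_star_self hj]; exact .refl _

theorem RankOneBound.append_orthogonal {j : ι} (hj : j ∈ b.support) {g : N} {q : ℕ}
    {x : P.weylGroup} (h : RankOneBound b j g q x) {k : ι} (hk : b.IsPos k)
    (hjk : P.pairingIn ℤ j k = 0) : RankOneBound b j (g + P.coroot k) q (x ⋆[b] σ k) := by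
  have hc := ofIdx_star_simple_comm hj hjk
  have hw : ∀ (c : ℕ) (v : P.weylGroup), Covered b (g + c • P.coroot j) v →
      Covered b (g + P.coroot k + c • P.coroot j) (v ⋆[b] σ k) := fun c v hv ↦ by
    rw [add_right_comm]
    exact hv.star (covered_ofIdx hk)
  refine ⟨?_, ?_, ?_, fun c hq ↦ hw c _ (h.full c hq), fun c hq ↦ ?_, fun c hq ↦ ?_,
    fun c hq ↦ ?_⟩
  · rw [map_add, h.eval, rootEval_coroot, hjk, Int.cast_zero, add_zero]
  · rw [star_assoc, hc, ← star_assoc, h.star_right]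
  · rw [← star_assoc, h.star_left]
  · obtain ⟨v, h1, h2⟩ := h.right c hq
    refine ⟨_, hw c _ h1, ?_⟩
    rw [star_assoc, hc, ← star_assoc]
    exact star_mono h2 (.refl _)
  · obtain ⟨v, h1, h2⟩ := h.left c hq
    refine ⟨_, hw c _ h1, ?_⟩
    rw [← star_assoc]
    exact star_mono h2 (.refl _)
  · obtain ⟨v, h1, h2⟩ := h.inner c hq
    refine ⟨_, hw c _ h1, ?_⟩
    rw [star_assoc, hc, ← star_assoc v, ← star_assoc]
    exact star_mono h2 (.refl _)

/-- In `full` and `left`, one extra $\alpha_j^\vee$ pays for the appended $s_k*s_j$. If $m\ge2$, the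
threshold for $2c$ rises by at least two, so $s_j$ can be bought separately. If $m=1$, the
reflection $s_js_ks_j$ with coroot $\alpha_k^\vee+\alpha_j^\vee$ is used instead, applied to the
weaker clause (`right` for `full`, `inner` for `left`) of the previous bound. In `right` and `inner`
the final $s_j$ is free. -/
theorem RankOneBound.append_neg {j : ι} (hj : j ∈ b.support) {g : N} {q : ℕ}
    {x : P.weylGroup} (h : RankOneBound b j g q x) {k : ι} (hk : b.IsPos k) {m : ℕ} (hm : 1 ≤ m)
    (hjk : P.pairingIn ℤ j k = -m) :
    RankOneBound b j (g + P.coroot k) (q + m) (x ⋆[b] (σ k ⋆[b] σ j)) := by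
  have hkj : k ≠ j := by
    rintro rfl
    rw [pairingIn_same] at hjk
    omega
  have hconj := simple_star_ofIdx_star_simple hj hk (by omega)
  have hk' : b.IsPos (σ j • k) := isPos_ofIdx_smul hj hk hkj
  have hco : P.coroot (σ j • k) = P.coroot k + (m : ℝ) • P.coroot j := by
    rw [coroot_ofIdx_smul, hjk]
    push_cast
    rw [neg_smul, sub_neg_eq_add]
  have hw : ∀ (c : ℕ) (v : P.weylGroup), Covered b (g + c • P.coroot j) v →
      Covered b (g + P.coroot k + c • P.coroot j) (v ⋆[b] σ k) := fun c v hv ↦ by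
    rw [add_right_comm]
    exact hv.star (covered_ofIdx hk)
  have hw2 : ∀ (c : ℕ) (v : P.weylGroup), Covered b (g + c • P.coroot j) v →
      Covered b (g + P.coroot k + (c + 1) • P.coroot j) (v ⋆[b] (σ k ⋆[b] σ j)) :=
    fun c v hv ↦ by
      rw [succ_nsmul, ← add_assoc, ← star_assoc]
      exact (hw c v hv).simple hj
  have hw1 : m = 1 → ∀ (c : ℕ) (v : P.weylGroup), Covered b (g + c • P.coroot j) v →
      Covered b (g + P.coroot k + (c + 1) • P.coroot j)
        (v ⋆[b] (σ j ⋆[b] (σ k ⋆[b] σ j))) := fun h1 c v hv ↦ by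
    rw [hconj]
    have := hv.star (covered_ofIdx hk')
    rw [hco, h1, Nat.cast_one, one_smul] at this
    rw [succ_nsmul]
    convert this using 1
    abel
  refine ⟨?_, ?_, ?_, fun c hq ↦ ?_, fun c hq ↦ ?_, fun c hq ↦ ?_, fun c hq ↦ ?_⟩
  · rw [map_add, h.eval, rootEval_coroot, hjk]
    push_cast
    ring
  · rw [star_assoc, star_assoc, simple_star_self hj]
  · rw [← star_assoc, h.star_left]
  · obtain ⟨d, rfl⟩ : ∃ d, c = d + 1 := ⟨c - 1, by omega⟩
    rcases hm.eq_or_lt with h1 | h1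
    · obtain ⟨v, h2, h3⟩ := h.right d (by omega)
      refine (hw1 h1.symm d v h2).of_le ?_
      rw [← star_assoc v]
      exact star_mono h3 (.refl _)
    · exact hw2 d x (h.full d (by omega))
  · refine ⟨_, hw c x (h.full c (by omega)), ?_⟩
    rw [star_assoc]
    exact .refl _
  · obtain ⟨d, rfl⟩ : ∃ d, c = d + 1 := ⟨c - 1, by omega⟩
    rcases hm.eq_or_lt with h1 | h1
    · obtain ⟨v, h2, h3⟩ := h.inner d (by omega)
      refine ⟨_, hw1 h1.symm d v h2, ?_⟩
      rw [← star_assoc v, ← star_assoc (σ j)]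
      exact star_mono h3 (.refl _)
    · obtain ⟨v, h2, h3⟩ := h.left d (by omega)
      refine ⟨_, hw2 d v h2, ?_⟩
      rw [← star_assoc (σ j)]
      exact star_mono h3 (.refl _)
  · obtain ⟨v, h2, h3⟩ := h.left c (by omega)
    refine ⟨_, hw c v h2, ?_⟩
    rw [star_assoc v, ← star_assoc (σ j)]
    exact star_mono h3 (.refl _)

/-- Factors are appended according to the sign of $\langle\alpha_j,\alpha_k^\vee\rangle$. A positive
one with $k\ne j$ is rewritten as $s_k=s_j*s_{k'}*s_j$ with $k'=s_jk$: now $k'$ pairs negatively,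
the left $s_j$ is absorbed by the bound built so far, and
$\alpha_k^\vee=\alpha_{k'}^\vee+m\alpha_j^\vee$ accounts for the weight. -/
theorem Word.exists_rankOneBound {j : ι} (hj : j ∈ b.support) {γ : N} {x : P.weylGroup}
    (h : Word b γ x) : ∃ (g : N) (c q : ℕ) (y : P.weylGroup), γ = g + c • P.coroot j ∧
      RankOneBound b j g q y ∧ x ≼[b] y := by
  induction h with
  | one => exact ⟨0, 0, 0, _, by simp, rankOneBound_simple hj, one_bruhatLE _⟩
  | mul γ x k hk _ ih =>
    obtain ⟨g, c, q, y, rfl, h1, h2⟩ := ih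
    rcases lt_trichotomy (P.pairingIn ℤ j k) 0 with h3 | h3 | h3
    · obtain ⟨m, hm⟩ : ∃ m : ℕ, P.pairingIn ℤ j k = -m :=
        ⟨(-P.pairingIn ℤ j k).toNat, by omega⟩
      refine ⟨_, c, _, _, add_right_comm _ _ _, h1.append_neg hj hk (by omega) hm, ?_⟩
      refine (star_mono h2 (.refl _)).trans ?_
      rw [← star_assoc]
      exact bruhatLE_star_left _ _
    · exact ⟨_, c, _, _, add_right_comm _ _ _, h1.append_orthogonal hj hk h3,
        star_mono h2 (.refl _)⟩
    · by_cases hkj : k = j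
      · subst hkj
        refine ⟨g, c + 1, q, y, by rw [succ_nsmul, add_assoc], h1, ?_⟩
        rw [← h1.star_right]
        exact star_mono h2 (.refl _)
      · obtain ⟨m, hm⟩ : ∃ m : ℕ, P.pairingIn ℤ j k = m :=
          ⟨(P.pairingIn ℤ j k).toNat, by omega⟩
        have h4 : P.pairingIn ℤ j (σ j • k) = -m := by
          rw [← hm, ← ofIdx_inv, ← pairingIn_smul_left, pairingIn_neg_left]
        have hk' := isPos_ofIdx_smul hj hk hkj
        refine ⟨_, c + m, _, _, ?_, h1.append_neg hj hk' (by omega) h4, ?_⟩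
        · rw [coroot_ofIdx_smul, hm, Int.cast_natCast, Nat.cast_smul_eq_nsmul, add_nsmul]
          abel
        · refine (star_mono h2 (.refl (σ k))).trans ?_
          have h5 := simple_star_ofIdx_star_simple hj hk' (by omega)
          rw [ofIdx_smul_smul] at h5
          rw [← h5, ← star_assoc, h1.star_right]
          exact .refl _

/-- Since $\langle\alpha_j,\gamma\rangle=2c-q$, positivity is exactly the threshold of the clause
`full`. -/
theorem Covered.exists_rankOneBound {j : ι} (hj : j ∈ b.support) {γ : N} {x : P.weylGroup}
    (h : Covered b γ x) (hγ : 0 < rootEval P j γ) : ∃ (g : N) (c q : ℕ) (y : P.weylGroup),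
      γ = g + c • P.coroot j ∧ RankOneBound b j g q y ∧ x ≼[b] y ∧ q + 1 ≤ 2 * c := by
  obtain ⟨w, h1, h2⟩ := h
  obtain ⟨g, c, q, y, rfl, h3, h4⟩ := h1.exists_rankOneBound hj
  refine ⟨g, c, q, y, rfl, h3, h2.trans h4, ?_⟩
  rw [map_add, h3.eval, map_nsmul, rootEval_coroot, pairingIn_same, nsmul_eq_mul] at hγ
  push_cast at hγ
  have : (q : ℝ) < 2 * c := by linarith
  exact_mod_cast this

theorem Covered.star_simple {j : ι} (hj : j ∈ b.support) {γ : N} {x : P.weylGroup}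
    (h : Covered b γ x) (hγ : 0 < rootEval P j γ) : Covered b γ (x ⋆[b] σ j) := by
  obtain ⟨g, c, q, y, rfl, h1, h2, h3⟩ := h.exists_rankOneBound hj hγ
  refine (h1.full c h3).of_le ?_
  rw [← h1.star_right]
  exact star_mono h2 (.refl _)

theorem Covered.simple_star {j : ι} (hj : j ∈ b.support) {γ : N} {x : P.weylGroup}
    (h : Covered b γ x) (hγ : 0 < rootEval P j γ) : Covered b γ (σ j ⋆[b] x) := by
  obtain ⟨g, c, q, y, rfl, h1, h2, h3⟩ := h.exists_rankOneBound hj hγ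
  refine (h1.full c h3).of_le ?_
  rw [← h1.star_left]
  exact star_mono (.refl _) h2

/-- Giving up one $\alpha_j^\vee$ lowers $2c-q$ from at least $1$ to at least $-1$, which is the
threshold of `inner`. -/
theorem Covered.exists_inner {j : ι} (hj : j ∈ b.support) {γ : N} {x : P.weylGroup}
    (h : Covered b γ x) (hγ : 0 < rootEval P j γ) :
    ∃ v, Covered b (γ - P.coroot j) v ∧ x ≼[b] σ j ⋆[b] (v ⋆[b] σ j) := by
  obtain ⟨g, c, q, y, rfl, h1, h2, h3⟩ := h.exists_rankOneBound hj hγ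
  obtain ⟨d, rfl⟩ : ∃ d, c = d + 1 := ⟨c - 1, by omega⟩
  obtain ⟨v, h4, h5⟩ := h1.inner d (by omega)
  refine ⟨v, ?_, h2.trans h5⟩
  rwa [succ_nsmul, ← add_assoc, add_sub_cancel_right]

end Word

/-! ### Splitting off maximal roots -/

section Greedy

variable {b : P.Base} [Fintype ι] [P.IsCrystallographic] [P.IsReduced]

/-- Every positive root other than `δ` that is made negative by `s_δ` pairs to at most `1` with the
coroot of `δ`. -/
def IsQuantumRoot (b : P.Base) (δ : ι) : Prop :=
  ∀ η, b.IsPos η → η ≠ δ → ¬ b.IsPos (σ δ • η) → P.pairingIn ℤ η δ ≤ 1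

theorem pairingIn_pos_comm {i j : ι} : 0 < P.pairingIn ℤ i j ↔ 0 < P.pairingIn ℤ j i :=
  P.zero_lt_pairingIn_iff' ℤ

theorem pairingIn_ofIdx_smul_right (i j k : ι) :
    P.pairingIn ℤ i (σ k • j) = P.pairingIn ℤ (σ k • i) j := by
  rw [pairingIn_smul_left, ofIdx_inv]

theorem nsmul_root_mem {k : ι} (hk : b.IsPos k) {z : ℤ} (hz : 0 ≤ z) :
    (z : ℝ) • P.root k ∈ AddSubmonoid.closure (P.root '' (b.support : Set ι)) := by
  lift z to ℕ using hz
  rw [Int.cast_natCast, Nat.cast_smul_eq_nsmul]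
  exact nsmul_mem (root_mem_of_isPos hk) z

/-- If an inversion $\eta\ne\delta$ had $\langle\eta,\delta^\vee\rangle\ge2$, then
$\langle\delta,\eta^\vee\rangle=1$ and $\delta^\vee=\eta^\vee+\eta'^\vee$ with $\eta'=-s_\delta\eta$
positive. Both coroots are then $\le\gamma$, and one of $\eta$, $\eta'$ lies strictly above
$\delta$, according to the sign of $\delta-\eta$. -/
theorem isQuantumRoot_of_isMaximalRoot {γ : N} {δ : ι} (h : IsMaximalRoot b γ δ) :
    IsQuantumRoot b δ := by
  obtain ⟨⟨hδ, hle⟩, hmax⟩ := h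
  intro η hη hne hneg
  by_contra! hk
  have h1 : P.pairingIn ℤ δ η = 1 := by
    have h2 := P.pairingIn_pairingIn_mem_set_of_isCrystal_of_isRed η δ
    have h3 : ¬ (P.pairingIn ℤ η δ = 2 ∧ P.pairingIn ℤ δ η = 2) := fun h3 ↦
      hne ((P.pairingIn_two_two_iff ℤ _ _).mp h3)
    simp only [Set.mem_insert_iff, Set.mem_singleton_iff, Prod.mk.injEq] at h2
    omega
  set η' := σ (σ δ • η) • σ δ • η with hη'
  have hη'pos : b.IsPos η' := not_isPos_iff.mp hneg
  have hco : P.coroot η' = P.coroot δ - P.coroot η := by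
    rw [hη', coroot_neg_idx, coroot_ofIdx_smul, h1, Int.cast_one, one_smul, neg_sub]
  by_cases hpos : b.IsPos (σ η • δ)
  · have h2 : η' = δ := by
      refine hmax η' hη'pos ?_ ?_
      · have : γ - P.coroot η' = γ - P.coroot δ + P.coroot η := by rw [hco]; abel
        rw [CorootLE, this]
        exact add_mem hle (coroot_mem_corootCone hη)
      · have : P.root η' - P.root δ =
            ((P.pairingIn ℤ η δ - 2 : ℤ) : ℝ) • P.root δ + P.root (σ η • δ) := by
          rw [hη', root_neg_idx, root_ofIdx_smul, root_ofIdx_smul, h1]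
          push_cast
          module
        rw [RootLE, this]
        exact add_mem (nsmul_root_mem hδ (by omega)) (root_mem_of_isPos hpos)
    apply hne
    have h3 : P.coroot η' = P.coroot δ := by rw [h2]
    rw [hco, sub_eq_self] at h3
    exact absurd h3 (P.ne_zero' η)
  · refine hne (hmax η hη ?_ ?_)
    · have : γ - P.coroot η = γ - P.coroot δ + P.coroot η' := by rw [hco]; abel
      rw [CorootLE, this]
      exact add_mem hle (coroot_mem_corootCone hη'pos)
    · have := root_mem_of_isPos (not_isPos_iff.mp hpos)
      rw [root_neg_idx, root_ofIdx_smul, h1, Int.cast_one, one_smul, neg_sub] at this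
      exact this

/-- If the pairing were negative, one of the two Cartan integers would be $-1$, so
$\delta^\vee+\alpha_j^\vee\le\gamma$ would be the coroot of $s_j\delta$ or $s_\delta\alpha_j$, a
root above $\delta$. -/
theorem IsMaximalRoot.pairingIn_nonneg {γ : N} {δ : ι} (h : IsMaximalRoot b γ δ) {j : ι}
    (hj : j ∈ b.support) (hjγ : γ - P.coroot δ - P.coroot j ∈ corootCone b) :
    0 ≤ P.pairingIn ℤ j δ := by
  obtain ⟨⟨hδ, hle⟩, hmax⟩ := h
  have hjp := Base.isPos_of_mem_support hj
  by_contra! hneg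
  have hjδ : δ ≠ j := by
    rintro rfl
    rw [pairingIn_same] at hneg
    omega
  have h1 : P.pairingIn ℤ j δ = -1 ∨ P.pairingIn ℤ δ j = -1 := by
    have h2 := P.pairingIn_pairingIn_mem_set_of_isCrystal_of_isRed j δ
    have h3 : ¬ (P.pairingIn ℤ j δ = -2 ∧ P.pairingIn ℤ δ j = -2) := fun h3 ↦ by
      have h4 := (P.pairingIn_neg_two_neg_two_iff ℤ _ _).mp h3
      refine not_isPos_iff.mpr ?_ hδ
      convert hjp using 1
      apply P.root.injective
      rw [root_neg_idx, h4]
    simp only [Set.mem_insert_iff, Set.mem_singleton_iff, Prod.mk.injEq] at h2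
    omega
  have key : ∀ k, b.IsPos k → P.coroot k = P.coroot δ + P.coroot j → RootLE b δ k → False := by
    intro k hk hco hle'
    have h2 := hmax k hk (by rwa [CorootLE, hco, ← sub_sub]) hle'
    rw [h2, left_eq_add] at hco
    exact P.ne_zero' j hco
  rcases h1 with h1 | h1
  · refine key (σ j • δ) (isPos_ofIdx_smul hj hδ hjδ) ?_ ?_
    · rw [coroot_ofIdx_smul, h1]
      push_cast
      module
    · have h2 : P.pairingIn ℤ δ j ≤ 0 := by
        by_contra! h2
        rw [pairingIn_pos_comm] at h2
        omega
      have : P.root (σ j • δ) - P.root δ = ((-P.pairingIn ℤ δ j : ℤ) : ℝ) • P.root j := by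
        rw [root_ofIdx_smul]
        push_cast
        module
      rw [RootLE, this]
      exact nsmul_root_mem hjp (by omega)
  · refine key (σ δ • j) (isPos_ofIdx_smul_of_pairingIn_nonpos hj hδ hneg.le) ?_ ?_
    · rw [coroot_ofIdx_smul, h1]
      push_cast
      module
    · have : P.root (σ δ • j) - P.root δ =
          ((-P.pairingIn ℤ j δ - 1 : ℤ) : ℝ) • P.root δ + P.root j := by
        rw [root_ofIdx_smul]
        push_cast
        module
      rw [RootLE, this]
      exact add_mem (nsmul_root_mem hδ (by omega)) (root_mem_of_isPos hjp)

theorem IsQuantumRoot.pairingIn_eq_one {δ j : ι} (h : IsQuantumRoot b δ) (hδ : b.IsPos δ)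
    (hj : j ∈ b.support) (hδj : δ ≠ j) (hpos : 0 < P.pairingIn ℤ j δ) : P.pairingIn ℤ j δ = 1 := by
  have := h j (Base.isPos_of_mem_support hj) hδj.symm
    (not_isPos_ofIdx_smul_of_pairingIn_pos hj hδ hδj hpos)
  omega

/-- Put $\delta'=s_j\delta$. Apart from $\alpha_j$ and a root sent to $-\alpha_j$ by $s_{\delta'}$,
both pairing negatively with $\delta'^\vee$, the reflection $s_j$ carries inversions of
$s_{\delta'}$ to inversions of $s_\delta$. -/
theorem IsQuantumRoot.simple_smul {δ j : ι} (h : IsQuantumRoot b δ) (hj : j ∈ b.support)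
    (hpos : 0 < P.pairingIn ℤ j δ) :
    IsQuantumRoot b (σ j • δ) := by
  have h1 : P.pairingIn ℤ j (σ j • δ) ≤ 1 := by
    rw [pairingIn_ofIdx_smul_right, pairingIn_neg_left]
    omega
  intro η hη hne hneg
  by_cases hηj : η = j
  · rwa [hηj]
  · by_cases hηj' : σ (σ j • δ) • η = σ j • j
    · have h2 := pairingIn_ofIdx_smul_right (P := P) η (σ j • δ) (σ j • δ)
      rw [hηj', pairingIn_neg_left, pairingIn_neg_right] at h2
      omega
    · rw [pairingIn_ofIdx_smul_right]
      refine h _ (isPos_ofIdx_smul hj hη hηj) (fun h2 ↦ hne ?_) ?_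
      · rw [← h2, ofIdx_smul_smul]
      · have h3 := not_isPos_ofIdx_smul hj hneg hηj'
        rwa [← conj_ofIdx, ← mul_smul, ofIdx_inv, mul_assoc, ofIdx_mul_cancel, mul_smul] at h3

/-- The simple root used in the descent pairs to exactly $1$, so $\alpha_k^\vee-\alpha_j^\vee$ is
the coroot of the lower root $s_jk$, and $s_j*s_{s_jk}*s_j=s_k$ reassembles the bound. -/
theorem Covered.bruhatLE_of_isQuantumRoot {δ : ι} (hδ : b.IsPos δ) (h : IsQuantumRoot b δ)
    {x : P.weylGroup} (hx : Covered b (P.coroot δ) x) : x ≼[b] σ δ := by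
  refine isPos_induction (b := b) (p := fun δ : ι ↦ IsQuantumRoot b δ → ∀ x : P.weylGroup,
    Covered b (P.coroot δ) x → x ≼[b] σ δ) (fun j hj _ x hx ↦ ?_)
    (fun k j hk hj hkj hjk hk' ih h x hx ↦ ?_) hδ h x hx
  · obtain ⟨v, h1, h2⟩ := Covered.exists_inner hj hx (by
      rw [rootEval_coroot, pairingIn_same]; norm_num)
    rw [sub_self, covered_zero_iff] at h1
    rwa [h1, one_star, simple_star_self hj] at h2
  · have h1 := h.pairingIn_eq_one hk hj hkj hjk
    obtain ⟨v, h2, h3⟩ := hx.exists_inner hj (by rw [rootEval_coroot, h1]; norm_num)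
    have h4 : P.coroot (σ j • k) = P.coroot k - P.coroot j := by
      rw [coroot_ofIdx_smul, h1, Int.cast_one, one_smul]
    rw [← h4] at h2
    have h5 := ih (h.simple_smul hj hjk) v h2
    have h6 := simple_star_ofIdx_star_simple hj hk' (by
      rw [pairingIn_ofIdx_smul_right, pairingIn_neg_left]; omega)
    rw [ofIdx_smul_smul] at h6
    rw [← h6]
    exact h3.trans (star_mono (.refl _) (star_mono h5 (.refl _)))

/-- A reflection in an admissible root can be split off. -/
theorem Covered.exists_star_ofIdx {δ : ι} (hδ : b.IsPos δ) (h : IsQuantumRoot b δ) {e : N}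
    (he : e ∈ corootCone b)
    (hpair : ∀ j ∈ b.support, e - P.coroot j ∈ corootCone b → 0 ≤ P.pairingIn ℤ j δ)
    {x : P.weylGroup} (hx : Covered b (e + P.coroot δ) x) :
    ∃ w, Covered b e w ∧ x ≼[b] w ⋆[b] σ δ := by
  refine corootCone_induction (b := b) (p := fun e ↦ (∀ j ∈ b.support,
    e - P.coroot j ∈ corootCone b → 0 ≤ P.pairingIn ℤ j δ) → ∀ x : P.weylGroup,
    Covered b (e + P.coroot δ) x →
      ∃ w, Covered b e w ∧ x ≼[b] w ⋆[b] σ δ) (fun e he ih hpair x hx ↦ ?_) he hpair x hx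
  by_cases he0 : e = 0
  · subst he0
    rw [zero_add] at hx
    exact ⟨1, covered_one he, by rw [one_star]; exact hx.bruhatLE_of_isQuantumRoot hδ h⟩
  -- Peeling off $s_j$ on both sides leaves the weight $e-\alpha_j^\vee+\delta^\vee$, to which the
  -- induction applies; the outer right $s_j$ must then be moved across $s_\delta$ or absorbed by
  -- it.
  · obtain ⟨j, hj, hcoeff, heval⟩ := exists_rootEval_pos he he0
    have h1 := sub_coroot_mem (b := b) subset_rfl he hj hcoeff
    have h2 := hpair j hj h1
    have heval' : 0 < rootEval P j e := by linarith
    obtain ⟨v, h3, h4⟩ := hx.exists_inner hj (by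
      have : (0 : ℝ) ≤ P.pairingIn ℤ j δ := by exact_mod_cast h2
      rw [map_add, rootEval_coroot]
      linarith)
    rw [add_sub_right_comm] at h3
    obtain ⟨w, h5, h6⟩ := ih (e - P.coroot j) h1 (by rw [map_sub, corootHeight_simple hj])
      (fun i hi hi' ↦ hpair i hi (by
        have := add_mem hi' (coroot_mem_coneOn (P := P) hj)
        rwa [sub_right_comm, sub_add_cancel] at this)) v h3
    replace h4 := h4.trans (star_mono (.refl _) (star_mono h6 (.refl _)))
    rw [star_assoc w] at h4
    rcases h2.eq_or_lt with h7 | h7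
    -- Both copies of $s_j$ end up around $w$. One is paid for by $\alpha_j^\vee$; the other is free
    -- since $\langle\alpha_j,e\rangle>0$.
    · rw [ofIdx_star_simple_comm hj h7.symm, ← star_assoc w, ← star_assoc] at h4
      refine ⟨_, Covered.simple_star hj ?_ heval', h4⟩
      simpa using h5.simple hj
    · rw [ofIdx_star_simple_of_pos hj hδ h7, ← star_assoc] at h4
      refine ⟨_, ?_, h4⟩
      simpa using (covered_simple hj).star h5

/-- Each recursion step splits off a maximal root. As covering does not refer to the recursion,
independence of the choices follows. -/
theorem IsGreedy.covered_iff {γ : N} {z : P.weylGroup} (h : IsGreedy b γ z) (x : P.weylGroup) :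
    Covered b γ x ↔ x ≼[b] z := by
  induction h generalizing x with
  | zero => rw [covered_zero_iff, bruhatLE_one_iff]
  | step γ δ z hδ hz ih =>
    rw [demazure_eq_star]
    constructor
    · intro hx
      obtain ⟨w, h1, h2⟩ := Covered.exists_star_ofIdx (e := γ - P.coroot δ) hδ.1.1
        (isQuantumRoot_of_isMaximalRoot hδ) hδ.1.2 (fun j hj ↦ hδ.pairingIn_nonneg hj)
        (by rwa [sub_add_cancel])
      exact h2.trans (star_mono ((ih w).mp h1) (.refl _))
    · intro hx
      have := (((ih z).mpr (.refl z)).star (covered_ofIdx hδ.1.1)).of_le hx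
      rwa [sub_add_cancel] at this

theorem exists_isMaximalRoot {γ : N} (hγ : γ ∈ corootCone b) (hγ0 : γ ≠ 0) :
    ∃ δ, IsMaximalRoot b γ δ := by
  classical
  obtain ⟨j, hj, hpos⟩ := exists_corootCoeff_pos hγ hγ0
  obtain ⟨δ, h1, h2⟩ := Finset.exists_max_image
    {i : ι | b.IsPos i ∧ CorootLE b (P.coroot i) γ}
    (fun i ↦ ∑ s ∈ b.support, rootCoeff b s (P.root i))
    ⟨j, by simpa using ⟨Base.isPos_of_mem_support hj, sub_coroot_mem subset_rfl hγ hj hpos⟩⟩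
  simp only [Finset.mem_filter, Finset.mem_univ, true_and] at h1 h2
  refine ⟨δ, h1, fun k hk hkγ hle ↦ ?_⟩
  have h3 := h2 k ⟨hk, hkγ⟩
  have h4 : ∀ s ∈ b.support, 0 ≤ rootCoeff b s (P.root k - P.root δ) :=
    fun s hs ↦ rootCoeff_nonneg_of_mem hle hs
  have h5 : ∑ s ∈ b.support, rootCoeff b s (P.root k - P.root δ) = 0 := by
    refine le_antisymm ?_ (Finset.sum_nonneg h4)
    simp only [map_sub, Finset.sum_sub_distrib]
    linarith
  have h6 := root_eq_sum_rootCoeff_of_mem hle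
  rw [Finset.sum_eq_zero fun s hs ↦ by
    rw [(Finset.sum_eq_zero_iff_of_nonneg h4).mp h5 s hs, zero_smul]] at h6
  exact P.root.injective (sub_eq_zero.mp h6)

theorem exists_isGreedy {γ : N} (hγ : γ ∈ corootCone b) : ∃ z, IsGreedy b γ z := by
  refine corootCone_induction (b := b) (p := fun γ ↦ ∃ z, IsGreedy b γ z) (fun γ hγ ih ↦ ?_) hγ
  by_cases hγ0 : γ = 0
  · exact ⟨1, hγ0 ▸ .zero⟩
  · obtain ⟨δ, hδ⟩ := exists_isMaximalRoot hγ hγ0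
    obtain ⟨z, hz⟩ := ih (γ - P.coroot δ) hδ.1.2 (by
      have := one_le_corootHeight_coroot hδ.1.1
      rw [map_sub]
      linarith)
    exact ⟨_, .step γ δ z hδ hz⟩

theorem IsGreedy.unique {γ : N} {z z' : P.weylGroup} (h : IsGreedy b γ z)
    (h' : IsGreedy b γ z') : z = z' :=
  ((h'.covered_iff z).mp ((h.covered_iff z).mpr (.refl z))).antisymm
    ((h.covered_iff z').mp ((h'.covered_iff z').mpr (.refl z')))

end Greedy

/-! ### Restricting weights to a standard parabolic subgroup -/

section Restrict

variable {b : P.Base} [Fintype ι] [P.IsCrystallographic] [P.IsReduced]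

/-- The projection to the span of the simple coroots in `J`. -/
def restrict (b : P.Base) (J : Finset ι) : N →ₗ[ℝ] N :=
  ∑ i ∈ J, (corootCoeff b i).smulRight (P.coroot i)

theorem restrict_apply (J : Finset ι) (γ : N) :
    restrict b J γ = ∑ i ∈ J, corootCoeff b i γ • P.coroot i := by
  simp [restrict]

theorem restrict_simple {J : Finset ι} (hJ : J ⊆ b.support) {j : ι} (hj : j ∈ J) :
    restrict b J (P.coroot j) = P.coroot j := by
  rw [restrict_apply, Finset.sum_eq_single_of_mem j hj (fun i hi hij ↦ by
    rw [corootCoeff_ne (hJ hi) (hJ hj) hij.symm, zero_smul]), corootCoeff_self (hJ hj), one_smul]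

theorem restrict_simple_of_notMem {J : Finset ι} (hJ : J ⊆ b.support) {j : ι}
    (hj : j ∈ b.support) (hjJ : j ∉ J) : restrict b J (P.coroot j) = 0 := by
  rw [restrict_apply]
  refine Finset.sum_eq_zero fun i hi ↦ ?_
  rw [corootCoeff_ne (hJ hi) hj (fun h ↦ hjJ (h ▸ hi)), zero_smul]

theorem restrict_mem_coneOn {J : Finset ι} (hJ : J ⊆ b.support) {γ : N} (h : γ ∈ corootCone b) :
    restrict b J γ ∈ coneOn P J := by
  induction h using AddSubmonoid.closure_induction with
  | mem x hx =>
    obtain ⟨j, hj, rfl⟩ := hx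
    by_cases hjJ : j ∈ J
    · rw [restrict_simple hJ hjJ]; exact coroot_mem_coneOn hjJ
    · rw [restrict_simple_of_notMem hJ hj hjJ]; exact zero_mem _
  | zero => rw [map_zero]; exact zero_mem _
  | add x y _ _ hx hy => rw [map_add]; exact add_mem hx hy

theorem sub_restrict_mem {J : Finset ι} (hJ : J ⊆ b.support) {γ : N} (h : γ ∈ corootCone b) :
    γ - restrict b J γ ∈ corootCone b := by
  induction h using AddSubmonoid.closure_induction with
  | mem x hx =>
    obtain ⟨j, hj, rfl⟩ := hx
    by_cases hjJ : j ∈ J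
    · rw [restrict_simple hJ hjJ, sub_self]; exact zero_mem _
    · rw [restrict_simple_of_notMem hJ hj hjJ, sub_zero]; exact coroot_mem_coneOn hj
  | zero => rw [map_zero, sub_zero]; exact zero_mem _
  | add x y _ _ hx hy => rw [map_add, add_sub_add_comm]; exact add_mem hx hy

/-- The discarded simple coroots pair nonpositively with $\alpha_j$. -/
theorem rootEval_le_rootEval_restrict {J : Finset ι} (hJ : J ⊆ b.support) {γ : N}
    (h : γ ∈ corootCone b) {j : ι} (hj : j ∈ J) :
    rootEval P j γ ≤ rootEval P j (restrict b J γ) := by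
  induction h using AddSubmonoid.closure_induction with
  | mem x hx =>
    obtain ⟨i, hi, rfl⟩ := hx
    by_cases hiJ : i ∈ J
    · rw [restrict_simple hJ hiJ]
    · rw [restrict_simple_of_notMem hJ hi hiJ, map_zero, rootEval_coroot]
      exact_mod_cast b.pairingIn_le_zero_of_ne (ne_of_mem_of_not_mem hj hiJ) (hJ hj) hi
  | zero => simp
  | add x y _ _ hx hy => simp only [map_add]; exact add_le_add hx hy

theorem IsParabolic.upRight {J : Finset ι} {x : P.weylGroup} (hx : IsParabolic b J x)
    {j : ι} (hj : j ∈ b.support) (hjJ : j ∈ J) : IsParabolic b J (upRight b j x) := by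
  by_cases h : b.IsPos (x • j)
  · rw [upRight_of_isPos h]; exact hx.mul (isParabolic_simple hj hjJ)
  · rwa [upRight_of_not_isPos h]

/-- An element of a standard parabolic subgroup below a Demazure product lies below a Demazure
product of elements of the subgroup. -/
theorem IsParabolic.exists_bruhatLE_star {J : Finset ι} {x u v : P.weylGroup}
    (hx : IsParabolic b J x) (h : x ≼[b] u ⋆[b] v) : ∃ x₁ x₂, IsParabolic b J x₁ ∧
      IsParabolic b J x₂ ∧ x₁ ≼[b] u ∧ x₂ ≼[b] v ∧ x ≼[b] x₁ ⋆[b] x₂ := by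
  obtain ⟨l, h1, h2, rfl⟩ := exists_reduced_word (b := b) v
  rw [star_eq_foldl _ l h1 h2] at h
  rw [← foldl_upRight_one l h1 h2]
  clear h2
  induction l using List.reverseRecOn generalizing x with
  | nil => exact ⟨x, 1, hx, .one J, h, .refl 1, by rw [star_one]; exact .refl x⟩
  | append_singleton l j ih =>
    have hj : j ∈ b.support := h1 j (by simp)
    simp only [List.foldl_append, List.foldl_cons, List.foldl_nil] at h ⊢
    rcases mul_bruhatLE_of_bruhatLE_upRight hj h with h3 | ⟨h3, h4⟩
    · obtain ⟨x₁, x₂, h5, h6, h7, h8, h9⟩ := ih hx (fun k hk ↦ h1 k (by simp [hk])) h3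
      exact ⟨x₁, x₂, h5, h6, h7, h8.trans (bruhatLE_upRight hj _), h9⟩
    · have hjJ : j ∈ J := by
        by_contra hjJ
        exact h3 (hx.isPos_smul hj hjJ)
      obtain ⟨x₁, x₂, h5, h6, h7, h8, h9⟩ := ih (hx.mul (isParabolic_simple hj hjJ))
        (fun k hk ↦ h1 k (by simp [hk])) h4
      refine ⟨x₁, _, h5, h6.upRight hj hjJ, h7, h8.upRight hj, ?_⟩
      have h10 := mul_bruhatLE_star (b := b) (x * σ j) (σ j)
      rw [mul_ofIdx_cancel] at h10
      refine h10.trans ((star_mono h9 (.refl _)).trans ?_)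
      rw [star_assoc, star_simple hj]
      exact .refl _

/-- Induction through $s_k=s_j*s_{s_jk}*s_j$. If $j\in J$, the restricted weight still pairs
positively with $\alpha_j$, so both outer factors are free. If $j\notin J$, then $j$ is never a
descent of an element of the subgroup, and the outer factors can be dropped. -/
theorem IsParabolic.covered_of_bruhatLE_ofIdx {J : Finset ι} (hJ : J ⊆ b.support) {k : ι}
    (hk : b.IsPos k) {x : P.weylGroup} (hx : IsParabolic b J x) (h : x ≼[b] σ k) :
    Covered b (restrict b J (P.coroot k)) x := by
  refine isPos_induction (b := b) (p := fun k : ι ↦ ∀ x : P.weylGroup, IsParabolic b J x →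
    x ≼[b] σ k → Covered b (restrict b J (P.coroot k)) x) (fun j hj x hx h ↦ ?_)
    (fun k j hk hj hkj hjk hk' ih x hx h ↦ ?_) hk x hx h
  · by_cases hjJ : j ∈ J
    · rw [restrict_simple hJ hjJ]
      exact (covered_simple hj).of_le h
    · rw [← one_star (b := b) (σ j), star_simple hj] at h
      rcases mul_bruhatLE_of_bruhatLE_upRight hj h with h1 | h1
      · rw [bruhatLE_one_iff.mp h1]
        exact covered_one (coneOn_mono hJ (restrict_mem_coneOn hJ (coroot_mem_coneOn hj)))
      · exact absurd (hx.isPos_smul hj hjJ) h1.1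
  · have hco : P.coroot k = P.coroot (σ j • k) + (P.pairingIn ℤ j k : ℝ) • P.coroot j := by
      rw [coroot_ofIdx_smul, sub_add_cancel]
    have h1 := simple_star_ofIdx_star_simple hj hk' (by
      rw [pairingIn_ofIdx_smul_right, pairingIn_neg_left]; omega)
    rw [ofIdx_smul_smul] at h1
    rw [← h1, simple_star hj, star_simple hj, bruhatLE_upLeft_iff hj] at h
    have h2 := mul_bruhatLE_of_bruhatLE_upRight hj h
    by_cases hjJ : j ∈ J
    · obtain ⟨x', h3, h4, h5⟩ : ∃ x', IsParabolic b J x' ∧ x' ≼[b] σ (σ j • k) ∧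
          QuantumBruhat.downLeft b j x ≼[b] x' ⋆[b] σ j := by
        rcases h2 with h2 | ⟨_, h2⟩
        · exact ⟨_, hx.downLeft hj, h2, bruhatLE_star_left _ _⟩
        · refine ⟨_, (hx.downLeft hj).mul (isParabolic_simple hj hjJ), h2, ?_⟩
          have h10 := mul_bruhatLE_star (b := b)
            (QuantumBruhat.downLeft b j x * σ j) (σ j)
          rwa [mul_ofIdx_cancel] at h10
      rw [← bruhatLE_upLeft_iff hj, ← simple_star hj] at h5
      have h6 : 0 < rootEval P j (restrict b J (P.coroot k)) := by
        refine lt_of_lt_of_le ?_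
          (rootEval_le_rootEval_restrict hJ (coroot_mem_corootCone hk) hjJ)
        rw [rootEval_coroot]
        exact_mod_cast hjk
      have h7 : Covered b (restrict b J (P.coroot k)) x' := by
        refine (ih x' h3 h4).mono ?_
        rw [hco, map_add, add_sub_cancel_left, map_smul (restrict b J) (_ : ℝ),
          restrict_simple hJ hjJ]
        obtain ⟨n, hn⟩ := Int.eq_ofNat_of_zero_le hjk.le
        rw [hn, Int.cast_natCast, Nat.cast_smul_eq_nsmul]
        exact nsmul_mem (coroot_mem_coneOn hj) n
      exact ((h7.star_simple hj h6).simple_star hj h6).of_le h5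
    · rw [downLeft_of_isPos (hx.inv.isPos_smul hj hjJ)] at h2
      rcases h2 with h2 | h2
      · rw [hco, map_add, map_smul (restrict b J) (_ : ℝ), restrict_simple_of_notMem hJ hj hjJ,
          smul_zero, add_zero]
        exact ih x hx h2
      · exact absurd (hx.isPos_smul hj hjJ) h2.1

/-- This makes weights outside `J` irrelevant for elements of the subgroup, as the induction on `J`
requires. -/
theorem IsParabolic.covered_restrict {J : Finset ι} (hJ : J ⊆ b.support) {γ : N}
    {x : P.weylGroup} (hx : IsParabolic b J x) (h : Covered b γ x) :
    Covered b (restrict b J γ) x := by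
  obtain ⟨w, h1, h2⟩ := h
  induction h1 generalizing x with
  | one =>
    rw [bruhatLE_one_iff.mp h2, map_zero]
    exact Word.one.covered
  | mul γ w k hk _ ih =>
    obtain ⟨x₁, x₂, h3, h4, h5, h6, h7⟩ := hx.exists_bruhatLE_star h2
    rw [map_add]
    exact ((ih h3 h5).star (h4.covered_of_bruhatLE_ofIdx hJ hk h6)).of_le h7

end Restrict

/-! ### Levi subsystems and their highest roots -/

section Levi

variable {b : P.Base} [Fintype ι] [P.IsCrystallographic] [P.IsReduced]

/-- The root of index `k` is a combination of the simple roots in `J`. -/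
def IsLevi (b : P.Base) (J : Finset ι) (k : ι) : Prop :=
  ∀ i ∈ b.support, i ∉ J → rootCoeff b i (P.root k) = 0

theorem corootCoeff_coroot_nonneg {k i : ι} (hk : b.IsPos k) (hi : i ∈ b.support) :
    0 ≤ corootCoeff b i (P.coroot k) := corootCoeff_nonneg (coroot_mem_corootCone hk) hi

theorem corootCoeff_eq_zero_iff_of_isPos {k i : ι} (hk : b.IsPos k) (hi : i ∈ b.support) :
    corootCoeff b i (P.coroot k) = 0 ↔ rootCoeff b i (P.root k) = 0 := by
  refine isPos_induction (b := b) (p := fun k : ι ↦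
    corootCoeff b i (P.coroot k) = 0 ↔ rootCoeff b i (P.root k) = 0) (fun j hj ↦ ?_)
    (fun k j hk hj _ hjk hk' ih ↦ ?_) hk
  · by_cases hij : j = i
    · subst hij
      simp [corootCoeff_self hi, rootCoeff_self hi]
    · simp [corootCoeff_ne hi hj hij, rootCoeff_ne hi hj hij]
  · have h1 : P.coroot k = P.coroot (σ j • k) + (P.pairingIn ℤ j k : ℝ) • P.coroot j := by
      rw [coroot_ofIdx_smul, sub_add_cancel]
    have h2 : P.root k = P.root (σ j • k) + (P.pairingIn ℤ k j : ℝ) • P.root j := by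
      rw [root_ofIdx_smul, sub_add_cancel]
    have h3 : (0 : ℝ) < P.pairingIn ℤ j k := by exact_mod_cast hjk
    have h4 : (0 : ℝ) < P.pairingIn ℤ k j := by exact_mod_cast pairingIn_pos_comm.mp hjk
    rw [h1, h2, map_add, map_add, map_smul (corootCoeff b i) (_ : ℝ),
      map_smul (rootCoeff b i) (_ : ℝ)]
    by_cases hij : j = i
    · subst hij
      rw [corootCoeff_self hi, rootCoeff_self hi]
      have h5 := corootCoeff_coroot_nonneg hk' hi
      have h6 := rootCoeff_nonneg hk' hi
      simp only [smul_eq_mul, mul_one]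
      constructor <;> intro <;> linarith
    · rw [corootCoeff_ne hi hj hij, rootCoeff_ne hi hj hij, smul_zero, smul_zero, add_zero,
        add_zero, ih]

theorem coroot_mem_coneOn_iff {J : Finset ι} (hJ : J ⊆ b.support) {k : ι} (hk : b.IsPos k) :
    P.coroot k ∈ coneOn P J ↔ IsLevi b J k := by
  rw [mem_coneOn_iff hJ]
  constructor
  · exact fun h i hi hiJ ↦ (corootCoeff_eq_zero_iff_of_isPos hk hi).mp ((h.2 i hi).2 hiJ)
  · exact fun h ↦ ⟨coroot_mem_corootLattice k, fun i hi ↦ ⟨corootCoeff_coroot_nonneg hk hi,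
      fun hiJ ↦ (corootCoeff_eq_zero_iff_of_isPos hk hi).mpr (h i hi hiJ)⟩⟩

theorem mem_coneOn_of_add {J : Finset ι} (hJ : J ⊆ b.support) {γ γ' : N}
    (h : γ ∈ corootCone b) (h' : γ' ∈ corootCone b) (hadd : γ + γ' ∈ coneOn P J) :
    γ ∈ coneOn P J ∧ γ' ∈ coneOn P J := by
  rw [mem_coneOn_iff hJ] at hadd ⊢
  rw [mem_coneOn_iff hJ]
  have key : ∀ i ∈ b.support, i ∉ J → corootCoeff b i γ = 0 ∧ corootCoeff b i γ' = 0 := by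
    intro i hi hiJ
    have h1 := corootCoeff_nonneg h hi
    have h2 := corootCoeff_nonneg h' hi
    have h3 := (hadd.2 i hi).2 hiJ
    rw [map_add] at h3
    constructor <;> linarith
  exact ⟨⟨mem_corootLattice_of_mem_corootCone h, fun i hi ↦
    ⟨corootCoeff_nonneg h hi, fun hiJ ↦ (key i hi hiJ).1⟩⟩,
    ⟨mem_corootLattice_of_mem_corootCone h', fun i hi ↦
    ⟨corootCoeff_nonneg h' hi, fun hiJ ↦ (key i hi hiJ).2⟩⟩⟩

theorem IsLevi.isParabolic {J : Finset ι} {k : ι} (h : IsLevi b J k) : IsParabolic b J (σ k) :=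
  isParabolic_ofIdx h

theorem isLevi_of_isParabolic {J : Finset ι} {k : ι} (h : IsParabolic b J (σ k)) :
    IsLevi b J k := by
  intro i hi hiJ
  have := h k i hi hiJ
  rw [root_neg_idx, map_neg] at this
  linarith

theorem IsLevi.smul {J : Finset ι} {k : ι} (h : IsLevi b J k) {x : P.weylGroup}
    (hx : IsParabolic b J x) : IsLevi b J (x • k) := fun i hi hiJ ↦ by
  rw [hx k i hi hiJ, h i hi hiJ]

theorem isLevi_simple {J : Finset ι} (hJ : J ⊆ b.support) {j : ι} (hj : j ∈ J) :
    IsLevi b J j := fun _ hi hiJ ↦ rootCoeff_ne hi (hJ hj) (ne_of_mem_of_not_mem hj hiJ)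

theorem BruhatLE.isParabolic {J : Finset ι} {x y : P.weylGroup} (h : x ≼[b] y)
    (hy : IsParabolic b J y) : IsParabolic b J x := by
  generalize hn : length b y = n
  induction n using Nat.strong_induction_on generalizing x y with
  | _ n ih =>
    by_cases hy1 : y = 1
    · rw [hy1, bruhatLE_one_iff] at h
      rw [h]
      exact .one J
    · obtain ⟨j, hj, hjy⟩ := exists_not_isPos_inv_smul (b := b) hy1
      have hjJ : j ∈ J := by
        by_contra hjJ
        exact hjy (hy.inv.isPos_smul hj hjJ)
      have hs := isParabolic_simple hj hjJ
      have h1 := length_simple_mul_of_not_isPos hj hjy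
      have h2 := h.downLeft hj
      rw [downLeft_of_not_isPos hjy] at h2
      have h3 := ih _ (by omega) h2 (hs.mul hy) rfl
      by_cases hx : b.IsPos (x⁻¹ • j)
      · rwa [downLeft_of_isPos hx] at h3
      · rw [downLeft_of_not_isPos hx] at h3
        simpa [ofIdx_mul_cancel] using hs.mul h3

theorem IsParabolic.star {J : Finset ι} {x y : P.weylGroup} (hx : IsParabolic b J x)
    (hy : IsParabolic b J y) : IsParabolic b J (x ⋆[b] y) := by
  obtain ⟨u, h1, h2, _⟩ := exists_star_eq_mul (b := b) x y
  rw [h2]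
  exact (h1.isParabolic hx).mul hy

theorem Word.isParabolic {J : Finset ι} (hJ : J ⊆ b.support) {γ : N} {w : P.weylGroup}
    (h : Word b γ w) (hγ : γ ∈ coneOn P J) : IsParabolic b J w := by
  induction h with
  | one => exact .one J
  | mul γ w k hk hw ih =>
    obtain ⟨h1, h2⟩ := mem_coneOn_of_add hJ hw.mem_corootCone (coroot_mem_corootCone hk) hγ
    exact (ih h1).star ((coroot_mem_coneOn_iff hJ hk).mp h2).isParabolic

theorem intCast_smul_coroot_mem {k : ι} (hk : b.IsPos k) {m : ℤ} (hm : 0 ≤ m) :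
    (m : ℝ) • P.coroot k ∈ corootCone b := by
  lift m to ℕ using hm
  rw [Int.cast_natCast, Nat.cast_smul_eq_nsmul]
  exact nsmul_mem (coroot_mem_corootCone hk) m

theorem IsParabolic.mem_of_not_isPos {J : Finset ι} {x : P.weylGroup} (hx : IsParabolic b J x)
    {j : ι} (hj : j ∈ b.support) (h : ¬ b.IsPos (x • j)) : j ∈ J := by
  by_contra hjJ
  exact h (hx.isPos_smul hj hjJ)

theorem IsParabolic.induction {J : Finset ι} {p : P.weylGroup → Prop} (one : p 1)
    (mul : ∀ x, IsParabolic b J x → ∀ j ∈ J, j ∈ b.support → ¬ b.IsPos (x • j) → p (x * σ j) → p x)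
    {x : P.weylGroup} (hx : IsParabolic b J x) : p x := by
  generalize hn : length b x = n
  induction n using Nat.strong_induction_on generalizing x with
  | _ n ih =>
    by_cases hx1 : x = 1
    · rw [hx1]; exact one
    · obtain ⟨j, hj, hjx⟩ := exists_not_isPos_smul (b := b) hx1
      have hjJ := hx.mem_of_not_isPos hj hjx
      have h1 := length_mul_simple_of_not_isPos hj hjx
      exact mul x hx j hjJ hj hjx (ih _ (by omega) (hx.mul (isParabolic_simple hj hjJ)) rfl)

/-- The properties of a highest root of the Levi subsystem attached to `J`. -/
structure IsHighestRoot (b : P.Base) (J : Finset ι) (θ : ι) : Prop where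
  isPos : b.IsPos θ
  isLevi : IsLevi b J θ
  nonneg : ∀ η, b.IsPos η → IsLevi b J η → 0 ≤ P.pairingIn ℤ η θ
  le_one : ∀ η, b.IsPos η → IsLevi b J η → η ≠ θ → P.pairingIn ℤ η θ ≤ 1
  not_isPos : ∀ η, b.IsPos η → IsLevi b J η → 0 < P.pairingIn ℤ η θ → ¬ b.IsPos (σ θ • η)

/-- A maximal root below the sum $\gamma$ of all positive Levi coroots has the required properties:
every Levi coroot is $\le\gamma$, and so is the sum of any two distinct ones, which lets
`IsMaximalRoot.pairingIn_nonneg` apply. The set `J` need not be connected. -/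
theorem exists_isHighestRoot {J : Finset ι} (hJ : J ⊆ b.support) (hne : J.Nonempty) :
    ∃ θ, IsHighestRoot b J θ := by
  classical
  set S : Finset ι := {k : ι | b.IsPos k ∧ IsLevi b J k} with hS
  have hmem : ∀ k, k ∈ S ↔ b.IsPos k ∧ IsLevi b J k := fun k ↦ by simp [hS]
  set γ : N := ∑ k ∈ S, P.coroot k with hγ
  have hγJ : γ ∈ coneOn P J := sum_mem fun k hk ↦
    (coroot_mem_coneOn_iff hJ ((hmem k).mp hk).1).mpr ((hmem k).mp hk).2
  have hle : ∀ k ∈ S, γ - P.coroot k ∈ corootCone b := fun k hk ↦ by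
    rw [hγ, ← Finset.add_sum_erase _ _ hk, add_sub_cancel_left]
    exact sum_mem fun i hi ↦ coroot_mem_corootCone ((hmem i).mp (Finset.mem_of_mem_erase hi)).1
  have hle2 : ∀ k ∈ S, ∀ j ∈ S, j ≠ k → γ - P.coroot k - P.coroot j ∈ corootCone b := by
    intro k hk j hj hjk
    rw [hγ, ← Finset.add_sum_erase _ _ hk, add_sub_cancel_left,
      ← Finset.add_sum_erase _ _ (Finset.mem_erase.mpr ⟨hjk, hj⟩), add_sub_cancel_left]
    exact sum_mem fun i hi ↦ coroot_mem_corootCone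
      ((hmem i).mp (Finset.mem_of_mem_erase (Finset.mem_of_mem_erase hi))).1
  have hsimple : ∀ j ∈ J, j ∈ S := fun j hj ↦
    (hmem j).mpr ⟨Base.isPos_of_mem_support (hJ hj), isLevi_simple hJ hj⟩
  have hγ0 : γ ≠ 0 := by
    obtain ⟨j, hj⟩ := hne
    intro h0
    have h1 := hle j (hsimple j hj)
    rw [h0, zero_sub] at h1
    exact P.ne_zero' j (corootCone_antisymm (coroot_mem_coneOn (hJ hj)) h1)
  obtain ⟨θ, hθ⟩ := exists_isMaximalRoot (coneOn_mono hJ hγJ) hγ0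
  have hθS : θ ∈ S := by
    refine (hmem θ).mpr ⟨hθ.1.1, (coroot_mem_coneOn_iff hJ hθ.1.1).mp ?_⟩
    exact (mem_coneOn_of_add hJ (coroot_mem_corootCone hθ.1.1) hθ.1.2
      (by rwa [add_sub_cancel])).1
  have hneg : ∀ η, b.IsPos η → IsLevi b J η → 0 < P.pairingIn ℤ η θ →
      ¬ b.IsPos (σ θ • η) := by
    intro η hη hηJ hpos h1
    have h2 : η = θ := by
      refine hθ.2 η hη (hle η ((hmem η).mpr ⟨hη, hηJ⟩)) ?_
      have : P.root η - P.root θ =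
          P.root (σ θ • η) + ((P.pairingIn ℤ η θ - 1 : ℤ) : ℝ) • P.root θ := by
        rw [root_ofIdx_smul]
        push_cast
        module
      rw [RootLE, this]
      exact add_mem (root_mem_of_isPos h1) (nsmul_root_mem hθ.1.1 (by omega))
    rw [h2, isPos_neg_idx] at h1
    exact h1 hθ.1.1
  refine ⟨θ, hθ.1.1, ((hmem θ).mp hθS).2, fun η hη hηJ ↦ ?_, fun η hη hηJ hne ↦ ?_, hneg⟩
  · have h1 : (P.pairingIn ℤ η θ : ℝ) =
        ∑ i ∈ b.support, rootCoeff b i (P.root η) * P.pairingIn ℤ i θ := by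
      rw [← rootEval_coroot, rootEval]
      conv_lhs => rw [root_eq_sum_rootCoeff_of_mem (root_mem_of_isPos hη), map_sum,
        LinearMap.sum_apply]
      refine Finset.sum_congr rfl fun i _ ↦ ?_
      rw [map_smul, LinearMap.smul_apply, smul_eq_mul, ← rootEval_coroot, rootEval]
    have h2 : (0 : ℝ) ≤ P.pairingIn ℤ η θ := by
      rw [h1]
      refine Finset.sum_nonneg fun i hi ↦ ?_
      by_cases hiJ : i ∈ J
      · refine mul_nonneg (rootCoeff_nonneg hη hi) ?_
        by_cases hiθ : i = θ
        · rw [hiθ, pairingIn_same]; norm_num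
        · exact_mod_cast hθ.pairingIn_nonneg hi (hle2 θ hθS i (hsimple i hiJ) hiθ)
      · rw [hηJ i hi hiJ, zero_mul]
    exact_mod_cast h2
  · by_contra! h1
    exact h1.not_ge (isQuantumRoot_of_isMaximalRoot hθ η hη hne (hneg η hη hηJ (by omega)))

/-- $\theta^\vee$ is dominant for `J`, so each right descent of $x$ contributes a nonnegative
multiple of a positive Levi coroot. -/
theorem IsHighestRoot.sub_smul_mem {J : Finset ι} (hJ : J ⊆ b.support) {θ : ι}
    (hθ : IsHighestRoot b J θ) {x : P.weylGroup} (hx : IsParabolic b J x) :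
    P.coroot θ - P.coroot (x • θ) ∈ coneOn P J := by
  refine hx.induction (p := fun x ↦ P.coroot θ - P.coroot (x • θ) ∈ coneOn P J) ?_
    fun x hx j hj hjs hjx ih ↦ ?_
  · rw [one_smul, sub_self]; exact zero_mem _
  · have h1 : P.coroot (x • θ) = P.coroot ((x * σ j) • θ) -
        (P.pairingIn ℤ j θ : ℝ) • P.coroot ((x * σ j) • j) := by
      have h2 : x • θ = σ ((x * σ j) • j) • (x * σ j) • θ := by
        rw [← mul_smul, ← mul_ofIdx, mul_ofIdx_cancel]
      rw [h2, coroot_ofIdx_smul, pairingIn_smul]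
    have h3 : b.IsPos ((x * σ j) • j) := isPos_mul_smul.mpr hjx
    have h4 := hθ.nonneg j (Base.isPos_of_mem_support hjs) (isLevi_simple hJ hj)
    rw [h1, sub_sub_eq_add_sub, add_sub_right_comm]
    refine add_mem ih ?_
    obtain ⟨n, hn⟩ := Int.eq_ofNat_of_zero_le h4
    rw [hn, Int.cast_natCast, Nat.cast_smul_eq_nsmul]
    exact nsmul_mem ((coroot_mem_coneOn_iff hJ h3).mpr
      ((isLevi_simple hJ hj).smul (hx.mul (isParabolic_simple hjs hj)))) n

/-- At a right descent $j$ of $x$, the root $x\alpha_j$ is negative, so $\langle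
x\alpha_j,\theta^\vee\rangle\le0$; as $x$ fixes $\theta$ this equals
$\langle\alpha_j,\theta^\vee\rangle\ge0$. Hence every such descent is orthogonal to $\theta$. -/
theorem IsHighestRoot.isParabolic_of_smul_eq {J J' : Finset ι} (hJ : J ⊆ b.support) {θ : ι}
    (hθ : IsHighestRoot b J θ) (hJ' : ∀ j ∈ J, P.pairingIn ℤ j θ = 0 → j ∈ J')
    {x : P.weylGroup} (hx : IsParabolic b J x) (h : x • θ = θ) : IsParabolic b J' x := by
  refine hx.induction (p := fun x ↦ x • θ = θ → IsParabolic b J' x) (fun _ ↦ .one J')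
    (fun x hx j hj hjs hjx ih h ↦ ?_) h
  have h1 : P.pairingIn ℤ j θ = 0 := by
    have h2 := hθ.nonneg j (Base.isPos_of_mem_support hjs) (isLevi_simple hJ hj)
    have h3 := hθ.nonneg _ (not_isPos_iff.mp hjx) ((((isLevi_simple hJ hj).smul hx).smul
      ((isLevi_simple hJ hj).smul hx).isParabolic))
    rw [pairingIn_neg_left, ← h, pairingIn_smul] at h3
    omega
  have h4 : σ j • θ = θ := by
    apply P.coroot.injective
    rw [coroot_ofIdx_smul, h1, Int.cast_zero, zero_smul, sub_zero]
  have h5 := ih (by rw [mul_smul, h4, h])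
  simpa [mul_ofIdx_cancel] using h5.mul (isParabolic_simple hjs (hJ' j hj h1))

theorem IsHighestRoot.exists_pairingIn_ne_zero {J : Finset ι} {θ : ι}
    (hθ : IsHighestRoot b J θ) : ∃ j ∈ J, P.pairingIn ℤ j θ ≠ 0 := by
  by_contra! hcon
  have h1 := rootEval_coroot (P := P) θ θ
  rw [rootEval, root_eq_sum_rootCoeff_of_mem (root_mem_of_isPos hθ.isPos), map_sum,
    LinearMap.sum_apply, Finset.sum_eq_zero, pairingIn_same] at h1
  · norm_num at h1
  · intro i hi
    rw [map_smul, LinearMap.smul_apply, smul_eq_mul]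
    by_cases hiJ : i ∈ J
    · change _ * rootEval P i _ = 0
      rw [rootEval_coroot, hcon i hiJ, Int.cast_zero, mul_zero]
    · rw [hθ.isLevi i hi hiJ, zero_mul]

end Levi

/-! ### The semi-infinite order and an affine reflection -/

section SemiInfinite

variable {b : P.Base} [Fintype ι] [P.IsCrystallographic] [P.IsReduced]

/-- One step of the semi-infinite Bruhat order attached to `J`. -/
def SemiInfStep (b : P.Base) (J : Finset ι) (u v : P.weylGroup × N) : Prop :=
  ∃ (k : ι) (m : ℤ), b.IsPos k ∧ IsLevi b J k ∧ IsParabolic b J u.1 ∧ 0 ≤ m ∧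
    (b.IsPos (u.1 • k) ∨ 1 ≤ m) ∧ v = (u.1 * σ k, u.2 + (m : ℝ) • P.coroot k)

/-- The semi-infinite Bruhat order attached to `J`. -/
def SemiInfLE (b : P.Base) (J : Finset ι) : P.weylGroup × N → P.weylGroup × N → Prop :=
  Relation.ReflTransGen (SemiInfStep b J)

theorem SemiInfLE.trans {J : Finset ι} {u v w : P.weylGroup × N} (h : SemiInfLE b J u v)
    (h' : SemiInfLE b J v w) : SemiInfLE b J u w := Relation.ReflTransGen.trans h h'

theorem SemiInfLE.translate {J : Finset ι} {u v : P.weylGroup × N} (h : SemiInfLE b J u v)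
    (τ : N) : SemiInfLE b J (u.1, u.2 + τ) (v.1, v.2 + τ) := by
  refine Relation.ReflTransGen.lift (fun u : P.weylGroup × N ↦ (u.1, u.2 + τ)) ?_ _ _ h
  rintro u _ ⟨k, m, h1, h2, h3, h4, h5, rfl⟩
  exact ⟨k, m, h1, h2, h3, h4, h5, by rw [add_right_comm]⟩

/-- A pair $(w,\xi)$ stands for $wt^\xi$ in the affine Weyl group. A step that sends its root to a
positive root is a Bruhat step; any other step adds at least one coroot, which pays for a factor
$s_k$. -/
theorem SemiInfLE.exists_covered {J : Finset ι} {u v : P.weylGroup × N} (h : SemiInfLE b J u v) :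
    ∃ w, Covered b (v.2 - u.2) w ∧ u.1 ≼[b] v.1 ⋆[b] w := by
  induction h using Relation.ReflTransGen.head_induction_on with
  | refl => exact ⟨1, by rw [sub_self]; exact Word.one.covered, by rw [star_one]; exact .refl _⟩
  | @head u c hs _ ih =>
    obtain ⟨k, m, h1, h2, h3, h4, h5, hc⟩ := hs
    subst hc
    obtain ⟨w, h6, h7⟩ := ih
    dsimp only at h6 h7
    by_cases hpos : b.IsPos (u.1 • k)
    · refine ⟨w, h6.mono ?_, (bruhatLE_mul_ofIdx h1 hpos).trans h7⟩
      have : v.2 - u.2 - (v.2 - (u.2 + (m : ℝ) • P.coroot k)) = (m : ℝ) • P.coroot k := by abel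
      rw [this]
      exact intCast_smul_coroot_mem h1 h4
    · refine ⟨w ⋆[b] σ k, (h6.star (covered_ofIdx h1)).mono ?_, ?_⟩
      · have : v.2 - u.2 - (v.2 - (u.2 + (m : ℝ) • P.coroot k) + P.coroot k) =
            ((m - 1 : ℤ) : ℝ) • P.coroot k := by
          push_cast
          module
        rw [this]
        have := h5.resolve_left hpos
        exact intCast_smul_coroot_mem h1 (by omega)
      · have h8 := mul_bruhatLE_star (b := b) (u.1 * σ k) (σ k)
        rw [mul_ofIdx_cancel] at h8
        rw [← star_assoc]
        exact h8.trans (star_mono h7 (.refl _))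

theorem BruhatLE.semiInfLE {J : Finset ι} {x y : P.weylGroup} (h : x ≼[b] y)
    (hy : IsParabolic b J y) (ξ : N) : SemiInfLE b J (x, ξ) (y, ξ) := by
  change Relation.ReflTransGen (BruhatStep b) x y at h
  induction h with
  | refl => exact .refl
  | @tail c d _ hs ih =>
    have h1 : c ≼[b] d := Relation.ReflTransGen.single hs
    have hc := h1.isParabolic hy
    obtain ⟨i, h2, h3, rfl⟩ := bruhatStep_iff.mp hs
    refine (ih hc).tail ⟨i, 0, h2, isLevi_of_isParabolic ?_, hc, le_rfl, Or.inl h3, by simp⟩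
    simpa [← mul_assoc] using hc.inv.mul hy

/-- Converse of `SemiInfLE.exists_covered`: the product $(y*w)*s_k$ equals $zs_k$ for some $z\le
y*w$, and $(zs_k,0)\to(z,\alpha_k^\vee)$ is one step with $m=1$. -/
theorem Word.semiInfLE {J : Finset ι} (hJ : J ⊆ b.support) {γ : N} {w : P.weylGroup}
    (h : Word b γ w) (hγ : γ ∈ coneOn P J) {x y : P.weylGroup} (hy : IsParabolic b J y)
    (hx : x ≼[b] y ⋆[b] w) : SemiInfLE b J (x, 0) (y, γ) := by
  induction h generalizing x with
  | one => rw [star_one] at hx; exact hx.semiInfLE hy 0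
  | mul γ w k hk hw ih =>
    obtain ⟨h1, h2⟩ := mem_coneOn_of_add hJ hw.mem_corootCone (coroot_mem_corootCone hk) hγ
    have hkJ := (coroot_mem_coneOn_iff hJ hk).mp h2
    obtain ⟨z, h3, h4, _⟩ := exists_star_eq_mul (b := b) (y ⋆[b] w) (σ k)
    have hz : IsParabolic b J z := h3.isParabolic (hy.star (hw.isParabolic hJ h1))
    have hzk : IsParabolic b J (z * σ k) := hz.mul hkJ.isParabolic
    rw [← star_assoc, h4] at hx
    refine (hx.semiInfLE hzk 0).trans ?_
    have h5 := (ih h1 h3).translate (P.coroot k)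
    refine Relation.ReflTransGen.head ⟨k, 1, hk, hkJ, hzk, zero_le_one, Or.inr le_rfl, rfl⟩ ?_
    simpa [SemiInfLE, mul_ofIdx_cancel] using h5

theorem Covered.semiInfLE {J : Finset ι} (hJ : J ⊆ b.support) {γ : N} {w : P.weylGroup}
    (h : Covered b γ w) (hγ : γ ∈ coneOn P J) {x y : P.weylGroup} (hy : IsParabolic b J y)
    (hx : x ≼[b] y ⋆[b] w) : SemiInfLE b J (x, 0) (y, γ) := by
  obtain ⟨v, h1, h2⟩ := h
  exact h1.semiInfLE hJ hγ hy (hx.trans (star_mono (.refl _) h2))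

/-- Left multiplication by the affine reflection attached to `θ`. -/
def semiInfFlip (θ : ι) (u : P.weylGroup × N) : P.weylGroup × N :=
  (σ θ * u.1, u.2 - P.coroot (u.1⁻¹ • θ))

theorem semiInfFlip_flip (θ : ι) (u : P.weylGroup × N) :
    semiInfFlip θ (semiInfFlip θ u) = u := by
  refine Prod.ext ?_ ?_
  · exact ofIdx_mul_cancel θ u.1
  · change u.2 - P.coroot (u.1⁻¹ • θ) - P.coroot ((σ θ * u.1)⁻¹ • θ) = u.2
    rw [mul_inv_rev, ofIdx_inv, mul_smul, smul_neg_idx, coroot_neg_idx]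
    abel

variable {J : Finset ι} {θ : ι}

/-- The flip changes $m$ to $m+p$ with $p=\langle u\alpha_k,\theta^\vee\rangle$. Here $p\ge0$ if
$u\alpha_k$ is positive, and $p\ge-1$ if it is negative and not $-\theta$. The only obstruction is
$u\alpha_k=-\theta$ with $m=1$, where $p=-2$ and the step is the flip itself. -/
theorem SemiInfStep.flip (hθ : IsHighestRoot b J θ) {u v : P.weylGroup × N}
    (h : SemiInfStep b J u v) :
    v = semiInfFlip θ u ∨ SemiInfStep b J (semiInfFlip θ u) (semiInfFlip θ v) := by
  obtain ⟨k, m, hk, hkJ, hu, hm, hpos, rfl⟩ := h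
  set p := P.pairingIn ℤ (u.1 • k) θ with hp
  have hηJ : IsLevi b J (u.1 • k) := hkJ.smul hu
  have key : 0 ≤ m + p → (b.IsPos (σ θ • u.1 • k) ∨ 1 ≤ m + p) →
      SemiInfStep b J (semiInfFlip θ u)
        (semiInfFlip θ (u.1 * σ k, u.2 + (m : ℝ) • P.coroot k)) := by
    refine fun h1 h2 ↦ ⟨k, m + p, hk, hkJ, hθ.isLevi.isParabolic.mul hu, h1, ?_, ?_⟩
    · rwa [semiInfFlip, mul_smul]
    · refine Prod.ext (mul_assoc _ _ _).symm ?_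
      change u.2 + (m : ℝ) • P.coroot k - P.coroot ((u.1 * σ k)⁻¹ • θ) =
        u.2 - P.coroot (u.1⁻¹ • θ) + ((m + p : ℤ) : ℝ) • P.coroot k
      rw [mul_inv_rev, ofIdx_inv, mul_smul, coroot_ofIdx_smul, hp, pairingIn_smul_left]
      push_cast
      module
  by_cases hη : b.IsPos (u.1 • k)
  · right
    have h1 := hθ.nonneg _ hη hηJ
    refine key (by omega) ?_
    rcases h1.eq_or_lt with h2 | h2
    · left
      have h3 : σ θ • u.1 • k = u.1 • k := ofIdx_smul_of_pairingIn_eq_zero h2.symm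
      rwa [h3]
    · right
      omega
  · have hη' := not_isPos_iff.mp hη
    have hηJ' := hηJ.smul hηJ.isParabolic
    have h1 := hθ.nonneg _ hη' hηJ'
    have h2 := hθ.not_isPos _ hη' hηJ'
    have hm1 := hpos.resolve_left hη
    rw [pairingIn_neg_left] at h1 h2
    rw [isPos_smul_neg_idx, not_not] at h2
    by_cases hηθ : σ (u.1 • k) • u.1 • k = θ
    · have h3 : p = -2 := by
        have h4 := pairingIn_neg_left (P := P) (u.1 • k) θ
        rw [hηθ, pairingIn_same] at h4
        omega
      by_cases hm2 : m = 1
      · left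
        have h4 : u.1⁻¹ • θ = σ k • k := by
          rw [← hηθ, smul_neg_idx, inv_smul_smul]
        refine Prod.ext ?_ ?_
        · change u.1 * σ k = σ θ * u.1
          rw [mul_ofIdx, ← hηθ, ofIdx_neg_idx]
        · change u.2 + (m : ℝ) • P.coroot k = u.2 - P.coroot (u.1⁻¹ • θ)
          rw [h4, coroot_neg_idx, hm2]
          push_cast
          module
      · right
        exact key (by omega) (Or.inl (h2 (by omega)))
    · right
      have h3 := hθ.le_one _ hη' hηJ' hηθ
      rw [pairingIn_neg_left] at h3
      refine key (by omega) ?_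
      rcases h1.eq_or_lt with h4 | h4
      · right; omega
      · exact Or.inl (h2 h4)

theorem semiInfLE_flip (hθ : IsHighestRoot b J θ) {u : P.weylGroup × N}
    (hu : IsParabolic b J u.1) (h : ¬ b.IsPos (u.1⁻¹ • θ)) :
    SemiInfLE b J u (semiInfFlip θ u) := by
  refine Relation.ReflTransGen.single ⟨σ (u.1⁻¹ • θ) • u.1⁻¹ • θ, 1, not_isPos_iff.mp h, ?_, hu,
    zero_le_one, Or.inr le_rfl, ?_⟩
  · exact (hθ.isLevi.smul hu.inv).smul (hθ.isLevi.smul hu.inv).isParabolic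
  · refine Prod.ext ?_ ?_
    · change σ θ * u.1 = _
      rw [ofIdx_neg_idx, mul_ofIdx, smul_inv_smul]
    · change u.2 - P.coroot (u.1⁻¹ • θ) = _
      rw [coroot_neg_idx]
      push_cast
      module

theorem isPos_flip {u : P.weylGroup × N} :
    b.IsPos ((semiInfFlip θ u).1⁻¹ • θ) ↔ ¬ b.IsPos (u.1⁻¹ • θ) := by
  rw [semiInfFlip, mul_inv_rev, ofIdx_inv, mul_smul, isPos_smul_neg_idx]

theorem semiInfFlip_le (hθ : IsHighestRoot b J θ) {u : P.weylGroup × N}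
    (hu : IsParabolic b J u.1) (h : b.IsPos (u.1⁻¹ • θ)) :
    SemiInfLE b J (semiInfFlip θ u) u := by
  have h1 := semiInfLE_flip hθ (u := semiInfFlip θ u) (hθ.isLevi.isParabolic.mul hu)
    (by rw [isPos_flip]; exact not_not.mpr h)
  rwa [semiInfFlip_flip] at h1

open Classical in
/-- The smaller one of `u` and its flip. -/
def semiInfLo (b : P.Base) (θ : ι) (u : P.weylGroup × N) : P.weylGroup × N :=
  if b.IsPos (u.1⁻¹ • θ) then semiInfFlip θ u else u

open Classical in
/-- The larger one of `u` and its flip. -/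
def semiInfHi (b : P.Base) (θ : ι) (u : P.weylGroup × N) : P.weylGroup × N :=
  if b.IsPos (u.1⁻¹ • θ) then u else semiInfFlip θ u

theorem SemiInfStep.lo_hi (hθ : IsHighestRoot b J θ) {u v : P.weylGroup × N}
    (h : SemiInfStep b J u v) : SemiInfLE b J (semiInfLo b θ u) (semiInfLo b θ v) ∧
      SemiInfLE b J (semiInfHi b θ u) (semiInfHi b θ v) := by
  have huv : SemiInfLE b J u v := .single h
  have hu : IsParabolic b J u.1 := by
    obtain ⟨_, _, _, _, h1, _⟩ := h
    exact h1
  have hv : IsParabolic b J v.1 := by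
    obtain ⟨_, _, _, h1, _, _, _, rfl⟩ := h
    exact hu.mul h1.isParabolic
  rcases h.flip hθ with rfl | h1
  · have h2 := isPos_flip (b := b) (θ := θ) (u := u)
    by_cases hpos : b.IsPos (u.1⁻¹ • θ)
    · rw [semiInfLo, semiInfLo, semiInfHi, semiInfHi, if_pos hpos, if_pos hpos,
        if_neg (by rw [h2]; exact not_not.mpr hpos), if_neg (by rw [h2]; exact not_not.mpr hpos),
        semiInfFlip_flip]
      exact ⟨.refl, .refl⟩
    · rw [semiInfLo, semiInfLo, semiInfHi, semiInfHi, if_neg hpos, if_neg hpos,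
        if_pos (h2.mpr hpos), if_pos (h2.mpr hpos), semiInfFlip_flip]
      exact ⟨.refl, .refl⟩
  · replace h1 : SemiInfLE b J _ _ := .single h1
    by_cases hup : b.IsPos (u.1⁻¹ • θ) <;> by_cases hvp : b.IsPos (v.1⁻¹ • θ)
    · rw [semiInfLo, semiInfLo, semiInfHi, semiInfHi, if_pos hup, if_pos hup, if_pos hvp,
        if_pos hvp]
      exact ⟨h1, huv⟩
    · rw [semiInfLo, semiInfLo, semiInfHi, semiInfHi, if_pos hup, if_pos hup, if_neg hvp,
        if_neg hvp]
      exact ⟨(semiInfFlip_le hθ hu hup).trans huv, huv.trans (semiInfLE_flip hθ hv hvp)⟩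
    · rw [semiInfLo, semiInfLo, semiInfHi, semiInfHi, if_neg hup, if_neg hup, if_pos hvp,
        if_pos hvp]
      exact ⟨(semiInfLE_flip hθ hu hup).trans h1, h1.trans (semiInfFlip_le hθ hv hvp)⟩
    · rw [semiInfLo, semiInfLo, semiInfHi, semiInfHi, if_neg hup, if_neg hup, if_neg hvp,
        if_neg hvp]
      exact ⟨huv, h1⟩

theorem SemiInfLE.lo (hθ : IsHighestRoot b J θ) {u v : P.weylGroup × N}
    (h : SemiInfLE b J u v) : SemiInfLE b J (semiInfLo b θ u) (semiInfLo b θ v) := by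
  induction h with
  | refl => exact .refl
  | tail _ hs ih => exact ih.trans (hs.lo_hi hθ).1

theorem SemiInfLE.hi (hθ : IsHighestRoot b J θ) {u v : P.weylGroup × N}
    (h : SemiInfLE b J u v) : SemiInfLE b J (semiInfHi b θ u) (semiInfHi b θ v) := by
  induction h with
  | refl => exact .refl
  | tail _ hs ih => exact ih.trans (hs.lo_hi hθ).2

end SemiInfinite

/-! ### Existence of a least covering weight -/

section Least

variable {b : P.Base} [Fintype ι] [P.IsCrystallographic] [P.IsReduced] {J : Finset ι} {θ : ι}

/-- `ω` is the least weight of a Demazure product of reflections lying above `x`. -/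
def IsLeastWeight (b : P.Base) (x : P.weylGroup) (ω : N) : Prop :=
  Covered b ω x ∧ ∀ γ, Covered b γ x → γ - ω ∈ corootCone b

theorem IsHighestRoot.semiInfLE_of_covered (hJ : J ⊆ b.support) (hθ : IsHighestRoot b J θ)
    {x : P.weylGroup} {γ : N} (h : Covered b γ x) (hγ : γ ∈ coneOn P J) :
    SemiInfLE b J (semiInfLo b θ (x, 0)) (σ θ, γ - P.coroot θ) := by
  have h1 := h.semiInfLE hJ hγ (x := x) (.one J) (by rw [one_star]; exact .refl x)
  have h2 := h1.lo hθ
  have h3 : semiInfLo b θ ((1 : P.weylGroup), γ) = (σ θ, γ - P.coroot θ) := by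
    rw [semiInfLo, if_pos (by simpa using hθ.isPos), semiInfFlip, mul_one, inv_one, one_smul]
  rwa [h3] at h2

theorem exists_covered (x : P.weylGroup) : ∃ γ, Covered b γ x := by
  obtain ⟨l, h1, h2, rfl⟩ := exists_reduced_word (b := b) x
  clear h2
  induction l using List.reverseRecOn with
  | nil => exact ⟨0, Word.one.covered⟩
  | append_singleton l j ih =>
    obtain ⟨γ, hγ⟩ := ih fun k hk ↦ h1 k (by simp [hk])
    refine ⟨γ + P.coroot j, (hγ.simple (h1 j (by simp))).of_le ?_⟩
    simpa using mul_bruhatLE_star (b := b) (l.map σ).prod (σ j)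

theorem isLeastWeight_one : IsLeastWeight b (1 : P.weylGroup) 0 :=
  ⟨Word.one.covered, fun γ h ↦ by rw [sub_zero]; exact h.mem_corootCone⟩

/-- The restricted weight still covers $x$, so by minimality it is the whole weight. -/
theorem IsLeastWeight.mem_coneOn (hJ : J ⊆ b.support) {x : P.weylGroup} {ω : N}
    (h : IsLeastWeight b x ω) (hx : IsParabolic b J x) : ω ∈ coneOn P J := by
  have h1 := h.2 _ (hx.covered_restrict hJ h.1)
  have h2 := sub_restrict_mem hJ h.1.mem_corootCone
  have h3 := corootCone_antisymm h1 (by rwa [neg_sub])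
  rw [sub_eq_zero] at h3
  rw [← h3]
  exact restrict_mem_coneOn hJ h.1.mem_corootCone

theorem isLeastWeight_of_coneOn (hJ : J ⊆ b.support) {x : P.weylGroup} (hx : IsParabolic b J x)
    {ω : N} (h : Covered b ω x)
    (h' : ∀ γ ∈ coneOn P J, Covered b γ x → γ - ω ∈ corootCone b) : IsLeastWeight b x ω := by
  refine ⟨h, fun γ hγ ↦ ?_⟩
  have h1 := h' _ (restrict_mem_coneOn hJ hγ.mem_corootCone) (hx.covered_restrict hJ hγ)
  have h2 := add_mem (sub_restrict_mem hJ hγ.mem_corootCone) h1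
  rwa [sub_add_sub_cancel] at h2

/-- Taking lower flips turns $(x,0)\le(1,\gamma)$ into a relation below
$(s_\theta,\gamma-\theta^\vee)$, and the adjoint of $s_\theta*\cdot$ turns that into a covering
condition on another element of the subgroup. The weight drops by $\theta^\vee$ if $x^{-1}\theta$ is
negative and by $\theta^\vee-(x^{-1}\theta)^\vee$ otherwise. This drop vanishes only if $x$ fixes
$\theta$, the case handed to `hfix`. -/
theorem IsHighestRoot.exists_isLeastWeight (hJ : J ⊆ b.support) (hθ : IsHighestRoot b J θ)
    (hfix : ∀ x : P.weylGroup, IsParabolic b J x → x • θ = θ → ∃ ω, IsLeastWeight b x ω)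
    {γ : N} (hγ : γ ∈ coneOn P J) {x : P.weylGroup} (hx : IsParabolic b J x)
    (h : Covered b γ x) : ∃ ω, IsLeastWeight b x ω := by
  refine corootCone_induction (b := b) (p := fun γ ↦ γ ∈ coneOn P J → ∀ x : P.weylGroup,
    IsParabolic b J x → Covered b γ x → ∃ ω, IsLeastWeight b x ω)
    (fun γ _ ih hγ x hx h ↦ ?_) (coneOn_mono hJ hγ) hγ x hx h
  have hθP := hθ.isLevi.isParabolic
  have hθJ : P.coroot θ ∈ coneOn P J := (coroot_mem_coneOn_iff hJ hθ.isPos).mpr hθ.isLevi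
  have hθ1 := one_le_corootHeight_coroot hθ.isPos
  by_cases hxθ : b.IsPos (x⁻¹ • θ)
  · by_cases hfx : x • θ = θ
    · exact hfix x hx hfx
    have hfx' : x⁻¹ • θ ≠ θ := fun h1 ↦ hfx (by rw [← h1, smul_inv_smul, h1])
    set μ := P.coroot (x⁻¹ • θ) with hμ
    have hd : P.coroot θ - μ ∈ coneOn P J := hθ.sub_smul_mem hJ hx.inv
    have hd0 : P.coroot θ - μ ≠ 0 := fun h0 ↦
      hfx' (P.coroot.injective (sub_eq_zero.mp h0)).symm
    have hlo : semiInfLo b θ (x, (0 : N)) = (σ θ * x, -μ) := by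
      rw [semiInfLo, if_pos hxθ, semiInfFlip, zero_sub]
    have hy : IsParabolic b J (σ θ * x) := hθP.mul hx
    have hyθ : (σ θ * x)⁻¹ • θ = σ (x⁻¹ • θ) • x⁻¹ • θ := by
      rw [mul_inv_rev, ofIdx_inv, mul_smul, smul_neg_idx]
    obtain ⟨y', hadj, hpar⟩ := exists_star_adjoint (b := b) (σ θ) (σ θ * x)
    have hdown : ∀ γ ∈ coneOn P J, Covered b γ x → Covered b (γ - (P.coroot θ - μ)) y' := by
      intro γ hγ h
      have h1 := hθ.semiInfLE_of_covered hJ h hγ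
      rw [hlo] at h1
      obtain ⟨w, h2, h3⟩ := h1.exists_covered
      have h4 : γ - P.coroot θ - -μ = γ - (P.coroot θ - μ) := by abel
      exact ((h4 ▸ h2)).of_le ((hadj w).mp h3)
    -- For the converse, taking upper flips brings $s_\theta x$ and $s_\theta$ back to $x$ and $1$.
    have hup : ∀ γ ∈ coneOn P J, Covered b γ y' → Covered b (γ + (P.coroot θ - μ)) x := by
      intro γ hγ h
      obtain ⟨w, h1, h2⟩ := h
      have h3 := (h1.semiInfLE hJ hγ hθP ((hadj w).mpr h2)).hi hθ
      rw [semiInfHi, semiInfHi, if_neg (by rw [hyθ, isPos_neg_idx]; exact not_not.mpr hxθ),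
        if_neg (by rw [ofIdx_inv, isPos_neg_idx]; exact not_not.mpr hθ.isPos)] at h3
      obtain ⟨v, h4, h5⟩ := h3.exists_covered
      simp only [semiInfFlip, hyθ, ofIdx_inv, coroot_neg_idx, ofIdx_mul_cancel, ofIdx_mul_self,
        one_star] at h4 h5
      have h6 : γ - -P.coroot θ - (0 - -P.coroot (x⁻¹ • θ)) = γ + (P.coroot θ - μ) := by
        rw [hμ]; abel
      exact (h6 ▸ h4).of_le h5
    have h1 := hdown γ hγ h
    have h2 := (mem_coneOn_of_add hJ h1.mem_corootCone (coneOn_mono hJ hd)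
      (by rwa [sub_add_cancel])).1
    obtain ⟨ω, hω⟩ := ih _ h1.mem_corootCone (by
      have := one_le_corootHeight (b := b) (coneOn_mono hJ hd) hd0
      rw [map_sub (corootHeight b) γ]
      linarith) h2 y' (hpar J hy) h1
    refine ⟨ω + (P.coroot θ - μ), isLeastWeight_of_coneOn hJ hx
      (hup ω (hω.mem_coneOn hJ (hpar J hy)) hω.1) fun γ hγ h ↦ ?_⟩
    have := hω.2 _ (hdown γ hγ h)
    rwa [sub_sub, add_comm (P.coroot θ - μ)] at this
  · obtain ⟨x', hadj, hpar⟩ := exists_star_adjoint (b := b) (σ θ) x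
    have hdown : ∀ γ ∈ coneOn P J, Covered b γ x → Covered b (γ - P.coroot θ) x' := by
      intro γ hγ h
      have h1 := hθ.semiInfLE_of_covered hJ h hγ
      rw [semiInfLo, if_neg hxθ] at h1
      obtain ⟨w, h2, h3⟩ := h1.exists_covered
      rw [sub_zero] at h2
      exact h2.of_le ((hadj w).mp h3)
    have h1 := hdown γ hγ h
    have h2 := (mem_coneOn_of_add hJ h1.mem_corootCone (coneOn_mono hJ hθJ)
      (by rwa [sub_add_cancel])).1
    obtain ⟨ω, hω⟩ := ih _ h1.mem_corootCone (by rw [map_sub]; linarith) h2 x' (hpar J hx) h1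
    refine ⟨P.coroot θ + ω, isLeastWeight_of_coneOn hJ hx ?_ fun γ hγ h ↦ ?_⟩
    -- No flip is needed here: a prefixed $s_\theta$ costs exactly $\theta^\vee$.
    · obtain ⟨w, h3, h4⟩ := hω.1
      exact ((covered_ofIdx hθ.isPos).star h3.covered).of_le ((hadj w).mpr h4)
    · rw [← sub_sub]
      exact hω.2 _ (hdown γ hγ h)

/-- The stabilizer of $\theta$ lies in the parabolic subgroup of the simple roots in `J` orthogonal
to $\theta$. These form a proper subset of `J`, so strong induction on `J` settles the fixed case.
-/
theorem IsParabolic.exists_isLeastWeight (hJ : J ⊆ b.support) {x : P.weylGroup}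
    (hx : IsParabolic b J x) : ∃ ω, IsLeastWeight b x ω := by
  classical
  induction J using Finset.strongInduction generalizing x with
  | H J ih =>
    rcases J.eq_empty_or_nonempty with rfl | hne
    · have hx1 : x = 1 := by
        by_contra hx1
        obtain ⟨j, hj, hjx⟩ := exists_not_isPos_smul (b := b) hx1
        exact absurd (hx.mem_of_not_isPos hj hjx) (Finset.notMem_empty j)
      exact ⟨0, hx1 ▸ isLeastWeight_one⟩
    · obtain ⟨θ, hθ⟩ := exists_isHighestRoot hJ hne
      obtain ⟨γ, hγ⟩ := exists_covered (b := b) x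
      refine hθ.exists_isLeastWeight hJ (fun y hy hyθ ↦ ?_)
        (restrict_mem_coneOn hJ hγ.mem_corootCone) hx (hx.covered_restrict hJ hγ)
      obtain ⟨j, hj, hjθ⟩ := hθ.exists_pairingIn_ne_zero
      refine ih {j ∈ J | P.pairingIn ℤ j θ = 0} ?_ ((Finset.filter_subset _ _).trans hJ)
        (hθ.isParabolic_of_smul_eq hJ (fun i hi hi0 ↦ ?_) hy hyθ)
      · refine Finset.ssubset_iff_subset_ne.mpr ⟨Finset.filter_subset _ _, fun h ↦ hjθ ?_⟩
        rw [← h] at hj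
        exact (Finset.mem_filter.mp hj).2
      · exact Finset.mem_filter.mpr ⟨hi, hi0⟩

theorem exists_isLeastWeight (x : P.weylGroup) : ∃ ω, IsLeastWeight b x ω :=
  (isParabolic_support x).exists_isLeastWeight subset_rfl

theorem IsLeastWeight.covered_iff {x : P.weylGroup} {ω : N} (h : IsLeastWeight b x ω) {γ : N} :
    Covered b γ x ↔ γ - ω ∈ corootCone b :=
  ⟨h.2 γ, h.1.mono⟩

end Least

/-! ### Paths in the quantum Bruhat graph -/

section QuantumBruhatGraph

variable {b : P.Base} [Fintype ι] [P.IsCrystallographic] [P.IsReduced]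

theorem pairingIn_pos_of_not_isPos {δ η : ι} (hδ : b.IsPos δ) (hη : b.IsPos η)
    (h : ¬ b.IsPos (σ δ • η)) : 0 < P.pairingIn ℤ η δ := by
  by_contra! hcon
  refine h (isPos_of_mem_closure ?_)
  have : P.root (σ δ • η) = P.root η + ((-P.pairingIn ℤ η δ : ℤ) : ℝ) • P.root δ := by
    rw [root_ofIdx_smul]
    push_cast
    module
  rw [this]
  exact add_mem (root_mem_of_isPos hη) (nsmul_root_mem hδ (by omega))

/-- In $\langle\delta^\vee,2\rho\rangle$, written as a sum over the inversions of $s_\delta$, the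
root $\delta$ contributes $2$ and every other inversion exactly $1$. -/
theorem IsQuantumRoot.length_ofIdx {δ : ι} (h : IsQuantumRoot b δ) (hδ : b.IsPos δ) :
    (length b (σ δ) : ℝ) + 1 = P.toLinearMap (twoRho b) (P.coroot δ) := by
  classical
  have hmem : δ ∈ inversions b (σ δ) :=
    mem_inversions.mpr ⟨hδ, by rw [isPos_neg_idx]; exact not_not.mpr hδ⟩
  have h1 : ∀ i ∈ (inversions b (σ δ)).erase δ, (P.pairingIn ℤ i δ : ℝ) = 1 := fun i hi ↦ by
    obtain ⟨hne, hi⟩ := Finset.mem_erase.mp hi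
    obtain ⟨hi, hneg⟩ := mem_inversions.mp hi
    have h2 := h i hi hne hneg
    have h3 := pairingIn_pos_of_not_isPos hδ hi hneg
    have h4 : P.pairingIn ℤ i δ = 1 := by omega
    rw [h4, Int.cast_one]
  rw [twoRho_apply_coroot, length_eq_card, ← Finset.add_sum_erase _ _ hmem,
    Finset.sum_congr rfl h1, ← Finset.card_erase_add_one hmem, Finset.sum_const, pairingIn_same]
  push_cast
  rw [nsmul_eq_mul]
  ring

/-- A Bruhat edge moves up in the order, and a quantum edge gives $x\le(xs_i)*s_i$. The edge count
telescopes because the lengths change by $1$ and by $1-2\,\mathrm{ht}(\alpha_i^\vee)$ respectively.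
-/
theorem IsPath.covered {x : P.weylGroup} {n : ℕ} {ω : N} (h : IsPath b x 1 n ω) :
    Covered b ω x ∧ (n : ℝ) = 2 * corootHeight b ω - length b x := by
  generalize hy : (1 : P.weylGroup) = y at h
  induction h with
  | nil x =>
    subst hy
    exact ⟨Word.one.covered, by simp [length_one]⟩
  | bruhat x y i n ω hi _ ih =>
    obtain ⟨h1, h2⟩ := ih hy
    refine ⟨h1.of_le (Relation.ReflTransGen.single ⟨i, rfl, by rw [hi.2]; omega⟩), ?_⟩
    rw [hi.2] at h2
    push_cast at h2 ⊢
    linarith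
  | quantum x y i n ω hi _ ih =>
    obtain ⟨h1, h2⟩ := ih hy
    constructor
    · rw [add_comm]
      refine (h1.star (covered_ofIdx hi.1)).of_le ?_
      simpa [mul_ofIdx_cancel] using mul_bruhatLE_star (b := b) (x * σ i) (σ i)
    · rw [hi.2, twoRho_apply (coroot_mem_corootLattice i)] at h2
      rw [map_add]
      push_cast
      linarith

theorem CoverChain.exists_isPath {x y z : P.weylGroup} (h : CoverChain b x y) {n : ℕ} {ω : N}
    (hp : IsPath b y z n ω) : ∃ m, IsPath b x z m ω := by
  induction h using Relation.ReflTransGen.head_induction_on with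
  | refl => exact ⟨n, hp⟩
  | head hs _ ih =>
    obtain ⟨i, hi, rfl, hlen⟩ := hs
    obtain ⟨m, hm⟩ := ih
    exact ⟨m + 1, .bruhat _ _ i _ _ ⟨hi, hlen⟩ hm⟩

/-- Write $z*s_\delta=us_\delta$ with $u\le z$ and lengths adding. Then $us_\delta\to u$ is a
quantum edge; before it the path climbs from $x$ by Bruhat edges, and after it the induction
continues from $u$. -/
theorem IsGreedy.exists_isPath {γ : N} {z : P.weylGroup} (h : IsGreedy b γ z) {x : P.weylGroup}
    (hx : x ≼[b] z) : ∃ n ω, IsPath b x 1 n ω ∧ γ - ω ∈ corootCone b := by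
  induction h generalizing x with
  | zero =>
    rw [bruhatLE_one_iff.mp hx]
    exact ⟨0, 0, .nil 1, by rw [sub_zero]; exact zero_mem _⟩
  | step γ δ z hδ hz ih =>
    rw [demazure_eq_star] at hx
    obtain ⟨u, h1, h2, h3⟩ := exists_star_eq_mul (b := b) z (σ δ)
    obtain ⟨n, ω, h4, h5⟩ := ih h1
    rw [h2] at hx
    have h6 : IsQuantumEdge b (u * σ δ) δ := by
      refine ⟨hδ.1.1, ?_⟩
      rw [mul_ofIdx_cancel, h3, ← (isQuantumRoot_of_isMaximalRoot hδ).length_ofIdx hδ.1.1]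
      push_cast
      ring
    obtain ⟨m, hm⟩ := hx.coverChain.exists_isPath
      (IsPath.quantum _ 1 δ n ω h6 (by rwa [mul_ofIdx_cancel]))
    exact ⟨m, _, hm, by rwa [← sub_sub]⟩

theorem Covered.exists_isPath {γ : N} {x : P.weylGroup} (h : Covered b γ x) :
    ∃ n ω, IsPath b x 1 n ω ∧ γ - ω ∈ corootCone b := by
  obtain ⟨z, hz⟩ := exists_isGreedy h.mem_corootCone
  exact hz.exists_isPath ((hz.covered_iff x).mp h)

/-- The number of edges depends only on the height of the weight and grows with it, and any weight
strictly above the least one has greater height. -/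
theorem IsLeastWeight.isShortestPathWeight_iff {x : P.weylGroup} {ω ω' : N}
    (h : IsLeastWeight b x ω) : IsShortestPathWeight b x 1 ω' ↔ ω' = ω := by
  obtain ⟨n, ω₀, hp, h1⟩ := h.1.exists_isPath
  obtain ⟨h2, hn⟩ := hp.covered
  obtain rfl : ω₀ = ω :=
    sub_eq_zero.mp (corootCone_antisymm (h.2 _ h2) (by rwa [neg_sub]))
  constructor
  · rintro ⟨n', hp', hmin⟩
    obtain ⟨h3, hn'⟩ := hp'.covered
    have h4 : (n' : ℝ) ≤ n := by exact_mod_cast hmin n ω₀ hp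
    by_contra hne
    have h5 := one_le_corootHeight (h.2 _ h3) (sub_ne_zero.mpr hne)
    rw [map_sub] at h5
    linarith
  · rintro rfl
    refine ⟨n, hp, fun n' ω' hp' ↦ ?_⟩
    obtain ⟨h3, hn'⟩ := hp'.covered
    have h4 := corootHeight_nonneg (h.2 _ h3)
    rw [map_sub] at h4
    have h5 : (n : ℝ) ≤ n' := by linarith
    exact_mod_cast h5

theorem existsUnique_isShortestPathWeight (x : P.weylGroup) :
    ∃! ω : N, IsShortestPathWeight b x 1 ω := by
  obtain ⟨ω, hω⟩ := exists_isLeastWeight (b := b) x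
  exact ⟨ω, hω.isShortestPathWeight_iff.mpr rfl, fun _ h ↦ hω.isShortestPathWeight_iff.mp h⟩

theorem corootLE_wt_iff {x : P.weylGroup} {γ : N} :
    CorootLE b (wt b x 1) γ ↔ Covered b γ x := by
  obtain ⟨ω, hω⟩ := exists_isLeastWeight (b := b) x
  have h : wt b x 1 = ω := hω.isShortestPathWeight_iff.mp
    (Classical.epsilon_spec (p := IsShortestPathWeight b x 1)
      ⟨ω, hω.isShortestPathWeight_iff.mpr rfl⟩)
  rw [h, hω.covered_iff, CorootLE]

theorem IsGreedy.isBruhatMax {γ : N} {z : P.weylGroup} (h : IsGreedy b γ z) :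
    IsBruhatMax b {x : P.weylGroup | CorootLE b (wt b x 1) γ} z :=
  ⟨corootLE_wt_iff.mpr ((h.covered_iff z).mpr (.refl z)),
    fun x hx ↦ (h.covered_iff x).mp (corootLE_wt_iff.mp hx)⟩

end QuantumBruhatGraph

end QuantumBruhat

end

theorem theorem3 {ι M N : Type*} [Fintype ι] [AddCommGroup M] [Module ℝ M]
    [AddCommGroup N] [Module ℝ N] (P : RootPairing ι ℝ M N)
    [P.IsCrystallographic] [P.IsReduced] (b : P.Base)
    (γ : N) (hγ : γ ∈ QuantumBruhat.corootCone b) :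
    -- the Demazure product and the weight `wt(x, 1)` are well defined
    (∀ u v : P.weylGroup, ∃! w : P.weylGroup, QuantumBruhat.IsDemazureProduct b u v w) ∧
    (∀ x : P.weylGroup, ∃! ω : N, QuantumBruhat.IsShortestPathWeight b x 1 ω) ∧
    -- `z_γ` is well defined (it exists and does not depend on the choices of maximal roots)
    (∃! z : P.weylGroup, QuantumBruhat.IsGreedy b γ z) ∧
    -- `z_γ` is the maximum
    (∀ z : P.weylGroup, QuantumBruhat.IsGreedy b γ z →
      QuantumBruhat.IsBruhatMax b
        {x : P.weylGroup | QuantumBruhat.CorootLE b (QuantumBruhat.wt b x 1) γ} z) := by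
  obtain ⟨z, hz⟩ := QuantumBruhat.exists_isGreedy hγ
  exact ⟨QuantumBruhat.existsUnique_isDemazureProduct,
    QuantumBruhat.existsUnique_isShortestPathWeight,
    ⟨z, hz, fun _ h ↦ h.unique hz⟩, fun _ h ↦ h.isBruhatMax⟩
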